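/- All graphs are finite, undirected and simple; a graph is 2-connected if it has at least three vertices, is connected, and stays connected when any single vertex is deleted; and a graph contains cycles of all lengths modulo $4$ if for every integer $r\ge 0$ it contains a cycle whose length is congruent to $r$ modulo $4$. Let $G$ be a $2$-connected non-bipartite graph of minimum degree at least $4$. Then $G$ contains cycles of all lengths modulo $4$, with the sole exception of the complete graph $K_5$: if $G$ is not isomorphic to $K_5$, then $G$ contains cycles of all lengths modulo $4$, while $K_5$ does not. Moreover, minimum degree $3$ does not suffice: for every integer $t\ge 1$, let $H_t$ be the graph obtained from two vertex-disjoint paths $v_0v_1\ldots v_{2t+1}$ and $u_0u_1\ldots u_{2t+1}$ by adding the edges $v_{2i}u_{2i+1}$ and $u_{2i}v_{2i+1}$ for $i=0,1,\ldots,t$, together with the edges $u_0v_0$ and $u_{2t+1}v_{2t+1}$. Then $H_t$ is a $2$-connected non-bipartite graph of minimum degree $3$ that contains no cycle of length congruent to $1$ modulo $4$. -/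

import Mathlib

/-- A graph is 2-connected if it has at least three vertices, is connected, and remains connected
when any one vertex is deleted (that is, it has no cut-vertex). -/
def SimpleGraph.TwoConnected {V : Type*} (G : SimpleGraph V) : Prop :=
  3 ≤ ENat.card V ∧ G.Connected ∧ ∀ v : V, (G.induce ({v}ᶜ : Set V)).Connected

/-- `G` contains a cycle whose length is congruent to `r` modulo `k`. -/
def SimpleGraph.HasCycleMod {V : Type*} (G : SimpleGraph V) (r k : ℕ) : Prop :=
  ∃ (v : V) (c : G.Walk v v), c.IsCycle ∧ c.length ≡ r [MOD k]

/-- `G` contains cycles of all lengths modulo `k`. -/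
def SimpleGraph.HasCyclesOfAllLengthsMod {V : Type*} (G : SimpleGraph V) (k : ℕ) : Prop :=
  ∀ r : ℕ, G.HasCycleMod r k

/-- The edges of `graphH t`, each listed in one direction. The vertex `(false, i)` is `v i` and
`(true, i)` is `u i`, for `0 ≤ i ≤ 2 * t + 1`. The three cases are: the edges of the two paths;
the edges `v (2 * i) -- u (2 * i + 1)` and `u (2 * i) -- v (2 * i + 1)`; and the two edges
`u 0 -- v 0` and `u (2 * t + 1) -- v (2 * t + 1)`. -/
def graphHRel (t : ℕ) (x y : Bool × Fin (2 * t + 2)) : Prop :=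
  (x.1 = y.1 ∧ x.2.val + 1 = y.2.val) ∨
  (x.1 ≠ y.1 ∧ Even x.2.val ∧ x.2.val + 1 = y.2.val) ∨
  (x.1 ≠ y.1 ∧ x.2 = y.2 ∧ (x.2.val = 0 ∨ x.2.val = 2 * t + 1))

instance (t : ℕ) : DecidableRel (graphHRel t) := fun x y => by
  unfold graphHRel; infer_instance

/-- The graph obtained from two disjoint paths `v 0, …, v (2 * t + 1)` and `u 0, …, u (2 * t + 1)`
by adding the edges `v (2 * i) -- u (2 * i + 1)` and `u (2 * i) -- v (2 * i + 1)` for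
`0 ≤ i ≤ t`, together with `u 0 -- v 0` and `u (2 * t + 1) -- v (2 * t + 1)`. -/
def graphH (t : ℕ) : SimpleGraph (Bool × Fin (2 * t + 2)) :=
  SimpleGraph.fromRel (graphHRel t)

instance (t : ℕ) : DecidableRel (graphH t).Adj := fun x y =>
  decidable_of_iff (x ≠ y ∧ (graphHRel t x y ∨ graphHRel t y x))
    (SimpleGraph.fromRel_adj (graphHRel t) x y).symm

/-! Lengths are weights in `ZMod 4`. Suppose first that G is 3-connected. Then some odd cycle C is
induced and non-separating, and each of its vertices has a neighbour off C: a frame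
(`KConn.exists_frame`). Two vertices of C cut it into an even and an odd arc, so a path of weight p
off C that attaches to them closes up to cycles of weights p + s and p + s + L, where L is odd and s
depends only on the attachments. Two such paths whose weights differ by 2 therefore give all
residues. If a residue is missing, then Menger's theorem, which supplies disjoint links to C, shows
that no cycle off C has weight 2 and that all odd cycles off C have the same weight
(`IsFrame.weight_ne_two`, `IsFrame.weight_eq`). Consequently a theta graph off C with one odd path
has its other two paths even (`IsFrame.theta_even`).

Now take a longest path off C. Rotating it and applying the theta restriction shows that its end has
at most two neighbours off C (`IsFrame.card_nbrs_le_two`), hence at least two on C. Two attachments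
of one vertex give all residues unless C is a triangle (`IsFrame.full_of_two_attachments`). Through
a triangle, a path between suitably attached vertices closes up in three consecutive weights, so two
paths of different weights suffice (`IsFrame.full_of_ne`); what survives is the complete graph on
five vertices.

If G is only 2-connected, let M be an inclusion-minimal side of a 2-separation {x, y}. The graph
induced on M, x and y, with the edge xy added, is 3-connected, and xy stands for an x-y path through
the rest of G. This edge gets the weight g of that path, and only x and y may have small degree;
hence the general weights. If an odd cycle avoids M, such paths exist in both parities, and
`KConn.fullPair` realises every residue with one of the two weights. Otherwise a second minimal side
is taken beyond M. Either the same argument applies there, or that side with its boundary carries no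
odd cycle; then all odd cycles of its side graph pass through both boundary vertices and
`KConn.full_of_forall_mem` applies.

The complete graph on five vertices has no cycle of length 2 modulo 4, for lack of vertices. In H_t,
deleting the two vertical edges leaves a graph that is bipartite by columns, in which a path joining
the two vertices of an end column has length 2 modulo 4. Cycles with exactly one vertical edge thus
have length 3 modulo 4, and all others are even. -/

namespace SimpleGraph

/-! ### Weighted paths and cycles with prescribed vertex sets. -/

variable {V : Type*} [DecidableEq V] {M N : Type*}

/-- `PathOn G w S a b n`: there is a path of `G` from `a` to `b` with vertex set exactly `S` whose
edge weights sum to `n`. -/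
inductive PathOn (G : SimpleGraph V) [AddCommMonoid M] (w : Sym2 V → M) :
    Finset V → V → V → M → Prop
  | nil (a : V) : PathOn G w {a} a a 0
  | cons {S : Finset V} {a b c : V} {n : M} (hab : G.Adj a b) (ha : a ∉ S)
      (hp : PathOn G w S b c n) : PathOn G w (insert a S) a c (w s(a, b) + n)

/-- `CycleOn G w S n`: there is a cycle of `G` with vertex set exactly `S` and weight `n`. -/
def CycleOn (G : SimpleGraph V) [AddCommMonoid M] (w : Sym2 V → M) (S : Finset V) (n : M) : Prop :=
  ∃ a b m, G.Adj b a ∧ PathOn G w S a b m ∧ 3 ≤ S.card ∧ n = m + w s(b, a)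

namespace PathOn

variable {G : SimpleGraph V} [AddCommMonoid M] [AddCommMonoid N] {w : Sym2 V → M}
  {S T : Finset V} {a b c d r : V} {n m : M}

theorem congr (h : PathOn G w S a b n) (hS : S = T) (hn : n = m) : PathOn G w T a b m := by
  subst hS hn; exact h

theorem left_mem (h : PathOn G w S a b n) : a ∈ S := by
  cases h <;> simp

theorem right_mem (h : PathOn G w S a b n) : b ∈ S := by
  induction h with
  | nil a => simp
  | cons hab ha hp ih => simp [ih]

theorem edge (h : G.Adj a b) : PathOn G w {a, b} a b (w s(a, b)) :=
  (PathOn.cons h (by simpa using h.ne) (PathOn.nil b)).congr rfl (by simp)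

theorem append (h₁ : PathOn G w S a b n) (h₂ : PathOn G w T b c m)
    (hd : ∀ v ∈ S, v ∈ T → v = b) : PathOn G w (S ∪ T) a c (n + m) := by
  induction h₁ with
  | nil a => exact h₂.congr (by have := h₂.left_mem; ext v; simp; grind) (by simp)
  | @cons S a a' b n hab ha hp ih =>
    have h3 := ih h₂ (fun v hv hv' => hd v (by simp [hv]) hv')
    have : a ∉ S ∪ T := by
      intro h
      rcases Finset.mem_union.1 h with h | h
      · exact ha h
      · have := hd a (by simp) h
        subst this
        exact ha hp.right_mem
    exact (PathOn.cons hab this h3).congr (by simp) (by rw [add_assoc])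

theorem join (h₁ : PathOn G w S a b n) (h : G.Adj b c) (h₂ : PathOn G w T c d m)
    (hd : Disjoint S T) : PathOn G w (S ∪ T) a d (n + w s(b, c) + m) := by
  have hb : b ∉ T := Finset.disjoint_left.1 hd h₁.right_mem
  have := h₁.append (PathOn.cons h hb h₂) (by
    intro v hv hv'
    rcases Finset.mem_insert.1 hv' with h | h
    · exact h
    · exact absurd h (Finset.disjoint_left.1 hd hv))
  exact this.congr (by have := h₁.right_mem; ext v; simp; grind) (by rw [add_assoc])

theorem reverse (h : PathOn G w S a b n) : PathOn G w S b a n := by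
  induction h with
  | nil a => exact .nil a
  | @cons S a a' b n hab ha hp ih =>
    have := ih.join hab.symm (PathOn.nil a) (by simpa using ha)
    exact this.congr (by ext v; simp) (by rw [add_zero, Sym2.eq_swap, add_comm])

theorem split (h : PathOn G w S a b n) (hr : r ∈ S) :
    ∃ S₁ S₂ n₁ n₂, PathOn G w S₁ a r n₁ ∧ PathOn G w S₂ r b n₂ ∧ S₁ ∪ S₂ = S ∧
      (∀ v ∈ S₁, v ∈ S₂ → v = r) ∧ n = n₁ + n₂ := by
  induction h with
  | nil a =>
    obtain rfl : r = a := by simpa using hr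
    exact ⟨{r}, {r}, 0, 0, .nil r, .nil r, by simp, by simp, by simp⟩
  | @cons S a a' b n hab ha hp ih =>
    by_cases hra : r = a
    · subst hra
      exact ⟨{r}, insert r S, 0, _, .nil r, .cons hab ha hp, by simp, by simp, by simp⟩
    · obtain ⟨S₁, S₂, n₁, n₂, h1, h2, h3, h4, h5⟩ := ih (by simpa [hra] using hr)
      subst h3
      refine ⟨insert a S₁, S₂, _, n₂, .cons hab (fun h => ha (by simp [h])) h1, h2, by simp, ?_, ?_⟩
      · intro v hv hv'
        rcases Finset.mem_insert.1 hv with h | h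
        · subst h; exact absurd (by simp [hv']) ha
        · exact h4 v h hv'
      · rw [h5, add_assoc]

theorem eq_singleton (h : PathOn G w S a a n) : S = {a} ∧ n = 0 := by
  cases h with
  | nil a => simp
  | cons hab ha hp => exact absurd hp.right_mem ha

theorem first (h : PathOn G w S a b n) (hab : a ≠ b) :
    ∃ a' S' n', G.Adj a a' ∧ a ∉ S' ∧ PathOn G w S' a' b n' ∧ S = insert a S' ∧
      n = w s(a, a') + n' := by
  cases h with
  | nil a => exact absurd rfl hab
  | cons h1 h2 h3 => exact ⟨_, _, _, h1, h2, h3, rfl, rfl⟩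

theorem last (h : PathOn G w S a b n) (hab : a ≠ b) :
    ∃ b' S' n', G.Adj b' b ∧ b ∉ S' ∧ PathOn G w S' a b' n' ∧ S = insert b S' ∧
      n = n' + w s(b', b) := by
  obtain ⟨b', S', n', h1, h2, h3, h4, h5⟩ := h.reverse.first hab.symm
  exact ⟨b', S', n', h1.symm, h2, h3.reverse, h4, by rw [h5, add_comm, Sym2.eq_swap]⟩

theorem two_le_card (h : PathOn G w S a b n) (hab : a ≠ b) : 2 ≤ S.card := by
  have : ({a, b} : Finset V) ⊆ S := by
    intro v hv
    simp at hv
    rcases hv with rfl | rfl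
    exacts [h.left_mem, h.right_mem]
  simpa [Finset.card_pair hab] using Finset.card_le_card this

theorem eq_pair (h : PathOn G w S a b n) (hS : S.card ≤ 2) (hab : a ≠ b) :
    S = {a, b} ∧ G.Adj a b ∧ n = w s(a, b) := by
  obtain ⟨a', S', n', h1, h2, h3, rfl, rfl⟩ := h.first hab
  rw [Finset.card_insert_of_notMem h2] at hS
  have : a' = b := by
    by_contra hne
    have := h3.two_le_card hne
    omega
  subst this
  obtain ⟨rfl, rfl⟩ := h3.eq_singleton
  exact ⟨rfl, h1, by simp⟩

theorem unit {w : Sym2 V → ZMod 4} {n : ZMod 4} (h : PathOn G w S a b n)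
    (hw : ∀ u ∈ S, ∀ v ∈ S, G.Adj u v → w s(u, v) = 1) : n + 1 = S.card := by
  induction h with
  | nil a => simp
  | @cons S a a' b n hab ha hp ih =>
    rw [hw a (by simp) a' (by simp [hp.left_mem]) hab, Finset.card_insert_of_notMem ha, Nat.cast_succ,
      ← ih (fun u hu v hv => hw u (by simp [hu]) v (by simp [hv]))]
    ring

/-- Transport along an injective map that respects adjacency (within the vertex set) and weights. -/
theorem map {W : Type*} [DecidableEq W] {G' : SimpleGraph W} {w' : Sym2 W → N} (φ : M →+ N)
    (f : V ↪ W) (h : PathOn G w S a b n)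
    (hf : ∀ u ∈ S, ∀ v ∈ S, G.Adj u v → G'.Adj (f u) (f v) ∧ w' s(f u, f v) = φ (w s(u, v))) :
    PathOn G' w' (S.map f) (f a) (f b) (φ n) := by
  induction h with
  | nil a => exact (PathOn.nil (f a)).congr (by simp) (by simp)
  | @cons S a a' b n hab ha hp ih =>
    have h1 := hf a (by simp) a' (by simp [hp.left_mem]) hab
    exact (PathOn.cons h1.1 (by simpa using ha)
      (ih (fun u hu v hv => hf u (by simp [hu]) v (by simp [hv])))).congr (by simp) (by simp [h1.2])

theorem mapHom {w' : Sym2 V → N} (φ : M →+ N) (h : PathOn G w S a b n)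
    (hw : ∀ u ∈ S, ∀ v ∈ S, G.Adj u v → w' s(u, v) = φ (w s(u, v))) :
    PathOn G w' S a b (φ n) :=
  (h.map φ (Function.Embedding.refl V) (fun u hu v hv huv => ⟨huv, hw u hu v hv huv⟩)).congr
    (by simp) rfl

theorem reweightOn {w' : Sym2 V → M} (h : PathOn G w S a b n)
    (hw : ∀ u ∈ S, ∀ v ∈ S, G.Adj u v → w' s(u, v) = w s(u, v)) :
    PathOn G w' S a b n := h.mapHom (AddMonoidHom.id M) hw

theorem graphMap {G' : SimpleGraph V} (h : PathOn G w S a b n)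
    (hG : ∀ u ∈ S, ∀ v ∈ S, G.Adj u v → G'.Adj u v) : PathOn G' w S a b n :=
  (h.map (AddMonoidHom.id M) (Function.Embedding.refl V)
    (fun u hu v hv huv => ⟨hG u hu v hv huv, rfl⟩)).congr (by simp) rfl

theorem reweight (h : PathOn G w S a b n) (w' : Sym2 V → N) : ∃ n', PathOn G w' S a b n' := by
  induction h with
  | nil a => exact ⟨0, .nil a⟩
  | cons hab ha hp ih =>
    obtain ⟨n', h'⟩ := ih
    exact ⟨_, .cons hab ha h'⟩

end PathOn

namespace CycleOn

variable {G : SimpleGraph V} [AddCommMonoid M] [AddCommMonoid N] {w : Sym2 V → M}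
  {S T : Finset V} {a b c d p q : V} {n m : M}

theorem congr (h : CycleOn G w S n) (hS : S = T) (hn : n = m) : CycleOn G w T m := by
  subst hS hn; exact h

theorem three_le_card (h : CycleOn G w S n) : 3 ≤ S.card := by
  obtain ⟨a, b, m, h1, h2, h3, h4⟩ := h; exact h3

theorem of_path (h : PathOn G w S a b n) (hab : G.Adj b a) (hS : 3 ≤ S.card) :
    CycleOn G w S (n + w s(b, a)) := ⟨a, b, n, hab, h, hS, rfl⟩

/-- The first edge of the second path serves as the closing edge. The cardinality bound excludes two
copies of one edge. -/
theorem of_paths (h₁ : PathOn G w S a b n) (h₂ : PathOn G w T a b m)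
    (hd : ∀ v ∈ S, v ∈ T → v = a ∨ v = b) (hab : a ≠ b) (hc : 3 ≤ (S ∪ T).card) :
    CycleOn G w (S ∪ T) (n + m) := by
  obtain ⟨a', T', m', h1, h2, h3, rfl, rfl⟩ := h₂.first hab
  have h4 := h₁.append h3.reverse (by
    intro v hv hv'
    rcases hd v hv (by simp [hv']) with rfl | rfl
    · exact absurd hv' h2
    · rfl)
  have hU : S ∪ T' = S ∪ insert a T' := by
    have := h₁.left_mem
    ext v; simp; grind
  exact ⟨a, a', _, h1.symm, h4.congr hU rfl, hc, by rw [Sym2.eq_swap]; abel⟩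

theorem join (h₁ : PathOn G w S a b n) (h₂ : PathOn G w T c d m) (hac : G.Adj a c)
    (hbd : G.Adj b d) (hd : Disjoint S T) (hc : 3 ≤ S.card + T.card) :
    CycleOn G w (S ∪ T) (n + m + w s(a, c) + w s(b, d)) := by
  have := h₁.join hbd h₂.reverse hd
  exact ⟨a, c, _, hac.symm, this, by rw [Finset.card_union_of_disjoint hd]; exact hc, by
    rw [Sym2.eq_swap (a := c)]; abel⟩

/-- Two distinct vertices of a cycle split it into two paths. -/
theorem arcs (h : CycleOn G w S n) (hp : p ∈ S) (hq : q ∈ S) (hpq : p ≠ q) :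
    ∃ S₁ S₂ n₁ n₂, PathOn G w S₁ p q n₁ ∧ PathOn G w S₂ p q n₂ ∧ S₁ ∪ S₂ = S ∧
      (∀ v ∈ S₁, v ∈ S₂ → v = p ∨ v = q) ∧ n = n₁ + n₂ := by
  obtain ⟨a, b, m, hba, hP, hc, rfl⟩ := h
  obtain ⟨A, B, x, y, hA, hB, rfl, hd, rfl⟩ := hP.split hp
  -- The cycle is a path cut at `p` together with its closing edge. If `q` lies behind `p`, the
  -- second arc leaves `q` towards the end, crosses the closing edge and returns to `p`. The other
  -- case is the reversed cycle.
  have key : ∀ {A B : Finset V} {a b p q : V} {x y : M}, PathOn G w A a p x → PathOn G w B p b y →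
      (∀ v ∈ A, v ∈ B → v = p) → q ∈ B → p ≠ q → G.Adj b a →
      ∃ S₁ S₂ n₁ n₂, PathOn G w S₁ p q n₁ ∧ PathOn G w S₂ p q n₂ ∧ S₁ ∪ S₂ = A ∪ B ∧
      (∀ v ∈ S₁, v ∈ S₂ → v = p ∨ v = q) ∧ x + y + w s(b, a) = n₁ + n₂ := by
    intro A B a b p q x y hA hB hd hq hpq hba
    obtain ⟨B₁, B₂, y₁, y₂, hB1, hB2, rfl, hd', rfl⟩ := hB.split hq
    have hpB2 : p ∉ B₂ := fun h => hpq (hd' p hB1.left_mem h)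
    have hdis : Disjoint B₂ A := by
      rw [Finset.disjoint_left]
      intro v hv hv'
      have := hd v hv' (by simp [hv])
      subst this
      exact hpB2 hv
    have := (hB2.join hba hA hdis).reverse
    refine ⟨B₁, B₂ ∪ A, _, _, hB1, this, ?_, ?_, ?_⟩
    · ext v; simp; tauto
    · intro v hv hv'
      rcases Finset.mem_union.1 hv' with h | h
      · exact Or.inr (hd' v hv h)
      · exact Or.inl (hd v h (by simp [hv]))
    · abel
  rcases Finset.mem_union.1 hq with hq | hq
  · have := key hB.reverse hA.reverse (fun v h1 h2 => hd v h2 h1) hq hpq hba.symm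
    obtain ⟨S₁, S₂, n₁, n₂, h1, h2, h3, h4, h5⟩ := this
    exact ⟨S₁, S₂, n₁, n₂, h1, h2, by rw [h3, Finset.union_comm], h4, by
      rw [← h5, Sym2.eq_swap (a := a)]; abel⟩
  · exact key hA hB hd hq hpq hba

theorem mapHom {w' : Sym2 V → N} (φ : M →+ N) (h : CycleOn G w S n)
    (hw : ∀ u ∈ S, ∀ v ∈ S, G.Adj u v → w' s(u, v) = φ (w s(u, v))) :
    CycleOn G w' S (φ n) := by
  obtain ⟨a, b, m, hba, hP, hc, rfl⟩ := h
  exact ⟨a, b, _, hba, hP.mapHom φ hw, hc, by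
    rw [hw b hP.right_mem a hP.left_mem hba, map_add]⟩

theorem reweightOn {w' : Sym2 V → M} (h : CycleOn G w S n)
    (hw : ∀ u ∈ S, ∀ v ∈ S, G.Adj u v → w' s(u, v) = w s(u, v)) :
    CycleOn G w' S n := h.mapHom (AddMonoidHom.id M) hw

theorem unit {w : Sym2 V → ZMod 4} {n : ZMod 4} (h : CycleOn G w S n)
    (hw : ∀ u ∈ S, ∀ v ∈ S, G.Adj u v → w s(u, v) = 1) : n = S.card := by
  obtain ⟨a, b, m, hba, hP, hc, rfl⟩ := h
  rw [hw b hP.right_mem a hP.left_mem hba, hP.unit hw]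

end CycleOn

end SimpleGraph

/-! ### Truncating paths, deleting an edge, and linkage inside a vertex set. -/

namespace SimpleGraph

variable {V : Type*} [DecidableEq V] {M N : Type*}

namespace PathOn

variable {G : SimpleGraph V} [AddCommMonoid M] {w : Sym2 V → M}
  {S T : Finset V} {a b c d r x y : V} {n m : M}

/-- The initial segment of a path up to its first vertex in `B`. -/
theorem firstHit (h : PathOn G w S a b n) {B : Finset V} (hB : ∃ v ∈ S, v ∈ B) :
    ∃ S' n' b', PathOn G w S' a b' n' ∧ S' ⊆ S ∧ b' ∈ B ∧ ∀ v ∈ S', v ∈ B → v = b' := by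
  induction h with
  | nil a =>
    obtain ⟨v, hv, hvB⟩ := hB
    obtain rfl : v = a := by simpa using hv
    exact ⟨{v}, 0, v, .nil v, by simp, hvB, by simp⟩
  | @cons S a a' b n hab ha hp ih =>
    by_cases haB : a ∈ B
    · exact ⟨{a}, 0, a, .nil a, by simp, haB, by simp⟩
    · obtain ⟨v, hv, hvB⟩ := hB
      have hv' : v ∈ S := by
        rcases Finset.mem_insert.1 hv with rfl | h
        · exact absurd hvB haB
        · exact h
      obtain ⟨S', n', b', h1, h2, h3, h4⟩ := ih ⟨v, hv', hvB⟩
      refine ⟨insert a S', _, b', .cons hab (fun h => ha (h2 h)) h1,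
        Finset.insert_subset_insert _ h2, h3, ?_⟩
      intro u hu huB
      rcases Finset.mem_insert.1 hu with rfl | h
      · exact absurd huB haB
      · exact h4 u h huB

theorem extend (h : PathOn G w S a b n) (hbc : G.Adj b c) :
    ∃ S' n', PathOn G w S' a c n' ∧ S' ⊆ insert c S := by
  by_cases hc : c ∈ S
  · obtain ⟨S₁, S₂, n₁, n₂, h1, h2, h3, h4, h5⟩ := h.split hc
    exact ⟨S₁, n₁, h1, by subst h3; intro v hv; simp [hv]⟩
  · exact ⟨_, _, h.join hbc (.nil c) (by simpa using hc), by intro v; simp⟩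

theorem concat (h₁ : PathOn G w S a b n) (h₂ : PathOn G w T b c m) :
    ∃ S' n', PathOn G w S' a c n' ∧ S' ⊆ S ∪ T := by
  induction h₂ generalizing S a n with
  | nil b => exact ⟨S, n, h₁, by intro v hv; simp [hv]⟩
  | @cons T b b' c m hab ha hp ih =>
    obtain ⟨S', n', h1, h2⟩ := h₁.extend hab
    obtain ⟨S'', n'', h3, h4⟩ := ih h1
    refine ⟨S'', n'', h3, fun v hv => ?_⟩
    have := h4 hv
    have hb' := hp.left_mem
    rcases Finset.mem_union.1 this with h | h
    · rcases Finset.mem_insert.1 (h2 h) with rfl | h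
      · simp [hb']
      · simp [h]
    · simp [h]

/-- A path uses a given edge at most once, so without that edge it falls into at most two pieces.
The pair `x'`, `y'` records the direction in which the edge is traversed. -/
theorem deleteEdge (h : PathOn G w S a b n) (x y : V) :
    PathOn (G.deleteEdges {s(x, y)}) w S a b n ∨
    ∃ x' y' S₁ S₂ n₁ n₂, s(x', y') = s(x, y) ∧ G.Adj x' y' ∧
      PathOn (G.deleteEdges {s(x, y)}) w S₁ a x' n₁ ∧
      PathOn (G.deleteEdges {s(x, y)}) w S₂ y' b n₂ ∧ S₁ ∪ S₂ = S ∧ Disjoint S₁ S₂ ∧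
      n = n₁ + w s(x, y) + n₂ := by
  induction h with
  | nil a => exact .inl (.nil a)
  | @cons S a a' b n hab ha hp ih =>
    by_cases he : s(a, a') = s(x, y)
    · refine .inr ⟨a, a', {a}, S, 0, n, he, hab, .nil a, hp.graphMap ?_, rfl, by simpa using ha, by
        rw [← he, zero_add]⟩
      intro u hu v hv huv
      refine (deleteEdges_adj).2 ⟨huv, ?_⟩
      rw [Set.mem_singleton_iff, ← he]
      intro h
      have : a ∈ s(u, v) := h ▸ Sym2.mem_mk_left a a'
      rcases Sym2.mem_iff.1 this with rfl | rfl <;> contradiction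
    · have hab' : (G.deleteEdges {s(x, y)}).Adj a a' := (deleteEdges_adj).2 ⟨hab, by simpa using he⟩
      rcases ih with h | ⟨x', y', S₁, S₂, n₁, n₂, h1, h2, h3, h4, h5, h6, h7⟩
      · exact .inl (.cons hab' ha h)
      · subst h5
        refine .inr ⟨x', y', insert a S₁, S₂, _, n₂, h1, h2,
          .cons hab' (fun h => ha (by simp [h])) h3, h4, by simp, ?_, by rw [h7]; abel⟩
        rw [Finset.disjoint_insert_left]
        exact ⟨fun h => ha (by simp [h]), h6⟩

end PathOn

/-- A cycle through the edge can be rotated so that this edge closes it; what remains is a path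
between the ends of the edge on the same vertex set. -/
theorem CycleOn.deleteEdge {G : SimpleGraph V} [AddCommMonoid M] {w : Sym2 V → M} {S : Finset V}
    {n : M} (h : CycleOn G w S n) (x y : V) :
    CycleOn (G.deleteEdges {s(x, y)}) w S n ∨
      ∃ m, G.Adj x y ∧ PathOn (G.deleteEdges {s(x, y)}) w S x y m ∧ n = m + w s(x, y) := by
  obtain ⟨a, b, m, hba, hP, hc, rfl⟩ := h
  have hsym : ∀ {x' y' : V} {m : M}, s(x', y') = s(x, y) →
      PathOn (G.deleteEdges {s(x, y)}) w S x' y' m →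
      PathOn (G.deleteEdges {s(x, y)}) w S x y m := by
    intro x' y' m he hp
    rcases Sym2.eq_iff.1 he with ⟨rfl, rfl⟩ | ⟨rfl, rfl⟩
    exacts [hp, hp.reverse]
  have hsymA : ∀ {x' y' : V}, s(x', y') = s(x, y) → G.Adj x' y' → G.Adj x y := by
    intro x' y' he hp
    rcases Sym2.eq_iff.1 he with ⟨rfl, rfl⟩ | ⟨rfl, rfl⟩
    exacts [hp, hp.symm]
  rcases hP.deleteEdge x y with hP' | ⟨x', y', S₁, S₂, n₁, n₂, h1, h2, h3, h4, h5, h6, h7⟩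
  · by_cases he : s(b, a) = s(x, y)
    · exact .inr ⟨m, hsymA he hba, hsym he hP'.reverse, by rw [he]⟩
    · exact .inl ⟨a, b, m, (deleteEdges_adj).2 ⟨hba, by simpa using he⟩, hP', hc, rfl⟩
  · subst h5
    -- If the closing edge were also the edge traversed by the path, the cycle would have only two
    -- vertices.
    have hne : s(b, a) ≠ s(x, y) := by
      intro he
      rw [← h1] at he
      have hcard : (S₁ ∪ S₂).card ≤ 2 := by
        rcases Sym2.eq_iff.1 he with ⟨rfl, rfl⟩ | ⟨rfl, rfl⟩
        · exact absurd h3.right_mem (Finset.disjoint_right.1 h6 h4.right_mem)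
        · rw [h3.eq_singleton.1, h4.eq_singleton.1]
          exact (Finset.card_union_le _ _).trans (by simp)
      omega
    have hba' : (G.deleteEdges {s(x, y)}).Adj b a := (deleteEdges_adj).2 ⟨hba, by simpa using hne⟩
    have := h3.reverse.join hba'.symm h4.reverse h6
    exact .inr ⟨_, hsymA h1 h2, hsym h1 this, by rw [h7, Sym2.eq_swap (a := a)]; abel⟩

/-- `a` and `b` are joined by a path inside `U`. -/
def Linked (G : SimpleGraph V) (U : Finset V) (a b : V) : Prop :=
  ∃ S n, PathOn G (fun _ => (1 : ℕ)) S a b n ∧ S ⊆ U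

namespace Linked

variable {G : SimpleGraph V} {U U' : Finset V} {a b c : V}

theorem path [AddCommMonoid M] (h : Linked G U a b) (w : Sym2 V → M) :
    ∃ S n, PathOn G w S a b n ∧ S ⊆ U := by
  obtain ⟨S, n, h1, h2⟩ := h
  obtain ⟨n', h'⟩ := h1.reweight w
  exact ⟨S, n', h', h2⟩

theorem of_path [AddCommMonoid M] {w : Sym2 V → M} {S : Finset V} {n : M}
    (h : PathOn G w S a b n) (hS : S ⊆ U) : Linked G U a b := by
  obtain ⟨n', h'⟩ := h.reweight (fun _ => (1 : ℕ))
  exact ⟨S, n', h', hS⟩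

theorem refl (h : a ∈ U) : Linked G U a a := ⟨{a}, 0, .nil a, by simpa using h⟩

theorem symm (h : Linked G U a b) : Linked G U b a := by
  obtain ⟨S, n, h1, h2⟩ := h
  exact ⟨S, n, h1.reverse, h2⟩

theorem trans (h : Linked G U a b) (h' : Linked G U b c) : Linked G U a c := by
  obtain ⟨S, n, h1, h2⟩ := h
  obtain ⟨T, m, h3, h4⟩ := h'
  obtain ⟨S', n', h5, h6⟩ := h1.concat h3
  exact ⟨S', n', h5, h6.trans (Finset.union_subset h2 h4)⟩

theorem mono (h : Linked G U a b) (hU : U ⊆ U') : Linked G U' a b := by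
  obtain ⟨S, n, h1, h2⟩ := h
  exact ⟨S, n, h1, h2.trans hU⟩

theorem left_mem (h : Linked G U a b) : a ∈ U := by
  obtain ⟨S, n, h1, h2⟩ := h
  exact h2 h1.left_mem

theorem right_mem (h : Linked G U a b) : b ∈ U := h.symm.left_mem

theorem adj (h : Linked G U a b) (hbc : G.Adj b c) (hc : c ∈ U) : Linked G U a c :=
  h.trans (.of_path (PathOn.edge (w := fun _ => (1 : ℕ)) hbc) (by
    intro v; simp; rintro (rfl | rfl)
    exacts [h.right_mem, hc]))

end Linked

/-! ### Menger's theorem. -/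

section Menger

variable [Fintype V]

/-- A path from A to B avoiding Z must meet X ∪ {x}; it is cut at its first such vertex. If this
segment used the edge, it could only do so in its last step from y to x, and its part up to y would
continue to `b` within the complement of X, against the choice of X. -/
theorem separator_of_separator_deleteEdges {G : SimpleGraph V} {A B X Z : Finset V} {x y b : V}
    (hX : ∀ a ∈ A, ∀ b ∈ B, ¬ Linked (G.deleteEdges {s(x, y)}) Xᶜ a b)
    (hb : b ∈ B) (hy : Linked (G.deleteEdges {s(x, y)}) Xᶜ y b)
    (hZ : ∀ a ∈ A, ∀ b ∈ insert x X, ¬ Linked (G.deleteEdges {s(x, y)}) Zᶜ a b) :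
    ∀ a ∈ A, ∀ b ∈ B, ¬ Linked G Zᶜ a b := by
  rintro a ha b' hb' ⟨S, n, hS, hSZ⟩
  have hhit : ∃ v ∈ S, v ∈ insert x X := by
    by_contra hcon
    push Not at hcon
    refine hX a ha b' hb' (.of_path (hS.graphMap (w := fun _ => (1 : ℕ)) ?_) (U := Xᶜ) ?_)
    · intro u hu v hv huv
      refine (deleteEdges_adj).2 ⟨huv, ?_⟩
      rw [Set.mem_singleton_iff]
      intro h
      have hx : x ∈ s(u, v) := h ▸ Sym2.mem_mk_left x y
      rcases Sym2.mem_iff.1 hx with rfl | rfl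
      · exact hcon _ hu (by simp)
      · exact hcon _ hv (by simp)
    · intro v hv
      have := hcon v hv
      simp at this ⊢
      tauto
  obtain ⟨S', n', s, h1, h2, h3, h4⟩ := hS.firstHit hhit
  rcases h1.deleteEdge x y with h | ⟨x', y', S₁, S₂, n₁, n₂, e1, e2, e3, e4, e5, e6, e7⟩
  · exact hZ a ha s h3 (.of_path h (h2.trans hSZ))
  · subst e5
    have hdis := Finset.disjoint_left.1 e6
    rcases Sym2.eq_iff.1 e1 with ⟨rfl, rfl⟩ | ⟨rfl, rfl⟩
    · have := h4 x' (by simp [e3.right_mem]) (by simp)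
      subst this
      exact hdis e3.right_mem e4.right_mem
    · have hs := h4 y' (by simp [e4.left_mem]) (by simp)
      subst hs
      refine hX a ha b hb (Linked.trans (.of_path e3 ?_) hy)
      intro v hv
      rw [Finset.mem_compl]
      intro hvX
      have := h4 v (by simp [hv]) (by simp [hvX])
      subst this
      exact hdis hv e4.left_mem

/-- **Menger's theorem**, vertex version for sets. -/
theorem menger [AddCommMonoid M] (w : Sym2 V → M) (k : ℕ) (G : SimpleGraph V) (A B : Finset V)
    (hsep : ∀ X : Finset V, (∀ a ∈ A, ∀ b ∈ B, ¬ Linked G Xᶜ a b) → k ≤ X.card) :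
    ∃ (T : Finset V) (f : V → V) (P : V → Finset V), T.card = k ∧ T ⊆ A ∧
      (∀ t ∈ T, f t ∈ B ∧ ∃ n, PathOn G w (P t) t (f t) n) ∧
      (∀ s ∈ T, ∀ t ∈ T, s ≠ t → Disjoint (P s) (P t)) := by
  classical
  -- Induction on the number of edges, counted as ordered pairs. Without edges the paths are single
  -- vertices of A ∩ B.
  induction hN : (Finset.univ.filter (fun p : V × V => G.Adj p.1 p.2)).card using
    Nat.strong_induction_on generalizing G A B with
  | _ N ih =>
  by_cases hE : ∃ u v, G.Adj u v
  swap
  · push Not at hE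
    have hk := hsep (A ∩ B) (by
      rintro a ha b hb ⟨S, n, h1, h2⟩
      have hab : a = b := by
        by_contra hab
        obtain ⟨a', _, _, h, _⟩ := h1.first hab
        exact hE _ _ h
      subst hab
      have := h2 h1.left_mem
      simp [ha, hb] at this)
    obtain ⟨T, hT, hTc⟩ := Finset.exists_subset_card_eq hk
    refine ⟨T, id, fun t => {t}, hTc, fun t ht => (Finset.mem_inter.1 (hT ht)).1, ?_, ?_⟩
    · intro t ht
      exact ⟨(Finset.mem_inter.1 (hT ht)).2, 0, .nil t⟩
    · intro s _ t _ hst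
      simpa using hst
  obtain ⟨u, v, huv⟩ := hE
  have hlt : ∀ x y, s(x, y) = s(u, v) → (Finset.univ.filter
      (fun p : V × V => (G.deleteEdges {s(x, y)}).Adj p.1 p.2)).card < N := by
    intro x y hxy
    rw [← hN]
    apply Finset.card_lt_card
    refine ⟨fun p hp => ?_, fun h => ?_⟩
    · simp only [Finset.mem_filter, Finset.mem_univ, true_and] at hp ⊢
      exact ((deleteEdges_adj).1 hp).1
    · have := h (show (u, v) ∈ _ by simpa using huv)
      simp [hxy] at this
  -- If separators stay large without the edge, induction gives the paths at once. Otherwise fewer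
  -- than k vertices X separate A from B after the deletion, and X with either end of the edge added
  -- is a separator of exactly k vertices.
  by_cases hG' : ∀ X : Finset V,
      (∀ a ∈ A, ∀ b ∈ B, ¬ Linked (G.deleteEdges {s(u, v)}) Xᶜ a b) → k ≤ X.card
  · obtain ⟨T, f, P, h1, h2, h3, h4⟩ := ih _ (hlt u v rfl) _ A B hG' (by congr!)
    refine ⟨T, f, P, h1, h2, fun t ht => ⟨(h3 t ht).1, ?_⟩, h4⟩
    obtain ⟨n, hn⟩ := (h3 t ht).2
    exact ⟨n, hn.graphMap (fun _ _ _ _ h => ((deleteEdges_adj).1 h).1)⟩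
  push Not at hG'
  obtain ⟨X, hX, hXk⟩ := hG'
  have hnot : ∃ a ∈ A, ∃ b ∈ B, Linked G Xᶜ a b := by
    by_contra hcon
    push Not at hcon
    exact absurd (hsep X hcon) (by omega)
  obtain ⟨a₀, ha₀, b₀, hb₀, S, n, hS, hSX⟩ := hnot
  rcases hS.deleteEdge u v with h | ⟨x, y, S₁, S₂, n₁, n₂, e1, e2, e3, e4, e5, e6, e7⟩
  · exact absurd (.of_path h hSX) (hX a₀ ha₀ b₀ hb₀)
  rw [← e1] at hX e3 e4
  subst e5
  have hS₁ : S₁ ⊆ Xᶜ := fun v hv => hSX (by simp [hv])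
  have hS₂ : S₂ ⊆ Xᶜ := fun v hv => hSX (by simp [hv])
  have hxX : x ∉ X := by simpa using hS₁ e3.right_mem
  have hyX : y ∉ X := by simpa using hS₂ e4.left_mem
  have hlx := Linked.of_path e3.reverse hS₁
  have hly := Linked.of_path e4 hS₂
  have hX' : ∀ b ∈ B, ∀ a ∈ A, ¬ Linked (G.deleteEdges {s(y, x)}) Xᶜ b a := by
    intro b hb a ha h
    rw [Sym2.eq_swap] at h
    exact hX a ha b hb h.symm
  -- Induction links A to X ∪ {x} and B to X ∪ {y} by k disjoint paths each. These two systems are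
  -- then glued at the vertices of X and along the edge from x to y.
  obtain ⟨T₁, f₁, P₁, c1, c2, c3, c4⟩ := ih _ (hlt x y e1) _ A (insert x X) (by
    intro Z hZ
    exact hsep Z (separator_of_separator_deleteEdges hX hb₀ hly hZ)) (by congr!)
  obtain ⟨T₂, f₂, P₂, d1, d2, d3, d4⟩ := ih _ (hlt y x (by rw [Sym2.eq_swap, e1])) _ B
    (insert y X) (by
    intro Z hZ
    refine hsep Z fun a ha b hb h => ?_
    exact separator_of_separator_deleteEdges hX' ha₀ (by rw [Sym2.eq_swap]; exact hlx) hZ b hb a ha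
      h.symm) (by congr!)
  have hcardx : (insert x X).card = X.card + 1 := Finset.card_insert_of_notMem hxX
  have hcardy : (insert y X).card = X.card + 1 := Finset.card_insert_of_notMem hyX
  have hinj₁ : Set.InjOn f₁ T₁ := by
    intro s hs t ht hst
    by_contra hne
    obtain ⟨n, hn⟩ := (c3 s hs).2
    obtain ⟨m, hm⟩ := (c3 t ht).2
    exact Finset.disjoint_left.1 (c4 s hs t ht hne) hn.right_mem (hst ▸ hm.right_mem)
  have hinj₂ : Set.InjOn f₂ T₂ := by
    intro s hs t ht hst
    by_contra hne
    obtain ⟨n, hn⟩ := (d3 s hs).2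
    obtain ⟨m, hm⟩ := (d3 t ht).2
    exact Finset.disjoint_left.1 (d4 s hs t ht hne) hn.right_mem (hst ▸ hm.right_mem)
  have him₁ : T₁.image f₁ = insert x X := Finset.eq_of_subset_of_card_le
    (by intro v hv; obtain ⟨t, ht, rfl⟩ := Finset.mem_image.1 hv; exact (c3 t ht).1)
    (by rw [Finset.card_image_of_injOn hinj₁]; omega)
  have him₂ : T₂.image f₂ = insert y X := Finset.eq_of_subset_of_card_le
    (by intro v hv; obtain ⟨t, ht, rfl⟩ := Finset.mem_image.1 hv; exact (d3 t ht).1)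
    (by rw [Finset.card_image_of_injOn hinj₂]; omega)
  have hend₁ : ∀ t ∈ T₁, ∀ v ∈ P₁ t, v ∈ insert x X → v = f₁ t := by
    intro t ht v hv hvX
    rw [← him₁] at hvX
    obtain ⟨s, hs, rfl⟩ := Finset.mem_image.1 hvX
    by_contra hne
    have hst : s ≠ t := fun h => hne (by rw [h])
    obtain ⟨n, hn⟩ := (c3 s hs).2
    exact Finset.disjoint_left.1 (c4 s hs t ht hst) hn.right_mem hv
  have hend₂ : ∀ t ∈ T₂, ∀ v ∈ P₂ t, v ∈ insert y X → v = f₂ t := by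
    intro t ht v hv hvX
    rw [← him₂] at hvX
    obtain ⟨s, hs, rfl⟩ := Finset.mem_image.1 hvX
    by_contra hne
    have hst : s ≠ t := fun h => hne (by rw [h])
    obtain ⟨n, hn⟩ := (d3 s hs).2
    exact Finset.disjoint_left.1 (d4 s hs t ht hst) hn.right_mem hv
  -- a vertex common to a path of the first kind and one of the second lies in the separator
  have hmeet : ∀ s ∈ T₁, ∀ t ∈ T₂, ∀ v, v ∈ P₁ s → v ∈ P₂ t → v ∈ X := by
    intro s hs t ht v hv hv'
    by_contra hvX
    obtain ⟨n, hn⟩ := (c3 s hs).2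
    obtain ⟨m, hm⟩ := (d3 t ht).2
    obtain ⟨Q₁, Q₂, q₁, q₂, g1, g2, g3, g4, g5⟩ := hn.split hv
    obtain ⟨R₁, R₂, r₁, r₂, k1, k2, k3, k4, k5⟩ := hm.split hv'
    have hQ : Q₁ ⊆ Xᶜ := by
      intro z hz
      rw [Finset.mem_compl]
      intro hzX
      have hz' := hend₁ s hs z (by rw [← g3]; simp [hz]) (by simp [hzX])
      subst hz'
      have := g4 _ hz g2.right_mem
      exact hvX (this ▸ hzX)
    have hR : R₁ ⊆ Xᶜ := by
      intro z hz
      rw [Finset.mem_compl]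
      intro hzX
      have hz' := hend₂ t ht z (by rw [← k3]; simp [hz]) (by simp [hzX])
      subst hz'
      have := k4 _ hz k2.right_mem
      exact hvX (this ▸ hzX)
    refine hX s (c2 hs) t (d2 ht) ((Linked.of_path g1 hQ).trans ?_)
    have := (Linked.of_path k1 hR).symm
    rwa [Sym2.eq_swap] at this
  -- The path ending in x continues with the one ending in y; every other path continues with the
  -- one having the same end.
  have hex : ∀ t ∈ T₁, ∃ t' ∈ T₂, f₂ t' = if f₁ t = x then y else f₁ t := by
    intro t ht
    have : (if f₁ t = x then y else f₁ t) ∈ T₂.image f₂ := by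
      rw [him₂]
      have := (c3 t ht).1
      split_ifs with h
      · simp
      · simp [h] at this; simp [this]
    obtain ⟨t', h1, h2⟩ := Finset.mem_image.1 this
    exact ⟨t', h1, h2⟩
  choose! g hg1 hg2 using hex
  refine ⟨T₁, g, fun t => P₁ t ∪ P₂ (g t), c1, c2, fun t ht => ⟨d2 (hg1 t ht), ?_⟩, ?_⟩
  · obtain ⟨n, hn⟩ := (c3 t ht).2
    obtain ⟨m, hm⟩ := (d3 _ (hg1 t ht)).2
    replace hn := hn.graphMap (G' := G) (fun _ _ _ _ h => ((deleteEdges_adj).1 h).1)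
    replace hm := hm.graphMap (G' := G) (fun _ _ _ _ h => ((deleteEdges_adj).1 h).1)
    rw [hg2 t ht] at hm
    split_ifs at hm with h
    · rw [h] at hn
      refine ⟨_, hn.join e2 hm.reverse ?_⟩
      rw [Finset.disjoint_left]
      intro z hz hz'
      have hzX := hmeet t ht _ (hg1 t ht) z hz hz'
      have := hend₁ t ht z hz (by simp [hzX])
      rw [h] at this
      exact hxX (this ▸ hzX)
    · refine ⟨_, hn.append hm.reverse ?_⟩
      intro z hz hz'
      have hzX := hmeet t ht _ (hg1 t ht) z hz hz'
      exact hend₁ t ht z hz (by simp [hzX])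
  · intro s hs t ht hst
    have hcross : ∀ s ∈ T₁, ∀ t ∈ T₁, s ≠ t → Disjoint (P₁ s) (P₂ (g t)) := by
      intro s hs t ht hst
      rw [Finset.disjoint_left]
      intro z hz hz'
      have hzX := hmeet s hs _ (hg1 t ht) z hz hz'
      have h1 := hend₁ s hs z hz (by simp [hzX])
      have h2 := hend₂ _ (hg1 t ht) z hz' (by simp [hzX])
      rw [hg2 t ht] at h2
      split_ifs at h2 with h
      · exact hyX (h2 ▸ hzX)
      · exact hst (hinj₁ hs ht (h1.symm.trans h2))
    have hgne : g s ≠ g t := by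
      intro h
      have h1 := hg2 s hs
      rw [h, hg2 t ht] at h1
      have hs' := (c3 s hs).1
      have ht' := (c3 t ht).1
      apply hst
      apply hinj₁ hs ht
      split_ifs at h1 with h2 h3 h3
      · rw [h2, h3]
      · simp [h3] at hs'
        exact absurd (h1 ▸ hs') hyX
      · simp [h2] at ht'
        exact absurd (h1 ▸ ht') hyX
      · exact h1.symm
    rw [Finset.disjoint_union_left, Finset.disjoint_union_right, Finset.disjoint_union_right]
    exact ⟨⟨c4 s hs t ht hst, hcross s hs t ht hst⟩, (hcross t ht s hs hst.symm).symm,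
      d4 _ (hg1 s hs) _ (hg1 t ht) hgne⟩

end Menger

end SimpleGraph

/-! ### Connectivity and disjoint links to a cycle. -/

namespace SimpleGraph

variable {V : Type*} [DecidableEq V] {M : Type*}

theorem ZMod4.four_eq_zero : (4 : ZMod 4) = 0 := rfl

/-- Throughout, parity in `ZMod 4` is expressed by doubling: even means `2 * n = 0`, odd means `2 *
n = 2`. Parity arguments then become linear identities. -/
theorem ZMod4.even_or_odd : ∀ n : ZMod 4, 2 * n = 0 ∨ 2 * n = 2 := by decide

/-- The path is cut at its first vertex in `B`. -/
theorem PathOn.firstHitSplit {G : SimpleGraph V} [AddCommMonoid M] {w : Sym2 V → M}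
    {S : Finset V} {a b : V} {n : M} (h : PathOn G w S a b n) {B : Finset V}
    (hB : ∃ v ∈ S, v ∈ B) :
    ∃ S₁ S₂ n₁ n₂ b', PathOn G w S₁ a b' n₁ ∧ PathOn G w S₂ b' b n₂ ∧ S₁ ∪ S₂ = S ∧
      (∀ v ∈ S₁, v ∈ S₂ → v = b') ∧ n = n₁ + n₂ ∧ b' ∈ B ∧ ∀ v ∈ S₁, v ∈ B → v = b' := by
  induction h with
  | nil a =>
    obtain ⟨v, hv, hvB⟩ := hB
    obtain rfl : v = a := by simpa using hv
    exact ⟨{v}, {v}, 0, 0, v, .nil v, .nil v, by simp, by simp, by simp, hvB, by simp⟩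
  | @cons S a a' b n hab ha hp ih =>
    by_cases haB : a ∈ B
    · exact ⟨{a}, _, 0, _, a, .nil a, .cons hab ha hp, by simp, by simp, by simp, haB, by simp⟩
    · obtain ⟨v, hv, hvB⟩ := hB
      have hv' : v ∈ S := by
        rcases Finset.mem_insert.1 hv with rfl | h
        · exact absurd hvB haB
        · exact h
      obtain ⟨S₁, S₂, n₁, n₂, b', h1, h2, h3, h4, h5, h6, h7⟩ := ih ⟨v, hv', hvB⟩
      subst h3
      refine ⟨insert a S₁, S₂, _, n₂, b', .cons hab (fun h => ha (by simp [h])) h1, h2, by simp, ?_,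
        by rw [h5, add_assoc], h6, ?_⟩
      · intro u hu hu'
        rcases Finset.mem_insert.1 hu with rfl | h
        · exact absurd (by simp [hu']) ha
        · exact h4 u h hu'
      · intro u hu huB
        rcases Finset.mem_insert.1 hu with rfl | h
        · exact absurd huB haB
        · exact h7 u h huB

/-- Every set separating the graph (the boundary of `M` lies in `X`) has at least `k` vertices. -/
def KConn {V : Type*} (G : SimpleGraph V) (k : ℕ) : Prop :=
  ∀ M X : Finset V, M.Nonempty → (∀ u ∈ M, ∀ v, G.Adj u v → v ∈ M ∨ v ∈ X) →
    (∃ v, v ∉ M ∧ v ∉ X) → k ≤ X.card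

theorem KConn.mono {V : Type*} {G : SimpleGraph V} {k l : ℕ} (hK : KConn G k) (h : l ≤ k) :
    KConn G l := fun M X h1 h2 h3 => h.trans (hK M X h1 h2 h3)

/-- A path `T` from `y ∈ Y` to `u`, with `u` adjacent to `c ∈ C`, that avoids `C` and meets `Y` only
in `y`. -/
structure IsLink (G : SimpleGraph V) [AddCommMonoid M] (w : Sym2 V → M) (C Y : Finset V)
    (y u c : V) (T : Finset V) (t : M) : Prop where
  mem_left : y ∈ Y
  mem_right : c ∈ C
  path : PathOn G w T y u t
  adj : G.Adj u c
  disj : Disjoint T C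
  only : ∀ v ∈ T, v ∈ Y → v = y

section

variable {G : SimpleGraph V}

/-- The path is cut at its first vertex in C and then, read backwards from there, at its first
vertex in Y. Its last edge becomes the attaching edge. -/
theorem PathOn.toLink [AddCommMonoid M] {w : Sym2 V → M} {C Y S : Finset V} {y c : V} {n : M}
    (h : PathOn G w S y c n) (hy : y ∈ Y) (hc : c ∈ C) (hCY : Disjoint C Y) :
    ∃ y' u c' T t, IsLink G w C Y y' u c' T t ∧ T ⊆ S ∧ c' ∈ S := by
  obtain ⟨S₁, n₁, c', h1, h2, h3, h4⟩ := h.firstHit ⟨c, h.right_mem, hc⟩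
  obtain ⟨S₂, n₂, y', h5, h6, h7, h8⟩ := h1.reverse.firstHit ⟨y, h1.left_mem, hy⟩
  have hne : c' ≠ y' := fun h => Finset.disjoint_left.1 hCY h3 (h ▸ h7)
  obtain ⟨u, T, t, g1, g2, g3, rfl, g5⟩ := h5.first hne
  refine ⟨y', u, c', T, t, ⟨h7, h3, g3.reverse, g1.symm, ?_, fun v hv hvY => h8 v (by simp [hv]) hvY⟩,
    fun v hv => h2 (h6 (by simp [hv])), h2 h1.right_mem⟩
  rw [Finset.disjoint_left]
  intro v hv hvC
  have := h4 v (h6 (by simp [hv])) hvC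
  subst this
  exact g2 hv

variable [Fintype V]

theorem KConn.linked {k : ℕ} (hK : KConn G k) {X : Finset V} (hX : X.card < k) {u v : V}
    (hu : u ∉ X) (hv : v ∉ X) : Linked G Xᶜ u v := by
  classical
  by_contra hcon
  -- The component of `u` off X has its boundary in X.
  have := hK (Finset.univ.filter (fun z => Linked G Xᶜ u z)) X
    ⟨u, by simpa using Linked.refl (by simpa using hu)⟩ (by
      intro z hz z' hzz'
      simp only [Finset.mem_filter, Finset.mem_univ, true_and] at hz ⊢
      by_cases h : z' ∈ X
      · exact .inr h
      · exact .inl (hz.adj hzz' (by simpa using h))) ⟨v, by simpa using hcon, hv⟩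
  omega

theorem KConn.links [AddCommMonoid M] {k : ℕ} (hK : KConn G k) (w : Sym2 V → M) {C Y : Finset V}
    (hC : k ≤ C.card) (hY : k ≤ Y.card) (hCY : Disjoint C Y) :
    ∃ (y u c : Fin k → V) (T : Fin k → Finset V) (t : Fin k → M),
      (∀ i, IsLink G w C Y (y i) (u i) (c i) (T i) (t i)) ∧
      ∀ i j, i ≠ j → Disjoint (T i) (T j) ∧ c i ≠ c j := by
  obtain ⟨A, f, P, h1, h2, h3, h4⟩ := menger w k G Y C (by
    intro X hX
    by_contra hlt
    obtain ⟨a, ha, haX⟩ := Finset.exists_mem_notMem_of_card_lt_card (s := X) (t := Y) (by omega)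
    obtain ⟨b, hb, hbX⟩ := Finset.exists_mem_notMem_of_card_lt_card (s := X) (t := C) (by omega)
    exact hX a ha b hb (hK.linked (by omega) haX hbX))
  have h5 : ∀ a ∈ A, ∃ y' u c' T t, IsLink G w C Y y' u c' T t ∧ T ⊆ P a ∧ c' ∈ P a := by
    intro a ha
    obtain ⟨hf, n, hn⟩ := h3 a ha
    exact hn.toLink (h2 ha) hf hCY
  choose! y u c T t h6 h7 h8 using h5
  let e := A.equivFinOfCardEq h1
  refine ⟨fun i => y (e.symm i), fun i => u (e.symm i), fun i => c (e.symm i),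
    fun i => T (e.symm i), fun i => t (e.symm i), fun i => h6 _ (e.symm i).2, fun i j hij => ?_⟩
  have hne : (e.symm i : V) ≠ e.symm j := fun h => hij (e.symm.injective (Subtype.ext h))
  have hd := h4 _ (e.symm i).2 _ (e.symm j).2 hne
  refine ⟨hd.mono (h7 _ (e.symm i).2) (h7 _ (e.symm j).2), fun h => ?_⟩
  have h' : c (e.symm i) = c (e.symm j) := h
  exact Finset.disjoint_left.1 hd (h8 _ (e.symm i).2) (by rw [h']; exact h8 _ (e.symm j).2)

end

/-! ### Odd cycles in closed walks, and odd cycles with minimal vertex set. -/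

section Parity

variable {G : SimpleGraph V} {w : Sym2 V → ZMod 4} {S T R U C : Finset V} {a b c d p q : V}
  {n m l L : ZMod 4}

/-- The second path is followed until it first returns to the first one. The initial parts form a
cycle or a doubled edge, and the final parts a shorter instance; the odd total makes one of the two
odd. A doubled edge is even, so an odd initial part is a genuine cycle. -/
theorem PathOn.exists_odd_cycle (hS : PathOn G w S a b n) (hT : PathOn G w T a b m)
    (hodd : 2 * (n + m) = 2) : ∃ C L, CycleOn G w C L ∧ 2 * L = 2 ∧ C ⊆ S ∪ T := by
  induction hN : T.card using Nat.strong_induction_on generalizing a S n T m with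
  | _ N ih =>
  by_cases hab : a = b
  · subst hab
    rw [hS.eq_singleton.2, hT.eq_singleton.2] at hodd
    exact absurd hodd (by decide)
  obtain ⟨a₁, T', m', h1, h2, h3, rfl, rfl⟩ := hT.first hab
  obtain ⟨T₁, T₂, m₁, m₂, z, g1, g2, rfl, g4, rfl, g6, g7⟩ :=
    h3.firstHitSplit ⟨b, h3.right_mem, hS.right_mem⟩
  obtain ⟨S₁, S₂, n₁, n₂, k1, k2, rfl, k4, rfl⟩ := hS.split g6
  have haT₁ : a ∉ T₁ := fun h => h2 (by simp [h])
  have hza : a ≠ z := fun h => haT₁ (h ▸ g1.right_mem)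
  have hP := PathOn.cons h1 haT₁ g1
  rcases ZMod4.even_or_odd (n₁ + (w s(a, a₁) + m₁)) with he | ho
  · obtain ⟨C, L, c1, c2, c3⟩ := ih T₂.card (by
      rw [← hN, Finset.card_insert_of_notMem h2]
      exact Nat.lt_succ_of_le (Finset.card_le_card Finset.subset_union_right)) k2 g2 (by
        linear_combination hodd - he) rfl
    refine ⟨C, L, c1, c2, c3.trans ?_⟩
    intro v; simp; tauto
  · by_cases hc : 3 ≤ (S₁ ∪ insert a T₁).card
    · refine ⟨_, _, CycleOn.of_paths k1 hP ?_ hza hc, ho, by intro v; simp; tauto⟩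
      intro v hv hv'
      rcases Finset.mem_insert.1 hv' with h | h
      · exact .inl h
      · exact .inr (g7 v h (by simp [hv]))
    · have hc1 := Finset.card_le_card (Finset.subset_union_left (s₁ := S₁) (s₂ := insert a T₁))
      have hc2 := Finset.card_le_card (Finset.subset_union_right (s₁ := S₁) (s₂ := insert a T₁))
      have e1 := (k1.eq_pair (by omega) hza).2.2
      have e2 := (hP.eq_pair (by omega) hza).2.2
      rw [e1, e2] at ho
      exfalso
      revert ho
      generalize w s(a, z) = x
      revert x
      decide

/-- In a set without odd cycles closed walks made of three paths have even weight. -/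
theorem PathOn.triangle_even (hU : ∀ C L, CycleOn G w C L → C ⊆ U → 2 * L ≠ 2)
    (hS : PathOn G w S d p n) (hT : PathOn G w T p q m) (hR : PathOn G w R d q l)
    (hSU : S ⊆ U) (hTU : T ⊆ U) (hRU : R ⊆ U) : 2 * (n + m + l) = 0 := by
  induction hT generalizing S n with
  | nil p =>
    rcases ZMod4.even_or_odd (n + l) with h | h
    · linear_combination h
    · obtain ⟨C, L, h1, h2, h3⟩ := hS.exists_odd_cycle hR h
      exact absurd h2 (hU C L h1 (h3.trans (Finset.union_subset hSU hRU)))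
  | @cons T p p' q m hpp' hp hT ih =>
    have hp'U : p' ∈ U := hTU (by simp [hT.left_mem])
    have hTU' : T ⊆ U := fun v hv => hTU (by simp [hv])
    -- The first step of the second path is absorbed into the first path without changing the total
    -- parity. If the new vertex already lies on that path, the piece cut off closes up with this
    -- step to an even closed walk.
    obtain ⟨S', n', h1, h2, h3⟩ : ∃ S' n', PathOn G w S' d p' n' ∧ S' ⊆ U ∧
        2 * (n' + n + w s(p, p')) = 0 := by
      by_cases hp' : p' ∈ S
      · obtain ⟨S₁, S₂, n₁, n₂, k1, k2, rfl, k4, rfl⟩ := hS.split hp'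
        refine ⟨S₁, n₁, k1, fun v hv => hSU (by simp [hv]), ?_⟩
        rcases ZMod4.even_or_odd (n₂ + w s(p', p)) with h | h
        · rw [Sym2.eq_swap]
          linear_combination h + n₁ * ZMod4.four_eq_zero
        · obtain ⟨C, L, h1, h2, h3⟩ := k2.exists_odd_cycle (PathOn.edge hpp'.symm) h
          refine absurd h2 (hU C L h1 (h3.trans (Finset.union_subset ?_ ?_)))
          · intro v hv; exact hSU (by simp [hv])
          · intro v hv
            have := hSU hS.right_mem
            simp at hv
            rcases hv with rfl | rfl <;> assumption
      · have := hS.join hpp' (.nil p') (by simpa using hp')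
        refine ⟨_, _, this, ?_, ?_⟩
        · intro v hv
          simp at hv
          rcases hv with rfl | h
          exacts [hp'U, hSU h]
        · linear_combination (n + w s(p, p')) * ZMod4.four_eq_zero
    have := ih h1 hR h2 hTU'
    linear_combination this + h3 - n' * ZMod4.four_eq_zero

/-- In an odd cycle of minimal vertex set, adjacent vertices are consecutive. -/
theorem CycleOn.consecutive (hC : CycleOn G w C L) (hL : 2 * L = 2)
    (hmin : ∀ C' L', CycleOn G w C' L' → 2 * L' = 2 → C' ⊆ C → C' = C) (hp : p ∈ C) (hq : q ∈ C)
    (hpq : G.Adj p q) : ∃ S n, PathOn G w S p q n ∧ S = C ∧ L = n + w s(p, q) := by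
  obtain ⟨S₁, S₂, n₁, n₂, h1, h2, h3, h4, h5⟩ := hC.arcs hp hq hpq.ne
  have key : ∀ {S₁ S₂ n₁ n₂}, PathOn G w S₁ p q n₁ → PathOn G w S₂ p q n₂ → S₁ ∪ S₂ = C →
      S₂.card ≤ 2 → L = n₁ + n₂ → ∃ S n, PathOn G w S p q n ∧ S = C ∧ L = n + w s(p, q) := by
    intro S₁ S₂ n₁ n₂ h1 h2 h3 h4 h5
    obtain ⟨rfl, _, rfl⟩ := h2.eq_pair h4 hpq.ne
    refine ⟨S₁, n₁, h1, ?_, h5⟩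
    rw [← h3]
    have := h1.left_mem
    have := h1.right_mem
    ext v; simp; grind
  -- When both arcs are longer than an edge, the chord cuts off one odd cycle, which misses the
  -- inner vertices of the other arc, against minimality.
  have key2 : ∀ {S₁ S₂ n₁ n₂}, PathOn G w S₁ p q n₁ → PathOn G w S₂ p q n₂ → S₁ ∪ S₂ = C →
      (∀ v ∈ S₁, v ∈ S₂ → v = p ∨ v = q) → 3 ≤ S₁.card → 3 ≤ S₂.card →
      2 * (n₁ + w s(p, q)) = 2 → False := by
    intro S₁ S₂ n₁ n₂ h1 h2 h3 h4 h5 h6 h7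
    have hcyc := CycleOn.of_path h1 hpq.symm h5
    have := hmin _ _ hcyc (by rw [Sym2.eq_swap]; exact h7) (by rw [← h3]; exact Finset.subset_union_left)
    have hsub : S₂ ⊆ {p, q} := by
      intro v hv
      have := h4 v (by rw [this, ← h3]; simp [hv]) hv
      simpa using this
    have := Finset.card_le_card hsub
    have := Finset.card_le_two (a := p) (b := q)
    omega
  by_cases hc1 : S₁.card ≤ 2
  · exact key h2 h1 (by rw [Finset.union_comm, h3]) hc1 (by rw [h5, add_comm])
  by_cases hc2 : S₂.card ≤ 2
  · exact key h1 h2 h3 hc2 h5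
  exfalso
  rcases ZMod4.even_or_odd (n₁ + w s(p, q)) with h | h
  · refine key2 h2 h1 (by rw [Finset.union_comm, h3]) (fun v hv hv' => h4 v hv' hv) (by omega)
      (by omega) ?_
    rw [h5] at hL
    linear_combination hL - h + w s(p, q) * ZMod4.four_eq_zero
  · exact key2 h1 h2 h3 h4 (by omega) (by omega) h

/-- By `CycleOn.consecutive`, `c` and `q₁` are consecutive on an odd cycle through all of C; let b
be the other neighbour of `c` there. A chord from `c` to any further vertex leaves an odd cycle
missing b or `q₁`. So b is the only other neighbour of `c` in C. -/
theorem CycleOn.degree_le_two (hC : CycleOn G w C L) (hL : 2 * L = 2)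
    (hmin : ∀ C' L', CycleOn G w C' L' → 2 * L' = 2 → C' ⊆ C → C' = C) {q₁ q₂ q₃ : V}
    (hc : c ∈ C) (h₁ : q₁ ∈ C) (h₂ : q₂ ∈ C) (h₃ : q₃ ∈ C) (a₁ : G.Adj c q₁) (a₂ : G.Adj c q₂)
    (a₃ : G.Adj c q₃) : q₁ = q₂ ∨ q₁ = q₃ ∨ q₂ = q₃ := by
  obtain ⟨S, n, hS, rfl, rfl⟩ := hC.consecutive hL hmin hc h₁ a₁
  obtain ⟨b, S', n', g1, g2, g3, rfl, rfl⟩ := hS.first a₁.ne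
  have key : ∀ q ∈ insert c S', G.Adj c q → q ≠ q₁ → q = b := by
    intro q hq hcq hqq
    by_contra hqb
    have hqS' : q ∈ S' := by
      rcases Finset.mem_insert.1 hq with rfl | h
      · exact absurd hcq (G.loopless.irrefl _)
      · exact h
    obtain ⟨X, Y, x, y, k1, k2, rfl, k4, rfl⟩ := g3.split hqS'
    have hcX : c ∉ X := fun h => g2 (by simp [h])
    have hcY : c ∉ Y := fun h => g2 (by simp [h])
    have hq1X : q₁ ∉ X := fun h => hqq (k4 _ h k2.right_mem).symm
    have hbY : b ∉ Y := fun h => hqb (k4 _ k1.left_mem h).symm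
    have c1 := CycleOn.join k1 (.nil c) g1.symm hcq.symm (by simpa using hcX) (by
      have := k1.two_le_card (Ne.symm hqb); simp; omega)
    have c2 := CycleOn.join k2 (.nil c) hcq.symm a₁.symm (by simpa using hcY) (by
      have := k2.two_le_card hqq; simp; omega)
    rcases ZMod4.even_or_odd (x + 0 + w s(b, c) + w s(q, c)) with h | h
    · have := hmin _ _ c2 (by
        rw [Sym2.eq_swap (a := c) (b := q₁), Sym2.eq_swap (a := c) (b := b)] at hL
        linear_combination hL - h + w s(q, c) * ZMod4.four_eq_zero) (by
        intro v; simp; tauto)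
      have hb : b ∈ Y ∪ {c} := by rw [this]; simp [k1.left_mem]
      simp [hbY] at hb
      exact g1.ne hb.symm
    · have := hmin _ _ c1 h (by intro v; simp; tauto)
      have hb : q₁ ∈ X ∪ {c} := by rw [this]; exact h₁
      simp [hq1X] at hb
      exact a₁.ne hb.symm
  by_cases e2 : q₂ = q₁
  · exact .inl e2.symm
  by_cases e3 : q₃ = q₁
  · exact .inr (.inl e3.symm)
  right; right
  rw [key q₂ h₂ a₂ e2, key q₃ h₃ a₃ e3]

end Parity

/-! ### Frames and their existence in 3-connected graphs. -/

/-- An induced non-separating odd cycle each of whose vertices has a neighbour outside. -/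
structure IsFrame (G : SimpleGraph V) [Fintype V] (w : Sym2 V → ZMod 4) (C : Finset V)
    (L : ZMod 4) : Prop where
  cyc : CycleOn G w C L
  odd : 2 * L = 2
  linked : ∀ u ∉ C, ∀ v ∉ C, Linked G Cᶜ u v
  min : ∀ C' L', CycleOn G w C' L' → 2 * L' = 2 → C' ⊆ C → C' = C
  nbr : ∀ c ∈ C, ∃ h ∉ C, G.Adj c h

section Frame

variable [Fintype V] {G : SimpleGraph V} {w : Sym2 V → ZMod 4} {C : Finset V} {L : ZMod 4}

/-- Choose a largest connected set H containing H₀ that some odd cycle C avoids. Maximality and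
3-connectivity force every vertex off H to have a neighbour in H and to lie on every odd cycle
avoiding H. Hence C is exactly the complement of H, and all frame properties follow. -/
theorem KConn.exists_frame (hK : KConn G 3) {C₀ H₀ : Finset V} {L₀ : ZMod 4}
    (hC₀ : CycleOn G w C₀ L₀) (hL₀ : 2 * L₀ = 2) (hne : H₀.Nonempty)
    (hconn : ∀ u ∈ H₀, ∀ v ∈ H₀, Linked G H₀ u v) (hd : Disjoint C₀ H₀) :
    ∃ C L, IsFrame G w C L ∧ Disjoint C H₀ := by
  classical
  obtain ⟨H, hH, hmax⟩ := Finset.exists_max_image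
    (Finset.univ.filter fun H : Finset V => H₀ ⊆ H ∧ (∀ u ∈ H, ∀ v ∈ H, Linked G H u v) ∧
      ∃ C L, CycleOn G w C L ∧ 2 * L = 2 ∧ Disjoint C H) Finset.card
    ⟨H₀, by simpa using ⟨hconn, C₀, L₀, hC₀, hL₀, hd⟩⟩
  simp only [Finset.mem_filter, Finset.mem_univ, true_and] at hH hmax
  obtain ⟨hH0, hHc, C, L, hC, hL, hCH⟩ := hH
  -- Otherwise `a` could be added to H.
  have hN : ∀ a ∉ H, ∀ h ∈ H, G.Adj h a → ∀ C' L', CycleOn G w C' L' → 2 * L' = 2 →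
      Disjoint C' H → a ∈ C' := by
    intro a ha h hh hadj C' L' h1 h2 h3
    by_contra haC
    have hto : ∀ u ∈ insert a H, Linked G (insert a H) u a := by
      intro u hu
      rcases Finset.mem_insert.1 hu with rfl | hu
      · exact .refl (by simp)
      · exact ((hHc u hu h hh).mono (Finset.subset_insert _ _)).adj hadj (by simp)
    have := hmax (insert a H) ⟨hH0.trans (Finset.subset_insert _ _),
      fun u hu v hv => (hto u hu).trans (hto v hv).symm, C', L', h1, h2, by
        rw [Finset.disjoint_insert_right]; exact ⟨haC, h3⟩⟩
    rw [Finset.card_insert_of_notMem ha] at this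
    omega
  -- If `d` had no neighbour in H, its component W among all such vertices would have at least three
  -- boundary vertices, each adjacent to H and therefore on every odd cycle that avoids H.
  have hall : ∀ d ∉ H, ∃ h ∈ H, G.Adj h d := by
    by_contra hcon
    push Not at hcon
    obtain ⟨d, hdH, hdN⟩ := hcon
    set D := Finset.univ.filter (fun v => v ∉ H ∧ ∀ h ∈ H, ¬ G.Adj h v) with hD
    set W := Finset.univ.filter (fun v => Linked G D d v) with hW
    set X := Finset.univ.filter (fun v => v ∉ W ∧ ∃ u ∈ W, G.Adj u v) with hX
    have hdD : d ∈ D := by simp [hD, hdH]; exact hdN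
    have hdW : d ∈ W := by simpa [hW] using Linked.refl hdD
    have hWD : W ⊆ D := fun v hv => by
      simp only [hW, Finset.mem_filter, Finset.mem_univ, true_and] at hv
      exact hv.right_mem
    have hDmem : ∀ v, v ∈ D ↔ v ∉ H ∧ ∀ h ∈ H, ¬ G.Adj h v := by simp [hD]
    obtain ⟨h₀, hh₀⟩ := hne.mono hH0
    have h3 : 3 ≤ X.card := by
      refine hK W X ⟨d, hdW⟩ ?_ ⟨h₀, ?_, ?_⟩
      · intro u hu v huv
        by_cases hv : v ∈ W
        · exact .inl hv
        · exact .inr (by simp only [hX, Finset.mem_filter, Finset.mem_univ, true_and]; exact ⟨hv, u, hu, huv⟩)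
      · intro h
        exact ((hDmem _).1 (hWD h)).1 hh₀
      · intro h
        simp only [hX, Finset.mem_filter, Finset.mem_univ, true_and] at h
        obtain ⟨_, u, hu, huv⟩ := h
        exact ((hDmem _).1 (hWD hu)).2 _ hh₀ huv.symm
    have hXp : ∀ p ∈ X, p ∉ H ∧ p ∉ D ∧ (∀ C' L', CycleOn G w C' L' → 2 * L' = 2 →
        Disjoint C' H → p ∈ C') ∧ ∃ S n, PathOn G w S d p n ∧ S ⊆ insert p D := by
      intro p hp
      simp only [hX, Finset.mem_filter, Finset.mem_univ, true_and] at hp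
      obtain ⟨hpW, u, hu, hup⟩ := hp
      have huD := hWD hu
      have hul : Linked G D d u := by simpa [hW] using hu
      have hpH : p ∉ H := fun h => ((hDmem _).1 huD).2 p h hup.symm
      have hpD : p ∉ D := fun h => hpW (by simpa [hW] using hul.adj hup h)
      have hex : ∃ h ∈ H, G.Adj h p := by
        by_contra hcon
        push Not at hcon
        exact hpD ((hDmem _).2 ⟨hpH, hcon⟩)
      obtain ⟨h, hh, hhp⟩ := hex
      refine ⟨hpH, hpD, hN p hpH h hh hhp, ?_⟩
      exact ((hul.mono (Finset.subset_insert p D)).adj hup (by simp)).path w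
    obtain ⟨p, q, r, hp, hq, hr, hpq, hpr, hqr⟩ := Finset.two_lt_card_iff.1 h3
    have hDH : ∀ v ∈ D, v ∉ H := fun v hv => ((hDmem v).1 hv).1
    have hCH' : ∀ v ∈ C, v ∉ H := fun v hv => Finset.disjoint_left.1 hCH hv
    obtain ⟨hpH, hpD, hpC, Sp, np, hSp, hSp'⟩ := hXp p hp
    obtain ⟨hqH, hqD, hqC, Sq, nq, hSq, hSq'⟩ := hXp q hq
    obtain ⟨hrH, hrD, hrC, Sr, nr, hSr, hSr'⟩ := hXp r hr
    -- closed walks avoiding one of the three attachments are even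
    have key : ∀ {p q r : V} {Sp Sq A : Finset V} {np nq n : ZMod 4}, p ≠ r → q ≠ r → p ∉ H →
        q ∉ H → r ∉ D → (∀ C' L', CycleOn G w C' L' → 2 * L' = 2 → Disjoint C' H → r ∈ C') →
        PathOn G w Sp d p np → Sp ⊆ insert p D → PathOn G w Sq d q nq → Sq ⊆ insert q D →
        PathOn G w A p q n → A ⊆ C → r ∉ A → 2 * (np + n + nq) = 0 := by
      intro p q r Sp Sq A np nq n hpr hqr hpH hqH hrD hrC h1 h2 h3 h4 h5 h6 h7
      refine PathOn.triangle_even (U := (insert r H)ᶜ) ?_ h1 h5 h3 ?_ ?_ ?_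
      · intro C' L' c1 c2 c3
        have hdis : Disjoint C' H := by
          rw [Finset.disjoint_left]
          intro v hv hvH
          have := c2 hv
          simp [hvH] at this
        have := c2 (hrC C' L' c1 c3 hdis)
        simp at this
      · intro v hv
        rcases Finset.mem_insert.1 (h2 hv) with rfl | h
        · simp [hpr, hpH]
        · have := hDH v h
          simp [this]
          rintro rfl
          exact hrD h
      · intro v hv
        have := hCH' v (h6 hv)
        simp [this]
        rintro rfl
        exact h7 hv
      · intro v hv
        rcases Finset.mem_insert.1 (h4 hv) with rfl | h
        · simp [hqr, hqH]
        · have := hDH v h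
          simp [this]
          rintro rfl
          exact hrD h
    have main : ∀ {S₁ S₂ : Finset V} {n₁ n₂ : ZMod 4}, PathOn G w S₁ p q n₁ →
        PathOn G w S₂ p q n₂ → S₁ ∪ S₂ = C → (∀ v ∈ S₁, v ∈ S₂ → v = p ∨ v = q) →
        L = n₁ + n₂ → r ∈ S₂ → False := by
      intro S₁ S₂ n₁ n₂ h1 h2 h3 h4 h5 h6
      have hrS₁ : r ∉ S₁ := fun h => by
        rcases h4 r h h6 with rfl | rfl
        · exact hpr rfl
        · exact hqr rfl
      obtain ⟨B₁, B₂, b₁, b₂, k1, k2, k3, k4, k5⟩ := h2.split h6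
      have e1 := key hpr hqr hpH hqH hrD hrC hSp hSp' hSq hSq' h1
        (by rw [← h3]; exact Finset.subset_union_left) hrS₁
      have e2 := key hpq hqr.symm hpH hrH hqD hqC hSp hSp' hSr hSr' k1
        (by rw [← h3, ← k3]; intro v; simp; tauto) (fun h => hqr (k4 _ h k2.right_mem))
      have e3 := key hpr.symm hpq.symm hrH hqH hpD hpC hSr hSr' hSq hSq' k2
        (by rw [← h3, ← k3]; intro v; simp; tauto) (fun h => hpr (k4 _ k1.left_mem h))
      -- The three even closed walks together run once around C and twice along each path from `d`,
      -- which makes L even.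
      have : (2 : ZMod 4) = 0 := by
        rw [h5, k5] at hL
        linear_combination e1 + e2 + e3 - hL - (np + nq + nr) * ZMod4.four_eq_zero
      exact absurd this (by decide)
    have hpC' := hpC C L hC hL hCH
    have hqC' := hqC C L hC hL hCH
    have hrC' := hrC C L hC hL hCH
    obtain ⟨S₁, S₂, n₁, n₂, h1, h2, h3, h4, h5⟩ := hC.arcs hpC' hqC' hpq
    rw [← h3] at hrC'
    rcases Finset.mem_union.1 hrC' with h | h
    · exact main h2 h1 (by rw [Finset.union_comm, h3]) (fun v hv hv' => h4 v hv' hv)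
        (by rw [h5, add_comm]) h
    · exact main h1 h2 h3 h4 h5 h
  have hallC : ∀ C' L', CycleOn G w C' L' → 2 * L' = 2 → Disjoint C' H → ∀ v, v ∉ H → v ∈ C' := by
    intro C' L' h1 h2 h3 v hv
    obtain ⟨h, hh, hadj⟩ := hall v hv
    exact hN v hv h hh hadj C' L' h1 h2 h3
  have hCc : Cᶜ = H := by
    ext v
    rw [Finset.mem_compl]
    refine ⟨fun h => ?_, fun h h' => Finset.disjoint_left.1 hCH h' h⟩
    by_contra hv
    exact h (hallC C L hC hL hCH v hv)
  have hmem : ∀ v, v ∉ C ↔ v ∈ H := by intro v; rw [← hCc, Finset.mem_compl]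
  refine ⟨C, L, ⟨hC, hL, ?_, ?_, ?_⟩, hCH.mono_right hH0⟩
  · intro u hu v hv
    rw [hCc]
    exact hHc u ((hmem u).1 hu) v ((hmem v).1 hv)
  · intro C' L' h1 h2 h3
    refine Finset.Subset.antisymm h3 fun v hv => ?_
    exact hallC C' L' h1 h2 (hCH.mono_left h3) v (Finset.disjoint_left.1 hCH hv)
  · intro c hc
    obtain ⟨h, hh, hadj⟩ := hall c (Finset.disjoint_left.1 hCH hc)
    exact ⟨h, (hmem h).2 hh, hadj.symm⟩

/-- A graph of minimum degree at least three with an odd cycle has an odd cycle missing a vertex. -/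
theorem exists_odd_cycle_not_spanning {C₀ : Finset V} {L₀ : ZMod 4} (hC₀ : CycleOn G w C₀ L₀)
    (hL₀ : 2 * L₀ = 2)
    (hdeg : ∀ v, ∃ q₁ q₂ q₃, G.Adj v q₁ ∧ G.Adj v q₂ ∧ G.Adj v q₃ ∧ q₁ ≠ q₂ ∧ q₁ ≠ q₃ ∧ q₂ ≠ q₃) :
    ∃ C L h, CycleOn G w C L ∧ 2 * L = 2 ∧ h ∉ C := by
  classical
  obtain ⟨C, hC, hmin⟩ := Finset.exists_min_image
    (Finset.univ.filter fun C : Finset V => ∃ L, CycleOn G w C L ∧ 2 * L = 2) Finset.card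
    ⟨C₀, by simpa using ⟨L₀, hC₀, hL₀⟩⟩
  simp only [Finset.mem_filter, Finset.mem_univ, true_and] at hC hmin
  obtain ⟨L, hC, hL⟩ := hC
  by_contra hcon
  push Not at hcon
  have hall := fun h => hcon C L h hC hL
  obtain ⟨c, _⟩ : C.Nonempty := Finset.card_pos.1 (by have := hC.three_le_card; omega)
  obtain ⟨q₁, q₂, q₃, h1, h2, h3, h4, h5, h6⟩ := hdeg c
  -- If all odd cycles were spanning, a smallest one would contain the three distinct neighbours of
  -- one of its vertices.
  have := hC.degree_le_two hL (fun C' L' g1 g2 g3 =>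
    Finset.eq_of_subset_of_card_le g3 (hmin C' ⟨L', g1, g2⟩)) (hall c) (hall q₁) (hall q₂) (hall q₃)
    h1 h2 h3
  tauto

end Frame

end SimpleGraph

/-! ### Consequences of a missing residue for the cycles and paths off a frame. -/

namespace SimpleGraph

variable {V : Type*} [DecidableEq V]

/-- Every residue modulo four is the weight of a cycle. -/
def Full (G : SimpleGraph V) (w : Sym2 V → ZMod 4) : Prop := ∀ r, ∃ S, CycleOn G w S r

/-- The cycle `Y` of weight `y` splits at `p` and `q` into paths of weights `n` and `y - n`. -/
def Arcs (G : SimpleGraph V) (w : Sym2 V → ZMod 4) (Y : Finset V) (y : ZMod 4) (p q : V)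
    (n : ZMod 4) : Prop :=
  ∃ S₁ S₂, PathOn G w S₁ p q n ∧ PathOn G w S₂ p q (y - n) ∧ S₁ ∪ S₂ = Y ∧
    ∀ v ∈ S₁, v ∈ S₂ → v = p ∨ v = q

section

variable {G : SimpleGraph V} {w : Sym2 V → ZMod 4} {Y : Finset V} {y n : ZMod 4} {p q r : V}

theorem CycleOn.exists_arcs (h : CycleOn G w Y y) (hp : p ∈ Y) (hq : q ∈ Y) (hpq : p ≠ q) :
    ∃ n, Arcs G w Y y p q n := by
  obtain ⟨S₁, S₂, n₁, n₂, h1, h2, h3, h4, h5⟩ := h.arcs hp hq hpq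
  exact ⟨n₁, S₁, S₂, h1, h2.congr rfl (by rw [h5]; ring), h3, h4⟩

theorem Arcs.symm (h : Arcs G w Y y p q n) : Arcs G w Y y q p n := by
  obtain ⟨S₁, S₂, h1, h2, h3, h4⟩ := h
  exact ⟨S₁, S₂, h1.reverse, h2.reverse, h3, fun v hv hv' => (h4 v hv hv').symm⟩

theorem Arcs.compl (h : Arcs G w Y y p q n) : Arcs G w Y y p q (y - n) := by
  obtain ⟨S₁, S₂, h1, h2, h3, h4⟩ := h
  exact ⟨S₂, S₁, h2, h1.congr rfl (by ring), by rw [Finset.union_comm, h3],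
    fun v hv hv' => h4 v hv' hv⟩

/-- The disjunction records which of the two arcs between `p` and `q` contains `r`. -/
theorem Arcs.refine (h : Arcs G w Y y p q n) (hr : r ∈ Y) (hrp : r ≠ p) (hrq : r ≠ q) :
    ∃ m k, Arcs G w Y y p r m ∧ Arcs G w Y y q r k ∧ (n = m + k ∨ y - n = m + k) := by
  have key : ∀ {n}, Arcs G w Y y p q n → (∀ S₁ S₂, PathOn G w S₁ p q n →
      PathOn G w S₂ p q (y - n) → S₁ ∪ S₂ = Y → (∀ v ∈ S₁, v ∈ S₂ → v = p ∨ v = q) → r ∈ S₁ →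
      ∃ m k, Arcs G w Y y p r m ∧ Arcs G w Y y q r k ∧ n = m + k) := by
    intro n _ S₁ S₂ h1 h2 h3 h4 hr
    obtain ⟨A, B, a, b, k1, k2, rfl, k4, rfl⟩ := h1.split hr
    have hqA : q ∉ A := fun h => hrq (k4 _ h k2.right_mem).symm
    have hpB : p ∉ B := fun h => hrp (k4 _ k1.left_mem h).symm
    have e1 := h2.append k2.reverse (by
      intro v hv hv'
      rcases h4 v (by simp [hv']) hv with rfl | rfl
      · exact absurd hv' hpB
      · rfl)
    have e2 := h2.reverse.append k1 (by
      intro v hv hv'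
      rcases h4 v (by simp [hv']) hv with rfl | rfl
      · rfl
      · exact absurd hv' hqA)
    refine ⟨a, b, ⟨A, _, k1, e1.congr rfl (by ring), ?_, ?_⟩,
      ⟨B, _, k2.reverse, e2.congr rfl (by ring), ?_, ?_⟩, rfl⟩
    · rw [← h3]; ext v; simp; tauto
    · intro v hv hv'
      rcases Finset.mem_union.1 hv' with h | h
      · rcases h4 v (by simp [hv]) h with rfl | rfl
        · exact .inl rfl
        · exact absurd hv hqA
      · exact .inr (k4 v hv h)
    · rw [← h3]; ext v; simp; tauto
    · intro v hv hv'
      rcases Finset.mem_union.1 hv' with h | h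
      · rcases h4 v (by simp [hv]) h with rfl | rfl
        · exact absurd hv hpB
        · exact .inl rfl
      · exact .inr (k4 v h hv)
  have h' := h
  obtain ⟨S₁, S₂, h1, h2, h3, h4⟩ := h
  rcases Finset.mem_union.1 (h3 ▸ hr) with hr' | hr'
  · obtain ⟨m, k, e1, e2, e3⟩ := key h' S₁ S₂ h1 h2 h3 h4 hr'
    exact ⟨m, k, e1, e2, .inl e3⟩
  · obtain ⟨m, k, e1, e2, e3⟩ := key h'.compl S₂ S₁ h2 (h1.congr rfl (by ring))
      (by rw [Finset.union_comm, h3]) (fun v hv hv' => h4 v hv' hv) hr'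
    exact ⟨m, k, e1, e2, .inr e3⟩

end

namespace IsFrame

variable [Fintype V] {G : SimpleGraph V} {w : Sym2 V → ZMod 4} {C Y : Finset V} {L y : ZMod 4}
  {c₁ c₂ c₃ u₁ u₂ y₁ y₂ : V} {n m p : ZMod 4} {S₁ S₂ T₁ T₂ : Finset V} {t₁ t₂ : ZMod 4}

theorem exists_arcs (hF : IsFrame G w C L) (h₁ : c₁ ∈ C) (h₂ : c₂ ∈ C) (hne : c₁ ≠ c₂) :
    ∃ E O e, PathOn G w E c₁ c₂ e ∧ PathOn G w O c₁ c₂ (L - e) ∧ E ∪ O = C ∧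
      (∀ v ∈ E, v ∈ O → v = c₁ ∨ v = c₂) ∧ 2 * e = 0 := by
  obtain ⟨n, hn⟩ := hF.cyc.exists_arcs h₁ h₂ hne
  rcases ZMod4.even_or_odd n with h | h
  · obtain ⟨S₁, S₂, h1, h2, h3, h4⟩ := hn
    exact ⟨S₁, S₂, n, h1, h2, h3, h4, h⟩
  · obtain ⟨S₁, S₂, h1, h2, h3, h4⟩ := hn.compl
    exact ⟨S₁, S₂, _, h1, h2, h3, h4, by linear_combination hF.odd - h⟩

/-- The shift `s` is the weight of the even arc and the two attaching edges, so it is the same for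
all paths S. As `e` is even, `L - e = L + e`, and the odd arc adds exactly L. -/
theorem exists_cycles (hF : IsFrame G w C L) (h₁ : c₁ ∈ C) (h₂ : c₂ ∈ C) (hne : c₁ ≠ c₂)
    (a₁ : G.Adj u₁ c₁) (a₂ : G.Adj u₂ c₂) :
    ∃ s, (2 * s = 2 * (w s(u₁, c₁) + w s(u₂, c₂))) ∧ ∀ S p, PathOn G w S u₁ u₂ p → Disjoint S C →
      (∃ T, CycleOn G w T (p + s)) ∧ ∃ T, CycleOn G w T (p + s + L) := by
  obtain ⟨E, O, e, hE, hO, hEO, -, he⟩ := hF.exists_arcs h₁ h₂ hne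
  refine ⟨e + w s(u₁, c₁) + w s(u₂, c₂), by linear_combination he, fun S p hS hd => ⟨?_, ?_⟩⟩
  · have hd' : Disjoint S E := hd.mono_right (by rw [← hEO]; exact Finset.subset_union_left)
    have := hE.two_le_card hne
    have := Finset.card_pos.2 ⟨_, hS.left_mem⟩
    exact ⟨_, (CycleOn.join hS hE a₁ a₂ hd' (by omega)).congr rfl (by ring)⟩
  · have hd' : Disjoint S O := hd.mono_right (by rw [← hEO]; exact Finset.subset_union_right)
    have := hO.two_le_card hne
    have := Finset.card_pos.2 ⟨_, hS.left_mem⟩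
    exact ⟨_, (CycleOn.join hS hO a₁ a₂ hd' (by omega)).congr rfl (by
      linear_combination - he)⟩

theorem full_of_paths (hF : IsFrame G w C L) (h₁ : c₁ ∈ C) (h₂ : c₂ ∈ C) (hne : c₁ ≠ c₂)
    (a₁ : G.Adj u₁ c₁) (a₂ : G.Adj u₂ c₂) (hS₁ : PathOn G w S₁ u₁ u₂ n)
    (hS₂ : PathOn G w S₂ u₁ u₂ m) (hnm : m = n + 2) (d₁ : Disjoint S₁ C) (d₂ : Disjoint S₂ C) :
    Full G w := by
  obtain ⟨s, -, h⟩ := hF.exists_cycles h₁ h₂ hne a₁ a₂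
  obtain ⟨e1, e2⟩ := h _ _ hS₁ d₁
  obtain ⟨e3, e4⟩ := h _ _ hS₂ d₂
  subst hnm
  have : ∀ s L n r : ZMod 4, 2 * L = 2 → r = n + s ∨ r = n + s + L ∨ r = n + 2 + s ∨
      r = n + 2 + s + L := by decide
  intro r
  rcases this s L n r hF.odd with rfl | rfl | rfl | rfl <;> assumption

/-- Two disjoint links attached to a set with two connecting paths whose weights differ by two. -/
theorem full_of_links (hF : IsFrame G w C L) (hCY : Disjoint C Y)
    (l₁ : IsLink G w C Y y₁ u₁ c₁ T₁ t₁) (l₂ : IsLink G w C Y y₂ u₂ c₂ T₂ t₂)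
    (hT : Disjoint T₁ T₂) (hne : c₁ ≠ c₂)
    (hS₁ : PathOn G w S₁ y₁ y₂ n) (hS₂ : PathOn G w S₂ y₁ y₂ m) (hnm : m = n + 2)
    (hY₁ : S₁ ⊆ Y) (hY₂ : S₂ ⊆ Y) : Full G w := by
  have key : ∀ {S n}, PathOn G w S y₁ y₂ n → S ⊆ Y →
      PathOn G w (T₁ ∪ (S ∪ T₂)) u₁ u₂ (t₁ + (n + t₂)) ∧ Disjoint (T₁ ∪ (S ∪ T₂)) C := by
    intro S n hS hSY
    refine ⟨l₁.path.reverse.append (hS.append l₂.path ?_) ?_, ?_⟩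
    · intro v hv hv'; exact l₂.only v hv' (hSY hv)
    · intro v hv hv'
      rcases Finset.mem_union.1 hv' with h | h
      · exact l₁.only v hv (hSY h)
      · exact absurd h (Finset.disjoint_left.1 hT hv)
    · rw [Finset.disjoint_union_left, Finset.disjoint_union_left]
      exact ⟨l₁.disj, hCY.symm.mono_left hSY, l₂.disj⟩
  exact hF.full_of_paths l₁.mem_right l₂.mem_right hne l₁.adj l₂.adj (key hS₁ hY₁).1
    (key hS₂ hY₂).1 (by rw [hnm]; ring) (key hS₁ hY₁).2 (key hS₂ hY₂).2

theorem full_of_arcs (hF : IsFrame G w C L) (hCY : Disjoint C Y)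
    (l₁ : IsLink G w C Y y₁ u₁ c₁ T₁ t₁) (l₂ : IsLink G w C Y y₂ u₂ c₂ T₂ t₂)
    (hT : Disjoint T₁ T₂) (hne : c₁ ≠ c₂) (ha : Arcs G w Y y y₁ y₂ n) (hn : y - n = n + 2) :
    Full G w := by
  obtain ⟨A₁, A₂, h1, h2, h3, -⟩ := ha
  exact hF.full_of_links hCY l₁ l₂ hT hne h1 h2 hn (by rw [← h3]; exact Finset.subset_union_left)
    (by rw [← h3]; exact Finset.subset_union_right)

/-- On a cycle of weight 2, two points at even distance are joined by arcs whose weights differ by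
2. Of the three ends of disjoint links to C, some two are at even distance. -/
theorem weight_ne_two (hF : IsFrame G w C L) (hK : KConn G 3) (hn : ¬ Full G w)
    (hY : CycleOn G w Y y) (hCY : Disjoint C Y) : y ≠ 2 := by
  rintro rfl
  obtain ⟨p, u, c, T, t, h1, h2⟩ := hK.links w hF.cyc.three_le_card hY.three_le_card hCY
  have hp : ∀ i j, i ≠ j → p i ≠ p j := fun i j hij h =>
    Finset.disjoint_left.1 (h2 i j hij).1 (h1 i).path.left_mem (h ▸ (h1 j).path.left_mem)
  have hodd : ∀ i j n, i ≠ j → Arcs G w Y 2 (p i) (p j) n → 2 * n = 2 := by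
    intro i j n hij ha
    rcases ZMod4.even_or_odd n with h | h
    · exact absurd (hF.full_of_arcs hCY (h1 i) (h1 j) (h2 i j hij).1 (h2 i j hij).2 ha
        (by linear_combination - h)) hn
    · exact h
  obtain ⟨n, ha⟩ := hY.exists_arcs (h1 0).mem_left (h1 1).mem_left (hp 0 1 (by decide))
  obtain ⟨m, k, hm, hk, hnmk⟩ := ha.refine (h1 2).mem_left (hp 2 0 (by decide)) (hp 2 1 (by decide))
  have e1 := hodd 0 1 n (by decide) ha
  have e2 := hodd 0 2 m (by decide) hm
  have e3 := hodd 1 2 k (by decide) hk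
  clear hm hk ha
  revert e1 e2 e3 hnmk
  revert n m k
  decide

set_option synthInstance.maxHeartbeats 200000 in
set_option synthInstance.maxSize 1000 in
-- Two of three links have attaching weights of equal parity. With them an odd cycle of weight `a`
-- yields s, s + L, s + a and s + a + L for some even s. The one missing residue is odd if `a = L`
-- and even if `a = -L`, so two odd cycles of different weights miss nothing in common.
theorem weight_eq (hF : IsFrame G w C L) (hK : KConn G 3) (hn : ¬ Full G w) {Y₁ Y₂ : Finset V}
    {a b : ZMod 4} (h₁ : CycleOn G w Y₁ a) (d₁ : Disjoint C Y₁) (o₁ : 2 * a = 2)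
    (h₂ : CycleOn G w Y₂ b) (d₂ : Disjoint C Y₂) (o₂ : 2 * b = 2) : a = b := by
  have key : ∀ {Y a}, CycleOn G w Y a → Disjoint C Y → 2 * a = 2 →
      ∃ s, 2 * s = 0 ∧ ∀ r, r = s ∨ r = s + L ∨ r = s + a ∨ r = s + a + L →
        ∃ S, CycleOn G w S r := by
    intro Y a hY hCY ho
    obtain ⟨p, u, c, T, t, h1, h2⟩ := hK.links w hF.cyc.three_le_card hY.three_le_card hCY
    obtain ⟨i, j, hij, hev⟩ : ∃ i j, i ≠ j ∧
        2 * (t i + w s(u i, c i) + (t j + w s(u j, c j))) = 0 := by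
      have arith : ∀ a b c : ZMod 4, 2 * (a + b) = 0 ∨ 2 * (a + c) = 0 ∨ 2 * (b + c) = 0 := by
        decide
      rcases arith (t 0 + w s(u 0, c 0)) (t 1 + w s(u 1, c 1)) (t 2 + w s(u 2, c 2)) with h | h | h
      exacts [⟨0, 1, by decide, h⟩, ⟨0, 2, by decide, h⟩, ⟨1, 2, by decide, h⟩]
    have h01 := h2 i j hij
    have hp : p i ≠ p j := fun h =>
      Finset.disjoint_left.1 h01.1 (h1 i).path.left_mem (h ▸ (h1 j).path.left_mem)
    obtain ⟨n, S₁, S₂, k1, k2, k3, -⟩ := hY.exists_arcs (h1 i).mem_left (h1 j).mem_left hp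
    obtain ⟨s, hs2, hs⟩ := hF.exists_cycles (h1 i).mem_right (h1 j).mem_right h01.2 (h1 i).adj
      (h1 j).adj
    have hpath : ∀ {S n}, PathOn G w S (p i) (p j) n → S ⊆ Y →
        PathOn G w (T i ∪ (S ∪ T j)) (u i) (u j) (t i + (n + t j)) ∧
          Disjoint (T i ∪ (S ∪ T j)) C := by
      intro S n hS hSY
      refine ⟨(h1 i).path.reverse.append (hS.append (h1 j).path ?_) ?_, ?_⟩
      · intro v hv hv'; exact (h1 j).only v hv' (hSY hv)
      · intro v hv hv'
        rcases Finset.mem_union.1 hv' with h | h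
        · exact (h1 i).only v hv (hSY h)
        · exact absurd h (Finset.disjoint_left.1 h01.1 hv)
      · rw [Finset.disjoint_union_left, Finset.disjoint_union_left]
        exact ⟨(h1 i).disj, hCY.symm.mono_left hSY, (h1 j).disj⟩
    have p1 := hpath k1 (by rw [← k3]; exact Finset.subset_union_left)
    have p2 := hpath k2 (by rw [← k3]; exact Finset.subset_union_right)
    obtain ⟨⟨X₁, q1⟩, ⟨X₂, q2⟩⟩ := hs _ _ p1.1 p1.2
    obtain ⟨⟨X₃, q3⟩, ⟨X₄, q4⟩⟩ := hs _ _ p2.1 p2.2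
    have arith : ∀ n a L c : ZMod 4, 2 * a = 2 → 2 * L = 2 → 2 * c = 0 → ∃ s, 2 * s = 0 ∧ ∀ r,
        r = s ∨ r = s + L ∨ r = s + a ∨ r = s + a + L →
        r = n + c ∨ r = n + c + L ∨ r = a - n + c ∨ r = a - n + c + L := by decide
    obtain ⟨s', e1, e2⟩ := arith n a L (t i + t j + s) ho hF.odd (by linear_combination hev + hs2)
    refine ⟨s', e1, fun r hr => ?_⟩
    rcases e2 r hr with rfl | rfl | rfl | rfl
    · exact ⟨_, q1.congr rfl (by ring)⟩
    · exact ⟨_, q2.congr rfl (by ring)⟩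
    · exact ⟨_, q3.congr rfl (by ring)⟩
    · exact ⟨_, q4.congr rfl (by ring)⟩
  obtain ⟨s, hs, hs'⟩ := key h₁ d₁ o₁
  obtain ⟨s', hs2, hs2'⟩ := key h₂ d₂ o₂
  by_contra hab
  refine hn fun r => ?_
  have arith : ∀ a b L : ZMod 4, 2 * a = 2 → 2 * b = 2 → 2 * L = 2 → a ≠ b →
      ∀ s s' r : ZMod 4, 2 * s = 0 → 2 * s' = 0 → (r = s ∨ r = s + L ∨ r = s + a ∨ r = s + a + L) ∨
      (r = s' ∨ r = s' + L ∨ r = s' + b ∨ r = s' + b + L) := by decide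
  rcases arith a b L o₁ o₂ hF.odd hab s s' r hs hs2 with h | h
  · exact hs' r h
  · exact hs2' r h

set_option synthInstance.maxHeartbeats 200000 in
set_option synthInstance.maxSize 1000 in
-- If all three paths were odd, pairwise sums equal to 0 would be impossible, as one of the sums is
-- 2. If exactly two were odd, the two odd cycles would have equal weight, so the odd paths would
-- too, and together they would form a cycle of weight 2.
theorem theta_even (hF : IsFrame G w C L) (hK : KConn G 3) (hn : ¬ Full G w) {n₁ n₂ n₃ : ZMod 4}
    {Y₁ Y₂ Y₃ : Finset V} (h₁ : CycleOn G w Y₁ (n₁ + n₂)) (h₂ : CycleOn G w Y₂ (n₁ + n₃))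
    (h₃ : CycleOn G w Y₃ (n₂ + n₃)) (d₁ : Disjoint C Y₁) (d₂ : Disjoint C Y₂) (d₃ : Disjoint C Y₃)
    (ho : 2 * n₁ = 2) : 2 * n₂ = 0 ∧ 2 * n₃ = 0 := by
  have e1 := hF.weight_ne_two hK hn h₁ d₁
  have e2 := hF.weight_ne_two hK hn h₂ d₂
  have e3 := hF.weight_ne_two hK hn h₃ d₃
  have e4 := fun a b => hF.weight_eq hK hn h₁ d₁ a h₂ d₂ b
  have e5 := fun a b => hF.weight_eq hK hn h₁ d₁ a h₃ d₃ b
  have e6 := fun a b => hF.weight_eq hK hn h₂ d₂ a h₃ d₃ b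
  clear h₁ h₂ h₃
  revert n₁ n₂ n₃
  decide

/-- On a cycle of weight 0, two points at odd distance have arcs n and -n, which differ by 2; so
they must not be the ends of disjoint links. Two disjoint links therefore start at points of equal
parity, and one of `u`, `z` is at odd distance from both. Its edge to C forms a forbidden pair with
a link ending elsewhere on C. -/
theorem full_of_odd_arcs (hF : IsFrame G w C L) (hK : KConn G 3) (hY : CycleOn G w Y 0)
    (hCY : Disjoint C Y) {u z c₁ c₂ : V} (ha : Arcs G w Y 0 u z n) (hn : 2 * n = 2)
    (hu : u ∈ Y) (hz : z ∈ Y) (huz : u ≠ z) (h₁ : c₁ ∈ C) (h₂ : c₂ ∈ C) (a₁ : G.Adj u c₁)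
    (a₂ : G.Adj z c₂) : Full G w := by
  by_contra hnF
  let O : V → V → Prop := fun p q => p ≠ q ∧ p ∈ Y ∧ q ∈ Y ∧ ∃ n, Arcs G w Y 0 p q n ∧ 2 * n = 2
  have hsymm : ∀ {p q}, O p q → O q p := fun ⟨h1, h2, h3, n, h4, h5⟩ =>
    ⟨h1.symm, h3, h2, n, h4.symm, h5⟩
  -- Odd distance on a cycle of even weight means lying in different parity classes.
  have hthird : ∀ {p q} r, r ∈ Y → O p q → O p r ∨ O q r := by
    intro p q r hr hpq
    by_cases hrp : r = p
    · subst hrp; exact .inr (hsymm hpq)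
    by_cases hrq : r = q
    · subst hrq; exact .inl hpq
    obtain ⟨h1, h2, h3, n, h4, h5⟩ := hpq
    obtain ⟨m, k, h6, h7, h8⟩ := h4.refine hr hrp hrq
    rcases ZMod4.even_or_odd m with h | h
    · refine .inr ⟨Ne.symm hrq, h3, hr, k, h7, ?_⟩
      clear h4 h6 h7
      revert h5 h8 h
      revert n m k
      decide
    · exact .inl ⟨Ne.symm hrp, h2, hr, m, h6, h⟩
  have hfull : ∀ {p q u₁ u₂ c₁ c₂ T₁ T₂ t₁ t₂}, O p q → IsLink G w C Y p u₁ c₁ T₁ t₁ →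
      IsLink G w C Y q u₂ c₂ T₂ t₂ → Disjoint T₁ T₂ → c₁ ≠ c₂ → False := by
    intro p q u₁ u₂ c₁ c₂ T₁ T₂ t₁ t₂ ⟨h1, h2, h3, n, h4, h5⟩ l₁ l₂ hT hc
    exact hnF (hF.full_of_arcs hCY l₁ l₂ hT hc h4 (by
      clear h4; revert n; decide))
  have htriv : ∀ {p c}, p ∈ Y → c ∈ C → G.Adj p c → IsLink G w C Y p p c {p} 0 := by
    intro p c hp hc hadj
    exact ⟨hp, hc, .nil p, hadj, by simpa using Finset.disjoint_right.1 hCY hp, by simp⟩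
  have hK2 : KConn G 2 := hK.mono (by norm_num)
  obtain ⟨p, v, c, T, t, h1, h2⟩ := hK2.links w ((by norm_num : 2 ≤ 3).trans hF.cyc.three_le_card)
    ((by norm_num : 2 ≤ 3).trans hY.three_le_card) hCY
  have h01 := h2 0 1 (by decide)
  have hboth : ∀ {u c₀}, c₀ ∈ C → G.Adj u c₀ → O u (p 0) → O u (p 1) → False := by
    intro u c₀ hc hadj o0 o1
    have key : ∀ i, c₀ ≠ c i → O u (p i) → False := fun i hi ho =>
      hfull ho (htriv ho.2.1 hc hadj) (h1 i) (by
        rw [Finset.disjoint_singleton_left]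
        exact fun h => ho.1 ((h1 i).only u h ho.2.1)) hi
    by_cases h : c₀ = c 0
    · exact key 1 (fun h' => h01.2 (h ▸ h')) o1
    · exact key 0 h o0
  have h01' : ¬ O (p 0) (p 1) := fun h => hfull h (h1 0) (h1 1) h01.1 h01.2
  have huz' : O u z := ⟨huz, hu, hz, n, ha, hn⟩
  have e0 := hthird (p 0) (h1 0).mem_left huz'
  have e1 := hthird (p 1) (h1 1).mem_left huz'
  rcases e0 with e0 | e0
  · rcases hthird (p 1) (h1 1).mem_left e0 with e | e
    · exact hboth h₁ a₁ e0 e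
    · exact h01' e
  · rcases hthird (p 1) (h1 1).mem_left e0 with e | e
    · exact hboth h₂ a₂ e0 e
    · exact h01' e

/-- The frame cycle is split at three vertices into arcs of weights `x₁₃`, `x₃₂` and `x₁₂`. -/
theorem full_of_three_arcs (hF : IsFrame G w C L) {h v : V} {X₁₃ X₃₂ X₁₂ : Finset V}
    {x₁₃ x₃₂ x₁₂ : ZMod 4} (hh : h ∉ C) (hv : v ∉ C) (a₁ : G.Adj h c₁)
    (a₂ : G.Adj h c₂) (hw : w s(h, c₁) = w s(h, c₂)) (a₃ : G.Adj v c₃)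
    (p₁₃ : PathOn G w X₁₃ c₁ c₃ x₁₃) (p₃₂ : PathOn G w X₃₂ c₃ c₂ x₃₂)
    (p₁₂ : PathOn G w X₁₂ c₁ c₂ x₁₂) (s₁₃ : X₁₃ ⊆ C) (s₃₂ : X₃₂ ⊆ C) (s₁₂ : X₁₂ ⊆ C)
    (d₁ : ∀ v ∈ X₁₃, v ∈ X₁₂ → v = c₁) (d₂ : ∀ v ∈ X₃₂, v ∈ X₁₂ → v = c₂)
    (ne₁ : c₁ ≠ c₃) (ne₂ : c₃ ≠ c₂)
    (harith : ∀ r, r = x₁₃ ∨ r = x₁₂ + x₃₂ ∨ r = x₃₂ ∨ r = x₁₂ + x₁₃) : Full G w := by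
  obtain ⟨P, p, hP, hPC⟩ := (hF.linked h hh v hv).path w
  have hPd : Disjoint P C := by
    rw [Finset.disjoint_left]; intro z hz; simpa using hPC hz
  have hPc := Finset.card_pos.2 ⟨_, hP.left_mem⟩
  -- From either of `c₁` and `c₂` there are two ways round the frame to `c₃`; these are the four
  -- weights in `harith`.
  have q1 := p₁₂.append p₃₂.reverse (fun v h1 h2 => d₂ v h2 h1)
  have q2 := p₁₂.reverse.append p₁₃ (fun v h1 h2 => d₁ v h2 h1)
  have c13 := p₁₃.two_le_card ne₁
  have c32 := p₃₂.two_le_card ne₂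
  have cq1 := q1.two_le_card ne₁
  have cq2 := q2.two_le_card ne₂.symm
  have e1 := CycleOn.join hP p₁₃ a₁ a₃ (hPd.mono_right s₁₃) (by omega)
  have e2 := CycleOn.join hP q1 a₁ a₃ (hPd.mono_right (Finset.union_subset s₁₂ s₃₂)) (by omega)
  have e3 := CycleOn.join hP p₃₂.reverse a₂ a₃ (hPd.mono_right s₃₂) (by omega)
  have e4 := CycleOn.join hP q2 a₂ a₃ (hPd.mono_right (Finset.union_subset s₁₂ s₁₃)) (by omega)
  intro r
  rcases harith (r - p - w s(h, c₁) - w s(v, c₃)) with hr | hr | hr | hr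
  · exact ⟨_, e1.congr rfl (by linear_combination -hr)⟩
  · exact ⟨_, e2.congr rfl (by linear_combination -hr)⟩
  · exact ⟨_, e3.congr rfl (by rw [← hw]; linear_combination -hr)⟩
  · exact ⟨_, e4.congr rfl (by rw [← hw]; linear_combination -hr)⟩

/-- A long unit frame with a vertex outside that has two neighbours on it. -/
theorem full_of_two_attachments (hF : IsFrame G w C L)
    (hunit : ∀ u ∈ C, ∀ v ∈ C, G.Adj u v → w s(u, v) = 1) (hcard : C.card ≠ 3) {h : V} (hh : h ∉ C)
    (hne : c₁ ≠ c₂) (h₁ : c₁ ∈ C) (h₂ : c₂ ∈ C) (a₁ : G.Adj h c₁) (a₂ : G.Adj h c₂)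
    (hw : w s(h, c₁) = w s(h, c₂)) : Full G w := by
  obtain ⟨E, O, e, hE, hO, hEO, hd, he⟩ := hF.exists_arcs h₁ h₂ hne
  have hEC : E ⊆ C := by rw [← hEO]; exact Finset.subset_union_left
  have hOC : O ⊆ C := by rw [← hEO]; exact Finset.subset_union_right
  have uE := hE.unit (fun u hu v hv => hunit u (hEC hu) v (hEC hv))
  have uO := hO.unit (fun u hu v hv => hunit u (hOC hu) v (hOC hv))
  have hL := hF.odd
  have hE2 := hE.two_le_card hne
  have hO2 := hO.two_le_card hne
  have hEne : E.card ≠ 2 := by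
    intro h; rw [h] at uE; clear hE hO uO; revert e; decide
  obtain ⟨c₃, E', e', g1, g2, g3, rfl, rfl⟩ := hE.first hne
  have hwc := hunit c₁ h₁ c₃ (hEC (by simp [g3.left_mem])) g1
  rw [hwc] at he hO uE uO
  rw [Finset.card_insert_of_notMem g2] at hEne hE2
  have hc32 : c₃ ≠ c₂ := by
    rintro rfl
    have := g3.eq_singleton.1
    rw [this] at hEne
    simp at hEne
  -- For an even arc of weight 0, the third vertex is the neighbour of `c₁` on it. The direct routes
  -- have weights 1 and 3, and the routes through the odd arc have the two even weights.
  by_cases he0 : 1 + e' = 0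
  · obtain ⟨v, hv, hadj⟩ := hF.nbr c₃ (hEC (by simp [g3.left_mem]))
    refine hF.full_of_three_arcs hh hv a₁ a₂ hw hadj.symm
      (PathOn.edge g1) g3 hO ?_ (fun v hv => hEC (by simp [hv])) hOC ?_ ?_ g1.ne hc32 ?_
    · intro v hv
      simp at hv
      rcases hv with rfl | rfl
      exacts [h₁, hEC (by simp [g3.left_mem])]
    · intro v hv hv'
      simp at hv
      rcases hv with rfl | rfl
      · rfl
      · rcases hd v (by simp [g3.left_mem]) hv' with h | h
        · exact h
        · exact absurd h hc32
    · intro v hv hv'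
      rcases hd v (by simp [hv]) hv' with rfl | rfl
      · exact absurd hv g2
      · rfl
    · rw [hwc]
      clear hE hO g3 uE uO hF
      revert L e'
      decide
  have he2 : e' = 1 := by
    clear hE hO g3 uE uO
    revert e'; decide
  subst he2
  -- The even arc has weight 2. If the odd arc has an inner vertex, the neighbour of `c₁` on it is
  -- the third vertex; otherwise the vertex two steps from `c₁` on the even arc is, which splits
  -- that arc into weights 2 and 0.
  by_cases hO3 : O.card = 2
  · -- the odd arc is a single edge
    -- The even arc contains all vertices of C, and a frame that is no triangle has more than three.
    have hE5 : 3 ≤ E'.card := by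
      have h5 : (insert c₁ E').card + O.card = C.card + 2 := by
        rw [← hEO, ← Finset.card_union_add_card_inter]
        congr 1
        rw [← Finset.card_pair hne]
        congr 1
        ext v
        constructor
        · intro hv
          have := hd v (Finset.mem_inter.1 hv).1 (Finset.mem_inter.1 hv).2
          simpa using this
        · intro hv
          simp at hv
          rcases hv with rfl | rfl
          · exact Finset.mem_inter.2 ⟨by simp, hO.left_mem⟩
          · exact Finset.mem_inter.2 ⟨hE.right_mem, hO.right_mem⟩
      rw [Finset.card_insert_of_notMem g2] at h5
      omega
    obtain ⟨c₄, E'', e'', k1, k2, k3, rfl, k5⟩ := g3.first hc32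
    rw [Finset.card_insert_of_notMem k2] at hE5
    have hwc' := hunit c₃ (hEC (by simp)) c₄ (hEC (by simp [k3.left_mem])) k1
    have hc42 : c₄ ≠ c₂ := by
      rintro rfl
      have := k3.eq_singleton.1
      rw [this] at hE5
      simp at hE5
    have hc41 : c₁ ≠ c₄ := by
      rintro rfl
      exact g2 (by simp [k3.left_mem])
    have he'' : e'' = 0 := by rw [hwc'] at k5; linear_combination -k5
    subst he''
    obtain ⟨v, hv, hadj⟩ := hF.nbr c₄ (hEC (by simp [k3.left_mem]))
    have hpath : PathOn G w {c₁, c₃, c₄} c₁ c₄ 2 :=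
      (PathOn.cons g1 (by simp; exact ⟨g1.ne, hc41⟩) (PathOn.edge k1)).congr rfl (by
        rw [hwc, hwc']; rfl)
    refine hF.full_of_three_arcs hh hv a₁ a₂ hw hadj.symm
      hpath k3 hO ?_ (fun v hv => hEC (by simp [hv])) hOC ?_ ?_ hc41 hc42 ?_
    · intro v hv
      apply hEC
      simp at hv ⊢
      rcases hv with rfl | rfl | rfl
      · simp
      · simp
      · simp [k3.left_mem]
    · intro v hv hv'
      have hvE : v ∈ insert c₁ (insert c₃ E'') := by
        simp at hv ⊢
        rcases hv with rfl | rfl | rfl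
        · simp
        · simp
        · simp [k3.left_mem]
      rcases hd v hvE hv' with rfl | rfl
      · rfl
      · simp [hne.symm, hc32.symm, hc42.symm] at hv
    · intro v hv hv'
      rcases hd v (by simp [hv]) hv' with rfl | rfl
      · exact absurd (by simp [hv]) g2
      · rfl
    · clear hE hO uE uO hF
      revert L
      decide
  · obtain ⟨c₄, O', o', k1, k2, k3, rfl, k5⟩ := hO.first hne
    have hwc' := hunit c₁ h₁ c₄ (hOC (by simp [k3.left_mem])) k1
    rw [Finset.card_insert_of_notMem k2] at hO3
    have hc42 : c₄ ≠ c₂ := by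
      rintro rfl
      have := k3.eq_singleton.1
      rw [this] at hO3
      simp at hO3
    obtain ⟨v, hv, hadj⟩ := hF.nbr c₄ (hOC (by simp [k3.left_mem]))
    have hE' := hE
    rw [hwc] at hE'
    refine hF.full_of_three_arcs hh hv a₁ a₂ hw hadj.symm
      (PathOn.edge k1) k3 hE' ?_ (fun v hv => hOC (by simp [hv])) hEC ?_ ?_ k1.ne hc42 ?_
    · intro v hv
      simp at hv
      rcases hv with rfl | rfl
      exacts [h₁, hOC (by simp [k3.left_mem])]
    · intro v hv hv'
      simp at hv
      rcases hv with rfl | rfl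
      · rfl
      · rcases hd v hv' (by simp [k3.left_mem]) with h | h
        · exact h
        · exact absurd h hc42
    · intro v hv hv'
      rcases hd v hv' (by simp [hv]) with rfl | rfl
      · exact absurd hv k2
      · rfl
    · rw [hwc']
      rw [hwc'] at k5
      clear hE hO uE uO k3 hE' hF
      revert L o'
      decide

end IsFrame

end SimpleGraph

/-! ### Longest paths off a frame and their rotations. -/

namespace SimpleGraph

variable {V : Type*} [DecidableEq V]

section

variable {G : SimpleGraph V} {w : Sym2 V → ZMod 4} {S A B : Finset V} {n α β : ZMod 4}
  {a b c e q q' r v : V}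

/-- Two vertices of a path cut it into three pieces. -/
theorem PathOn.order₂ {P : V → Prop} (h : PathOn G w S a e n) (hq : q ∈ S) (hq' : q' ∈ S)
    (hne : q ≠ q') (hP : P q) (hP' : P q') :
    ∃ b c A B D α β δ, P b ∧ P c ∧ b ≠ c ∧ PathOn G w A a b α ∧ PathOn G w B b c β ∧
      PathOn G w D c e δ ∧ A ∪ (B ∪ D) = S ∧ (∀ v ∈ A, v ∈ B ∪ D → v = b) ∧
      (∀ v ∈ B, v ∈ D → v = c) ∧ n = α + (β + δ) := by
  obtain ⟨A, E, α, ε, h1, h2, h3, h4, h5⟩ := h.split hq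
  rw [← h3] at hq'
  rcases Finset.mem_union.1 hq' with hq' | hq'
  · obtain ⟨A', B, α', β, k1, k2, k3, k4, k5⟩ := h1.split hq'
    refine ⟨q', q, A', B, E, α', β, ε, hP', hP, hne.symm, k1, k2, h2, ?_, ?_, ?_, ?_⟩
    · rw [← h3, ← k3, Finset.union_assoc]
    · intro v hv hv'
      rcases Finset.mem_union.1 hv' with hv' | hv'
      · exact k4 v hv hv'
      · have := h4 v (by rw [← k3]; simp [hv]) hv'
        subst this
        exact k4 _ hv k2.right_mem
    · intro v hv hv'
      exact h4 v (by rw [← k3]; simp [hv]) hv'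
    · rw [h5, k5, add_assoc]
  · obtain ⟨B, D, β, δ, k1, k2, k3, k4, k5⟩ := h2.split hq'
    exact ⟨q, q', A, B, D, α, β, δ, hP, hP', hne, h1, k1, k2, by rw [k3, h3], by rw [k3]; exact h4,
      k4, by rw [h5, k5]⟩

theorem PathOn.order₃ {P : V → Prop} (h : PathOn G w S a e n) (hq : q ∈ S) (hq' : q' ∈ S)
    (hr : r ∈ S) (hne : q ≠ q') (hqr : q ≠ r) (hqr' : q' ≠ r) (hP : P q) (hP' : P q') (hPr : P r) :
    ∃ b c d A B D α β δ, P b ∧ P c ∧ P d ∧ b ≠ c ∧ c ≠ d ∧ PathOn G w A a b α ∧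
      PathOn G w B b c β ∧ PathOn G w D c d δ ∧ A ∪ (B ∪ D) ⊆ S ∧ (∀ v ∈ A, v ∈ B ∪ D → v = b) ∧
      (∀ v ∈ B, v ∈ D → v = c) := by
  obtain ⟨b, c, A, B, D, α, β, δ, ⟨h1, h1'⟩, ⟨h2, h2'⟩, h3, h4, h5, h6, h7, h8, h9, -⟩ :=
    h.order₂ (P := fun v => P v ∧ v ≠ r) hq hq' hne ⟨hP, hqr⟩ ⟨hP', hqr'⟩
  rw [← h7] at hr
  rcases Finset.mem_union.1 hr with hr | hr
  · obtain ⟨A₁, A₂, a₁, a₂, k1, k2, k3, k4, -⟩ := h4.split hr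
    refine ⟨r, b, c, A₁, A₂, B, _, _, _, hPr, h1, h2, Ne.symm h1', h3, k1, k2, h5, ?_, ?_, ?_⟩
    · rw [← h7, ← k3]; intro v; simp; tauto
    · intro v hv hv'
      rcases Finset.mem_union.1 hv' with hv' | hv'
      · exact k4 v hv hv'
      · have := h8 v (by rw [← k3]; simp [hv]) (by simp [hv'])
        subst this
        exact k4 _ hv k2.right_mem
    · intro v hv hv'
      exact h8 v (by rw [← k3]; simp [hv]) (by simp [hv'])
  rcases Finset.mem_union.1 hr with hr | hr
  · obtain ⟨A₁, A₂, a₁, a₂, k1, k2, k3, k4, -⟩ := h5.split hr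
    refine ⟨b, r, c, A, A₁, A₂, _, _, _, h1, hPr, h2, h1', Ne.symm h2', h4, k1, k2, ?_, ?_, k4⟩
    · rw [← h7, ← k3]; intro v; simp; tauto
    · intro v hv hv'
      exact h8 v hv (by rw [← k3]; simp at hv' ⊢; tauto)
  · obtain ⟨A₁, A₂, a₁, a₂, k1, k2, k3, k4, -⟩ := h6.split hr
    refine ⟨b, c, r, A, B, A₁, _, _, _, h1, h2, hPr, h3, h2', h4, h5, k1, ?_, ?_, ?_⟩
    · rw [← h7, ← k3]; intro v; simp; tauto
    · intro v hv hv'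
      exact h8 v hv (by rw [← k3]; simp at hv' ⊢; tauto)
    · intro v hv hv'
      exact h9 v hv (by rw [← k3]; simp [hv'])

end

/-- A path of maximum order among those avoiding `C`. -/
structure IsLongest (G : SimpleGraph V) (w : Sym2 V → ZMod 4) (C S : Finset V) (a b : V)
    (n : ZMod 4) : Prop where
  path : PathOn G w S a b n
  disj : Disjoint S C
  -- The competing paths carry a constant weight, so that maximality does not depend on `w`.
  max : ∀ S' a' b' n', PathOn G (fun _ => (1 : ℕ)) S' a' b' n' → Disjoint S' C → S'.card ≤ S.card

namespace IsLongest

variable {G : SimpleGraph V} {w : Sym2 V → ZMod 4} {C S T : Finset V} {a b v e : V} {n m : ZMod 4}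

theorem exists_of_notMem [Fintype V] (w : Sym2 V → ZMod 4) (hv : v ∉ C) :
    ∃ S a b n, IsLongest G w C S a b n := by
  classical
  obtain ⟨S, hS, hmax⟩ := Finset.exists_max_image
    (Finset.univ.filter fun S : Finset V => Disjoint S C ∧ ∃ a b n,
      PathOn G (fun _ => (1 : ℕ)) S a b n) Finset.card
    ⟨{v}, by simpa [hv] using ⟨v, v, 0, PathOn.nil v⟩⟩
  simp only [Finset.mem_filter, Finset.mem_univ, true_and] at hS hmax
  obtain ⟨hd, a, b, n, hP⟩ := hS
  obtain ⟨n', hP'⟩ := hP.reweight w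
  exact ⟨S, a, b, n', hP', hd, fun S' a' b' n' h1 h2 => hmax S' ⟨h2, a', b', n', h1⟩⟩

theorem of_path (h : IsLongest G w C S a b n) {a' b' : V} {w' : Sym2 V → ZMod 4}
    (hT : PathOn G w' T a' b' m) (hc : T.card = S.card) (hd : Disjoint T C) :
    IsLongest G w' C T a' b' m := ⟨hT, hd, by rw [hc]; exact h.max⟩

theorem reverse (h : IsLongest G w C S a b n) : IsLongest G w C S b a n :=
  h.of_path h.path.reverse rfl h.disj

theorem left_notMem (h : IsLongest G w C S a b n) : a ∉ C :=
  Finset.disjoint_left.1 h.disj h.path.left_mem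

theorem nbr_mem (h : IsLongest G w C S a b n) (hv : v ∉ C) (hav : G.Adj a v) : v ∈ S := by
  by_contra hvS
  obtain ⟨n', hP⟩ := (PathOn.cons hav.symm hvS h.path).reweight (fun _ => (1 : ℕ))
  have := h.max _ _ _ _ hP (by rw [Finset.disjoint_insert_left]; exact ⟨hv, h.disj⟩)
  rw [Finset.card_insert_of_notMem hvS] at this
  omega

/-- A Pósa rotation: the edge ab is added, and the initial segment A is traversed backwards, so that
`z` becomes the new end. -/
theorem rotate {A D : Finset V} {α δ : ZMod 4} {z : V} (h : IsLongest G w C S a e n)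
    (hA : PathOn G w A a z α) (hD : PathOn G w D b e δ) (hab : G.Adj a b) (hd : Disjoint A D)
    (hS : A ∪ D = S) : IsLongest G w C S z e (α + w s(a, b) + δ) :=
  h.of_path ((hA.reverse.join hab hD hd).congr hS rfl) rfl h.disj

variable [Fintype V] [DecidableRel G.Adj]

/-- A second neighbour `b` of the end `a` gives another longest path, from the predecessor of `b`. -/
theorem exists_rotation (h : IsLongest G w C S a e n)
    (hcard : 2 ≤ (G.neighborFinset a \ C).card) :
    ∃ z b A D α δ, PathOn G w A a z α ∧ G.Adj z b ∧ PathOn G w D b e δ ∧ G.Adj a b ∧ a ≠ z ∧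
      Disjoint A D ∧ A ∪ D = S ∧ n = α + w s(z, b) + δ := by
  have hae : a ≠ e := by
    rintro rfl
    obtain ⟨b, hb⟩ : (G.neighborFinset a \ C).Nonempty := Finset.card_pos.1 (by omega)
    simp at hb
    have := h.nbr_mem hb.2 hb.1
    rw [h.path.eq_singleton.1] at this
    simp at this
    exact hb.1.ne this.symm
  obtain ⟨v₁, S', n', h1, h2, h3, rfl, rfl⟩ := h.path.first hae
  obtain ⟨b, hb, hbv⟩ := Finset.exists_mem_ne (by omega : 1 < (G.neighborFinset a \ C).card) v₁
  simp at hb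
  have hbS : b ∈ S' := by
    have := h.nbr_mem hb.2 hb.1
    rcases Finset.mem_insert.1 this with h | h
    · exact absurd h hb.1.ne'
    · exact h
  obtain ⟨A, D, α, δ, k1, k2, rfl, k4, rfl⟩ := h3.split hbS
  obtain ⟨z, A', α', l1, l2, l3, rfl, rfl⟩ := k1.last hbv.symm
  refine ⟨z, b, insert a A', D, _, δ, .cons h1 (fun h => h2 (by simp [h])) l3, l1, k2, hb.1, ?_, ?_,
    ?_, by ring⟩
  · rintro rfl
    exact h2 (by simp [l3.right_mem])
  · rw [Finset.disjoint_insert_left]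
    refine ⟨fun h => h2 (by simp [h]), ?_⟩
    rw [Finset.disjoint_left]
    intro v hv hv'
    have := k4 v (by simp [hv]) hv'
    subst this
    exact l2 hv
  · have := k2.left_mem
    ext v; simp; grind

/-- All neighbours of `a` off C lie on the path. Besides its successor there are two more, `b` and
`c` in path order, and `z` is the predecessor of `b`. -/
theorem exists_ear (h : IsLongest G w C S a e n)
    (hcard : 3 ≤ (G.neighborFinset a \ C).card) :
    ∃ z b c A B D α β δ, PathOn G w A a z α ∧ G.Adj z b ∧ PathOn G w B b c β ∧
      PathOn G w D c e δ ∧ G.Adj a b ∧ G.Adj a c ∧ a ≠ z ∧ b ≠ c ∧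
      Disjoint A (B ∪ D) ∧ (∀ v ∈ B, v ∈ D → v = c) ∧ A ∪ (B ∪ D) = S := by
  have hae : a ≠ e := by
    rintro rfl
    obtain ⟨b, hb⟩ : (G.neighborFinset a \ C).Nonempty := Finset.card_pos.1 (by omega)
    simp at hb
    have := h.nbr_mem hb.2 hb.1
    rw [h.path.eq_singleton.1] at this
    simp at this
    exact hb.1.ne this.symm
  obtain ⟨v₁, S', n', h1, h2, h3, rfl, rfl⟩ := h.path.first hae
  have h2c : 1 < ((G.neighborFinset a \ C).erase v₁).card := by
    have := Finset.pred_card_le_card_erase (s := G.neighborFinset a \ C) (a := v₁)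
    omega
  obtain ⟨q, q', hq, hq', hqq⟩ := Finset.one_lt_card_iff.1 h2c
  simp at hq hq'
  have hmem : ∀ q, G.Adj a q → q ∉ C → q ∈ S' := by
    intro q h4 h5
    rcases Finset.mem_insert.1 (h.nbr_mem h5 h4) with h | h
    · exact absurd h h4.ne'
    · exact h
  obtain ⟨b, c, A, B, D, α, β, δ, ⟨k1, k1'⟩, ⟨k2, k2'⟩, k3, k4, k5, k6, k7, k8, k9, -⟩ :=
    h3.order₂ (P := fun v => G.Adj a v ∧ v ≠ v₁) (hmem q hq.2.1 hq.2.2) (hmem q' hq'.2.1 hq'.2.2)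
      hqq ⟨hq.2.1, hq.1⟩ ⟨hq'.2.1, hq'.1⟩
  subst k7
  obtain ⟨z, A', α', l1, l2, l3, rfl, rfl⟩ := k4.last (Ne.symm k1')
  refine ⟨z, b, c, insert a A', B, D, _, β, δ, .cons h1 (fun h => h2 (by simp [h])) l3, l1, k5, k6,
    k1, k2, ?_, k3, ?_, k9, ?_⟩
  · rintro rfl
    exact h2 (by simp [l3.right_mem])
  · rw [Finset.disjoint_insert_left]
    refine ⟨fun h => h2 (by simp at h ⊢; tauto), ?_⟩
    rw [Finset.disjoint_left]
    intro v hv hv'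
    have := k8 v (by simp [hv]) hv'
    subst this
    exact l2 hv
  · have := k5.left_mem
    ext v; simp; grind

end IsLongest

namespace IsFrame

variable [Fintype V] {G : SimpleGraph V} {w : Sym2 V → ZMod 4} {C A B S : Finset V} {L α β : ZMod 4}
  {v b c z e c₁ c₂ : V} {n : ZMod 4}

/-- The edge vb, the path A, and the path B closed by the edge cv form a theta graph whose first
path is odd. -/
theorem ear_even (hF : IsFrame G w C L) (hK : KConn G 3) (hn : ¬ Full G w) (hA : PathOn G w A v b α)
    (hA3 : 3 ≤ A.card) (hB : PathOn G w B b c β) (hd : ∀ x ∈ A, x ∈ B → x = b) (hvb : G.Adj v b)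
    (hvc : G.Adj v c) (hbc : b ≠ c) (hAC : Disjoint C A) (hBC : Disjoint C B)
    (hw : w s(v, b) = 1) :
    2 * α = 0 ∧ 2 * (β + w s(v, c)) = 0 ∧ CycleOn G w (A ∪ B) 0 := by
  have hvB : v ∉ B := fun h => hvb.ne (hd v hA.left_mem h)
  have hvC : v ∉ C := Finset.disjoint_right.1 hAC hA.left_mem
  have hB2 := hB.two_le_card hbc
  have e1 : CycleOn G w A (1 + α) := (CycleOn.of_path hA hvb.symm hA3).congr rfl (by
    rw [Sym2.eq_swap, hw]; ring)
  have e2 : CycleOn G w (B ∪ {v}) (1 + (β + w s(v, c))) :=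
    (CycleOn.join hB (.nil v) hvb.symm hvc.symm (by simpa using hvB) (by simp; omega)).congr rfl (by
      rw [Sym2.eq_swap, hw, Sym2.eq_swap (a := c)]; ring)
  have e3 : CycleOn G w (A ∪ B) (α + (β + w s(v, c))) :=
    (CycleOn.of_path (hA.append hB hd) hvc.symm
      (hA3.trans (Finset.card_le_card Finset.subset_union_left))).congr rfl (by
      rw [Sym2.eq_swap (a := c)]; ring)
  have d3 : Disjoint C (A ∪ B) := by rw [Finset.disjoint_union_right]; exact ⟨hAC, hBC⟩
  obtain ⟨h1, h2⟩ := hF.theta_even hK hn e1 e2 e3 hAC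
    (by rw [Finset.disjoint_union_right]; exact ⟨hBC, by simpa using hvC⟩) d3 (by decide)
  refine ⟨h1, h2, e3.congr rfl ?_⟩
  have h3 := hF.weight_ne_two hK hn e3 d3
  clear e1 e2 e3 hA hB
  generalize β + w s(v, c) = x at *
  revert α x
  decide

/-- By `ear_even`, the cycle formed by A, zb, B and cv has weight 0, while `α` is odd. So `v` and
`z` are at odd distance on it, and both attach to the frame. -/
theorem full_of_ear (hF : IsFrame G w C L) (hK : KConn G 3) (hA : PathOn G w A v z α)
    (hzb : G.Adj z b) (hB : PathOn G w B b c β) (hd : Disjoint A B) (hvb : G.Adj v b)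
    (hvc : G.Adj v c) (hvz : v ≠ z) (hbc : b ≠ c) (hAC : Disjoint C A) (hBC : Disjoint C B)
    (hw : w s(v, b) = 1) (hwz : w s(z, b) = 1) (hc₁ : c₁ ∈ C) (hc₂ : c₂ ∈ C) (a₁ : G.Adj v c₁)
    (a₂ : G.Adj z c₂) : Full G w := by
  by_contra hn
  have hbA : b ∉ A := Finset.disjoint_right.1 hd hB.left_mem
  have hAb := hA.join hzb (.nil b) (by simpa using hbA)
  have hA2 := hA.two_le_card hvz
  obtain ⟨e1, e2, e3⟩ := hF.ear_even hK hn hAb (by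
    rw [Finset.card_union_of_disjoint (by simpa using hbA)]; simp; omega) hB (by
      intro x hx hx'
      rcases Finset.mem_union.1 hx with h | h
      · exact absurd hx' (Finset.disjoint_left.1 hd h)
      · simpa using h) hvb hvc hbc (by
      rw [Finset.disjoint_union_right]
      exact ⟨hAC, by simpa using Finset.disjoint_right.1 hBC hB.left_mem⟩) hBC hw
  have hU : A ∪ {b} ∪ B = A ∪ B := by
    have := hB.left_mem
    ext x; simp; grind
  rw [hU] at e3
  have hvB := Finset.disjoint_left.1 hd hA.left_mem
  have hzB := Finset.disjoint_left.1 hd hA.right_mem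
  have hback := PathOn.cons hvc hvB (c := b) hB.reverse
  have hback2 := hback.join hzb.symm (.nil z) (by simp [hvz.symm, hzB])
  have hdC : Disjoint C (A ∪ B) := by rw [Finset.disjoint_union_right]; exact ⟨hAC, hBC⟩
  -- `e3` only provides some cycle of weight 0 on this vertex set; the complementary arc from `v` to
  -- `z` requires the weight of this particular one.
  have hsum : α + w s(z, b) + β + w s(v, c) = 0 := by
    by_contra hne
    have h1 : CycleOn G w (A ∪ B) (α + w s(z, b) + β + w s(v, c)) :=
      (CycleOn.of_path (hA.join hzb hB hd) hvc.symm (by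
        rw [Finset.card_union_of_disjoint hd]
        have := hB.two_le_card hbc
        omega)).congr rfl (by rw [Sym2.eq_swap (a := c)])
    have h2 := hF.weight_ne_two hK hn h1 hdC
    rw [add_zero] at e1
    have h3 : 2 * (α + w s(z, b) + β + w s(v, c)) = 0 := by linear_combination e1 + e2
    generalize α + w s(z, b) + β + w s(v, c) = x at *
    clear h1 e1 e2
    revert x
    decide
  refine hn (hF.full_of_odd_arcs hK e3 hdC (u := v) (z := z) (n := α) ?_ ?_ ?_ ?_ hvz hc₁ hc₂ a₁ a₂)
  · refine ⟨A, _, hA, hback2.congr rfl ?_, ?_, ?_⟩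
    · rw [Sym2.eq_swap (a := b)]; linear_combination hsum
    · ext x
      simp only [Finset.mem_union, Finset.mem_insert, Finset.mem_singleton]
      constructor
      · rintro (h | (rfl | h) | rfl)
        exacts [.inl h, .inl hA.left_mem, .inr h, .inl hA.right_mem]
      · rintro (h | h)
        exacts [.inl h, .inr (.inl (.inr h))]
    · intro x hx hx'
      simp only [Finset.mem_union, Finset.mem_insert, Finset.mem_singleton] at hx'
      rcases hx' with (h | h) | h
      · exact .inl h
      · exact absurd h (Finset.disjoint_left.1 hd hx)
      · exact .inr h
  · rw [hwz] at e1
    linear_combination e1 - ZMod4.four_eq_zero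
  · simp [hA.left_mem]
  · simp [hA.right_mem]

variable [DecidableRel G.Adj]

/-- The end of a longest path has at most three neighbours off the frame cycle. -/
theorem card_nbrs_le (hF : IsFrame G w C L) (hK : KConn G 3) (hn : ¬ Full G w)
    (hS : IsLongest G w C S v e n) (hunit : ∀ u ∉ C, G.Adj v u → w s(v, u) = 1) :
    (G.neighborFinset v \ C).card ≤ 3 := by
  by_contra hcon
  have hae : v ≠ e := by
    rintro rfl
    obtain ⟨b, hb⟩ : (G.neighborFinset v \ C).Nonempty := Finset.card_pos.1 (by omega)
    simp at hb
    have := hS.nbr_mem hb.2 hb.1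
    rw [hS.path.eq_singleton.1] at this
    simp at this
    exact hb.1.ne this.symm
  have hd := hS.disj
  obtain ⟨v₁, S', n', h1, h2, h3, rfl, rfl⟩ := hS.path.first hae
  have h2c : 2 < ((G.neighborFinset v \ C).erase v₁).card := by
    have := Finset.pred_card_le_card_erase (s := G.neighborFinset v \ C) (a := v₁)
    omega
  obtain ⟨q, q', r, hq, hq', hr, hqq, hqr, hqr'⟩ := Finset.two_lt_card_iff.1 h2c
  simp at hq hq' hr
  have hmem : ∀ q, G.Adj v q → q ∉ C → q ∈ S' := by
    intro q h4 h5
    rcases Finset.mem_insert.1 (hS.nbr_mem h5 h4) with h | h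
    · exact absurd h h4.ne'
    · exact h
  obtain ⟨b, c, d, A, B, D, α, β, δ, ⟨k1, k1', k1''⟩, ⟨k2, k2', k2''⟩, ⟨k3, k3', k3''⟩, k4, k5, k6,
    k7, k8, k9, k10, k11⟩ :=
    h3.order₃ (P := fun u => G.Adj v u ∧ u ≠ v₁ ∧ u ∉ C) (hmem q hq.2.1 hq.2.2)
      (hmem q' hq'.2.1 hq'.2.2) (hmem r hr.2.1 hr.2.2) hqq hqr hqr' ⟨hq.2.1, hq.1, hq.2.2⟩
      ⟨hq'.2.1, hq'.1, hq'.2.2⟩ ⟨hr.2.1, hr.1, hr.2.2⟩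
  have hAS : A ⊆ S' := fun x hx => k9 (by simp [hx])
  have hBS : B ⊆ S' := fun x hx => k9 (by simp [hx])
  have hDS : D ⊆ S' := fun x hx => k9 (by simp [hx])
  have hdS : Disjoint C S' := (hd.mono_left (Finset.subset_insert _ _)).symm
  have hvC : v ∉ C := hS.left_notMem
  have hA' := PathOn.cons h1 (fun h => h2 (hAS h)) k6
  have hA2 := k6.two_le_card k1'.symm
  have hA3 : 3 ≤ (insert v A).card := by
    rw [Finset.card_insert_of_notMem (fun h => h2 (hAS h))]; omega
  have hAC : Disjoint C (insert v A) := by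
    rw [Finset.disjoint_insert_right]; exact ⟨hvC, hdS.mono_right hAS⟩
  have d1 : ∀ x ∈ insert v A, x ∈ B ∪ D → x = b := by
    intro x hx hx'
    rcases Finset.mem_insert.1 hx with rfl | h
    · exact absurd (k9 (by simp at hx' ⊢; tauto)) h2
    · exact k10 x h hx'
  obtain ⟨e1, e2, -⟩ := hF.ear_even hK hn hA' hA3 k7 (fun x hx hx' => d1 x hx (by simp [hx'])) k1 k2
    k4 hAC (hdS.mono_right hBS) (hunit b k1'' k1)
  have hAB := hA'.append k7 (fun x hx hx' => d1 x hx (by simp [hx']))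
  obtain ⟨e3, e4, -⟩ := hF.ear_even hK hn hAB
    (hA3.trans (Finset.card_le_card Finset.subset_union_left)) k8 (by
      intro x hx hx'
      rcases Finset.mem_union.1 hx with h | h
      · have := d1 x h (by simp [hx'])
        subst this
        exact k11 _ k7.left_mem hx'
      · exact k11 x h hx') k2 k3 k5 (by
      rw [Finset.disjoint_union_right]; exact ⟨hAC, hdS.mono_right hBS⟩) (hdS.mono_right hDS)
    (hunit c k2'' k2)
  rw [hunit c k2'' k2] at e2
  -- The first ear makes `α` even and `β` odd; the second one makes `α + β` even.
  have : (2 : ZMod 4) = 0 := by linear_combination e2 + e1 - e3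
  exact absurd this (by decide)

theorem exists_attachment (hF : IsFrame G w C L) (hK : KConn G 3) (hn : ¬ Full G w)
    (hS : IsLongest G w C S v e n) (hunit : ∀ u ∉ C, G.Adj v u → w s(v, u) = 1)
    (hdeg : 4 ≤ G.degree v) : ∃ c ∈ C, G.Adj v c := by
  by_contra hcon
  push Not at hcon
  have h1 := hF.card_nbrs_le hK hn hS hunit
  have h2 : G.neighborFinset v \ C = G.neighborFinset v := by
    ext u; simp; intro h h'; exact hcon u h' h
  rw [h2, card_neighborFinset_eq_degree] at h1
  omega

/-- With three neighbours off C there is an ear. Its two ends `v` and `z` are ends of longest paths,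
so both attach to the frame, by hypothesis or by `exists_attachment`, and `full_of_ear` applies. -/
theorem card_nbrs_le_two (hF : IsFrame G w C L) (hK : KConn G 3) (hn : ¬ Full G w)
    (hS : IsLongest G w C S v e n)
    (hunit : ∀ u ∉ C, ∀ u' ∉ C, G.Adj u u' → w s(u, u') = 1)
    (hdeg : ∀ u ∉ C, 4 ≤ G.degree u ∨ ∃ c ∈ C, G.Adj u c) :
    (G.neighborFinset v \ C).card ≤ 2 := by
  by_contra hcon
  obtain ⟨z, b, c, A, B, D, α, β, δ, h1, h2, h3, h4, h5, h6, h7, h8, h9, h10, h11⟩ :=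
    hS.exists_ear (by omega)
  have hatt : ∀ {z e n}, IsLongest G w C S z e n → ∃ c ∈ C, G.Adj z c := by
    intro z e n hz
    rcases hdeg z hz.left_notMem with h | h
    · exact hF.exists_attachment hK hn hz (hunit z hz.left_notMem) h
    · exact h
  have hBD := h3.append h4 h10
  have hz := hS.rotate h1 hBD h5 h9 h11
  obtain ⟨c₁, hc₁, a₁⟩ := hatt hS
  obtain ⟨c₂, hc₂, a₂⟩ := hatt hz
  have hAC : Disjoint C A := hS.disj.symm.mono_right (by rw [← h11]; exact Finset.subset_union_left)
  have hBC : Disjoint C B := hS.disj.symm.mono_right (by rw [← h11]; intro x; simp; tauto)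
  have hb : b ∉ C := Finset.disjoint_right.1 hBC h3.left_mem
  exact hn (hF.full_of_ear hK h1 h2 h3 (h9.mono_right Finset.subset_union_left) h5 h6 h7 h8 hAC hBC
    (hunit v hS.left_notMem b hb h5) (hunit z hz.left_notMem b hb h2) hc₁ hc₂ a₁ a₂)

end IsFrame

end SimpleGraph

/-! ### Triangular frames and the 3-connected case. -/

namespace SimpleGraph

variable {V : Type*} [DecidableEq V]

theorem PathOn.subset_of_closed {M : Type*} [AddCommMonoid M] {G : SimpleGraph V} {w : Sym2 V → M}
    {S U W : Finset V} {a b : V} {n : M} (h : PathOn G w S a b n)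
    (hW : ∀ u ∈ W, ∀ v ∈ U, G.Adj u v → v ∈ W) (ha : a ∈ W) (hS : S ⊆ U) : S ⊆ W := by
  induction h with
  | nil a => simpa using ha
  | @cons S a a' b n hab haS hp ih =>
    have hSU : S ⊆ U := fun v hv => hS (by simp [hv])
    exact Finset.insert_subset ha (ih (hW _ ha _ (hSU hp.left_mem) hab) hSU)

/-- The neighbourhood of `v` is a separator unless `v` is adjacent to everything else. In that case
the vertex of degree four guarantees enough vertices. -/
theorem KConn.three_le_degree [Fintype V] {G : SimpleGraph V} [DecidableRel G.Adj] (hK : KConn G 3)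
    (h4 : ∃ v, 4 ≤ G.degree v) (v : V) : 3 ≤ G.degree v := by
  obtain ⟨u, hu⟩ := h4
  by_cases h : ∃ z, z ∉ ({v} : Finset V) ∧ z ∉ G.neighborFinset v
  · have := hK {v} (G.neighborFinset v) (by simp) (by
      intro u hu z hz; right; simp at hu ⊢; rwa [← hu]) h
    simpa using this
  · push Not at h
    have h1 : insert u (G.neighborFinset u) ⊆ insert v (G.neighborFinset v) := by
      intro z _
      by_cases hz : z = v
      · simp [hz]
      · have := h z (by simpa using hz)
        simp at this ⊢
        exact .inr this
    have h2 := Finset.card_le_card h1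
    rw [Finset.card_insert_of_notMem (by simp), Finset.card_insert_of_notMem (by simp)] at h2
    simp at h2
    omega

theorem KConn.exists_frame_of_odd_cycle [Fintype V] {G : SimpleGraph V} [DecidableRel G.Adj]
    {w : Sym2 V → ZMod 4} (hK : KConn G 3) (h4 : ∃ v, 4 ≤ G.degree v) {C₀ : Finset V}
    {L₀ : ZMod 4} (hC₀ : CycleOn G w C₀ L₀) (hL₀ : 2 * L₀ = 2) :
    ∃ C L h, IsFrame G w C L ∧ h ∉ C := by
  obtain ⟨C, L, h, h1, h2, h3⟩ := exists_odd_cycle_not_spanning hC₀ hL₀ (by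
    intro v
    have := hK.three_le_degree h4 v
    rw [← card_neighborFinset_eq_degree] at this
    obtain ⟨a, b, c, ha, hb, hc, h1, h2, h3⟩ := Finset.two_lt_card_iff.1 this
    simp at ha hb hc
    exact ⟨a, b, c, ha, hb, hc, h1, h2, h3⟩)
  obtain ⟨C', L', h4, h5⟩ := hK.exists_frame (H₀ := {h}) h1 h2 (by simp) (by
    intro u hu v hv
    simp at hu hv
    subst hu hv
    exact Linked.refl (by simp)) (by simpa using h3)
  exact ⟨C', L', h, h4, by simpa using h5⟩

section

variable [Fintype V] {G : SimpleGraph V} [DecidableRel G.Adj]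

theorem card_nbrs_add (v : V) (C : Finset V) :
    (G.neighborFinset v ∩ C).card + (G.neighborFinset v \ C).card = G.degree v := by
  rw [Finset.card_inter_add_card_sdiff, card_neighborFinset_eq_degree]

theorem exists_two_attachments {v : V} {C : Finset V} (h : 2 ≤ (G.neighborFinset v ∩ C).card) :
    ∃ c₁ ∈ C, ∃ c₂ ∈ C, c₁ ≠ c₂ ∧ G.Adj v c₁ ∧ G.Adj v c₂ := by
  obtain ⟨a, b, ha, hb, hab⟩ := Finset.one_lt_card_iff.1 h
  simp at ha hb
  exact ⟨a, ha.2, b, hb.2, hab, ha.1, hb.1⟩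

/-- Two pairs in a set of three elements meet. -/
theorem exists_common_attachment {v z : V} {C : Finset V} (hC : C.card = 3)
    (hv : 2 ≤ (G.neighborFinset v ∩ C).card) (hz : 2 ≤ (G.neighborFinset z ∩ C).card) :
    ∃ c ∈ C, ∃ c' ∈ C, c' ≠ c ∧ G.Adj v c ∧ G.Adj v c' ∧ G.Adj z c := by
  obtain ⟨c, hc⟩ : ((G.neighborFinset v ∩ C) ∩ (G.neighborFinset z ∩ C)).Nonempty := by
    rw [← Finset.card_pos]
    have h1 := Finset.card_union_add_card_inter (G.neighborFinset v ∩ C) (G.neighborFinset z ∩ C)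
    have h2 : (G.neighborFinset v ∩ C ∪ G.neighborFinset z ∩ C).card ≤ C.card :=
      Finset.card_le_card (Finset.union_subset Finset.inter_subset_right Finset.inter_subset_right)
    omega
  obtain ⟨c', hc', hne⟩ := Finset.exists_mem_ne (by omega : 1 < (G.neighborFinset v ∩ C).card) c
  simp only [Finset.mem_inter, mem_neighborFinset] at hc hc'
  exact ⟨c, hc.1.2, c', hc'.2, hne, hc.1.1, hc'.1, hc.2.1⟩

end

namespace IsFrame

variable [Fintype V] {G : SimpleGraph V} {w : Sym2 V → ZMod 4} {C P Q S : Finset V}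
  {L p q n : ZMod 4} {v z c c' e : V}

theorem card_nbrs_inter_le_two [DecidableRel G.Adj] (hF : IsFrame G w C L) (hc : c ∈ C) :
    (G.neighborFinset c ∩ C).card ≤ 2 := by
  by_contra hcon
  obtain ⟨a, b, d, ha, hb, hd, h1, h2, h3⟩ := Finset.two_lt_card_iff.1 (not_le.1 hcon)
  simp at ha hb hd
  have := hF.cyc.degree_le_two hF.odd hF.min hc ha.2 hb.2 hd.2 ha.1 hb.1 hd.1
  tauto

/-- The single vertex `v` and the path P both close up through the even and through the odd arc
between `c'` and `c`. The two start weights differ by 2. -/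
theorem full_of_common (hF : IsFrame G w C L) (hP : PathOn G w P v z 2) (hPC : Disjoint P C)
    (hc : c ∈ C) (hc' : c' ∈ C) (hne : c' ≠ c) (a₁ : G.Adj v c) (a₂ : G.Adj v c') (a₃ : G.Adj z c)
    (hw : w s(v, c) = w s(z, c)) : Full G w := by
  obtain ⟨E, O, e, hE, hO, hEO, -, he⟩ := hF.exists_arcs hc' hc hne
  have dE := hPC.mono_right (show E ⊆ C by rw [← hEO]; exact Finset.subset_union_left)
  have dO := hPC.mono_right (show O ⊆ C by rw [← hEO]; exact Finset.subset_union_right)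
  have hvE : Disjoint {v} E := dE.mono_left (by simpa using hP.left_mem)
  have hvO : Disjoint {v} O := dO.mono_left (by simpa using hP.left_mem)
  have cE := hE.two_le_card hne
  have cO := hO.two_le_card hne
  have cP := Finset.card_pos.2 ⟨_, hP.left_mem⟩
  have e1 := CycleOn.join (.nil v) hE a₂ a₁ hvE (by simp; omega)
  have e2 := CycleOn.join (.nil v) hO a₂ a₁ hvO (by simp; omega)
  have e3 := CycleOn.join hP hE a₂ a₃ dE (by omega)
  have e4 := CycleOn.join hP hO a₂ a₃ dO (by omega)
  rw [← hw] at e3 e4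
  intro r
  have arith : ∀ e L x r : ZMod 4, 2 * e = 0 → 2 * L = 2 → r = e + x ∨ r = L - e + x ∨
    r = 2 + e + x ∨ r = 2 + (L - e) + x := by decide
  rcases arith e L (w s(v, c') + w s(v, c)) r he hF.odd with h | h | h | h
  · exact ⟨_, e1.congr rfl (by rw [h]; ring)⟩
  · exact ⟨_, e2.congr rfl (by rw [h]; ring)⟩
  · exact ⟨_, e3.congr rfl (by rw [h]; ring)⟩
  · exact ⟨_, e4.congr rfl (by rw [h]; ring)⟩

theorem triangle_paths (hF : IsFrame G w C L)
    (hunit : ∀ u ∈ C, ∀ v ∈ C, G.Adj u v → w s(u, v) = 1) (hcard : C.card = 3) (hc : c ∈ C)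
    (hc' : c' ∈ C) (hne : c' ≠ c) :
    ∃ E O, PathOn G w E c' c 2 ∧ PathOn G w O c' c 1 ∧ E ⊆ C ∧ O ⊆ C := by
  obtain ⟨E, O, e, hE, hO, hEO, -, he⟩ := hF.exists_arcs hc' hc hne
  have hEC : E ⊆ C := by rw [← hEO]; exact Finset.subset_union_left
  have hOC : O ⊆ C := by rw [← hEO]; exact Finset.subset_union_right
  have hL := hF.cyc.unit hunit
  have uE := hE.unit (fun u hu v hv => hunit u (hEC hu) v (hEC hv))
  have cE := hE.two_le_card hne
  have cE' := Finset.card_le_card hEC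
  have h3 : E.card = 3 := by
    by_contra h3
    have : E.card = 2 := by omega
    rw [this] at uE
    clear hE hO
    revert e
    decide
  have he2 : e = 2 := by
    rw [h3] at uE
    clear hE hO
    revert e
    decide
  rw [hL, hcard] at hO
  subst he2
  exact ⟨E, O, hE, hO, hEC, hOC⟩

/-- A path between two attached vertices closes up through a triangle in three ways. -/
theorem exists_cycle_of_ne (hF : IsFrame G w C L)
    (hunit : ∀ u ∈ C, ∀ v ∈ C, G.Adj u v → w s(u, v) = 1) (hcard : C.card = 3)
    (hP : PathOn G w P v z p) (hPC : Disjoint P C) (hvz : v ≠ z) (hc : c ∈ C) (hc' : c' ∈ C)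
    (hne : c' ≠ c) (a₁ : G.Adj v c) (a₂ : G.Adj v c') (a₃ : G.Adj z c) (hw : w s(v, c) = 1)
    (hw' : w s(v, c') = 1) {r : ZMod 4} (hr : r ≠ p + w s(z, c)) : ∃ S, CycleOn G w S r := by
  obtain ⟨E, O, hE, hO, hEC, hOC⟩ := hF.triangle_paths hunit hcard hc hc' hne
  have cE := hE.two_le_card hne
  have cO := hO.two_le_card hne
  have cP := hP.two_le_card hvz
  have e1 := CycleOn.join hP (.nil c) a₁ a₃ (by
    simpa using Finset.disjoint_right.1 hPC hc) (by simp; omega)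
  have e2 := CycleOn.join hP hO a₂ a₃ (hPC.mono_right hOC) (by omega)
  have e3 := CycleOn.join hP hE a₂ a₃ (hPC.mono_right hEC) (by omega)
  rw [hw] at e1
  rw [hw'] at e2 e3
  -- Here x is `p + w s(z, c)`; the path closes at `c` directly, over the edge c'c, or over the
  -- third vertex of the triangle.
  have arith : ∀ x r : ZMod 4, r ≠ x → r = x + 1 ∨ r = x + 2 ∨ r = x + 3 := by decide
  rcases arith _ r hr with h | h | h
  · exact ⟨_, e1.congr rfl (by rw [h]; ring)⟩
  · exact ⟨_, e2.congr rfl (by rw [h]; ring)⟩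
  · exact ⟨_, e3.congr rfl (by rw [h]; ring)⟩

theorem full_of_ne (hF : IsFrame G w C L)
    (hunit : ∀ u ∈ C, ∀ v ∈ C, G.Adj u v → w s(u, v) = 1) (hcard : C.card = 3)
    (hP : PathOn G w P v z p) (hQ : PathOn G w Q v z q) (hPC : Disjoint P C) (hQC : Disjoint Q C)
    (hvz : v ≠ z) (hc : c ∈ C) (hc' : c' ∈ C) (hne : c' ≠ c) (a₁ : G.Adj v c) (a₂ : G.Adj v c')
    (a₃ : G.Adj z c) (hw : w s(v, c) = 1) (hw' : w s(v, c') = 1) (hpq : p ≠ q) : Full G w := by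
  intro r
  by_cases hr : r = p + w s(z, c)
  · exact hF.exists_cycle_of_ne hunit hcard hQ hQC hvz hc hc' hne a₁ a₂ a₃ hw hw'
      (by rw [hr]; simpa using hpq)
  · exact hF.exists_cycle_of_ne hunit hcard hP hPC hvz hc hc' hne a₁ a₂ a₃ hw hw' hr

/-- The graph off the frame is connected, so a nonempty set closed under its edges is everything. -/
theorem compl_eq_of_closed (hF : IsFrame G w C L) {W : Finset V} {a : V} (ha : a ∈ W)
    (hW : Disjoint W C) (hcl : ∀ u ∈ W, ∀ v ∉ C, G.Adj u v → v ∈ W) : Cᶜ = W := by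
  ext h
  constructor
  · intro hh
    obtain ⟨S, n, h1, h2⟩ := hF.linked a (Finset.disjoint_left.1 hW ha) h (by simpa using hh)
    exact h1.subset_of_closed (U := Cᶜ) (fun u hu v hv => hcl u hu v (by simpa using hv)) ha h2
      h1.right_mem
  · intro hh
    simpa using Finset.disjoint_left.1 hW hh

end IsFrame

/-- A 3-connected graph of minimum degree four with an odd cycle has cycles of all lengths modulo
four unless it is the complete graph on five vertices. -/
theorem KConn.full_or_complete [Fintype V] {G : SimpleGraph V} [DecidableRel G.Adj]
    (hK : KConn G 3) (hdeg : ∀ v, 4 ≤ G.degree v) {C₀ : Finset V} {L₀ : ZMod 4}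
    (hC₀ : CycleOn G (fun _ => (1 : ZMod 4)) C₀ L₀) (hL₀ : 2 * L₀ = 2) :
    Full G (fun _ => 1) ∨ (Fintype.card V = 5 ∧ ∀ u v, u ≠ v → G.Adj u v) := by
  by_contra hcon
  push Not at hcon
  obtain ⟨hn, hK5⟩ := hcon
  obtain ⟨v, hv⟩ : C₀.Nonempty := Finset.card_pos.1 (by have := hC₀.three_le_card; omega)
  obtain ⟨C, L, h, hF, hh⟩ := hK.exists_frame_of_odd_cycle ⟨v, hdeg v⟩ hC₀ hL₀
  have hunit : ∀ u ∈ C, ∀ v ∈ C, G.Adj u v → (fun _ : Sym2 V => (1 : ZMod 4)) s(u, v) = 1 :=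
    fun _ _ _ _ _ => rfl
  have hatt2 : ∀ {S a b n}, IsLongest G (fun _ => 1) C S a b n →
      2 ≤ (G.neighborFinset a ∩ C).card := by
    intro S a b n hS
    have h1 := hF.card_nbrs_le_two hK hn hS (fun _ _ _ _ _ => rfl) (fun u _ => .inl (hdeg u))
    have h2 := G.card_nbrs_add a C
    have := hdeg a
    omega
  obtain ⟨S, a, b, n, hS⟩ := IsLongest.exists_of_notMem (G := G) (fun _ => 1) hh
  have hcard : C.card = 3 := by
    by_contra hcard
    obtain ⟨c₁, h1, c₂, h2, h3, h4, h5⟩ := exists_two_attachments (hatt2 hS)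
    exact hn (hF.full_of_two_attachments hunit hcard hS.left_notMem h3 h1 h2 h4 h5 rfl)
  -- Ends of longest paths have a common attachment on the triangle, so no path of weight 2 off C
  -- can join two of them.
  have hpath2 : ∀ {S T a b z b' n m}, IsLongest G (fun _ => 1) C S a b n →
      IsLongest G (fun _ => 1) C T z b' m → ∀ {P}, PathOn G (fun _ => (1 : ZMod 4)) P a z 2 →
      Disjoint P C → False := by
    intro S T a b z b' n m h1 h2 P hP hPC
    obtain ⟨c, hc, c', hc', hne, a₁, a₂, a₃⟩ := exists_common_attachment hcard (hatt2 h1) (hatt2 h2)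
    exact hn (hF.full_of_common hP hPC hc hc' hne a₁ a₂ a₃ rfl)
  -- Two neighbours off C would allow a rotation, whose new end is reached from `a` by a path with
  -- two edges. So `a` has at most one neighbour off C and needs all three on C.
  have hall : ∀ {S a b n}, IsLongest G (fun _ => 1) C S a b n → ∀ c ∈ C, G.Adj a c := by
    intro S a b n hS
    by_cases h2 : 2 ≤ (G.neighborFinset a \ C).card
    · obtain ⟨z, b', A, D, α, δ, h1, h2, h3, h4, h5, h6, h7, h8⟩ := hS.exists_rotation h2
      have hz := hS.rotate h1 h3 h4 h6 h7
      have hb' : b' ∉ C := Finset.disjoint_left.1 hS.disj (by rw [← h7]; simp [h3.left_mem])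
      refine (hpath2 hS hz (P := {a, b', z}) ?_ ?_).elim
      · exact (PathOn.cons h4 (by simp [h4.ne, h5]) (PathOn.edge h2.symm)).congr rfl (by norm_num)
      · simp [hS.left_notMem, hz.left_notMem, hb']
    · have h3 := G.card_nbrs_add a C
      have := hdeg a
      have h4 : G.neighborFinset a ∩ C = C :=
        Finset.eq_of_subset_of_card_le Finset.inter_subset_right (by omega)
      intro c hc
      rw [← h4] at hc
      simp at hc
      exact hc.1
  have hab : a ≠ b := by
    rintro rfl
    have h1 : G.neighborFinset a \ C = ∅ := by
      rw [Finset.eq_empty_iff_forall_notMem]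
      intro u hu
      simp at hu
      have := hS.nbr_mem hu.2 hu.1
      rw [hS.path.eq_singleton.1] at this
      simp at this
      exact hu.1.ne this.symm
    have h2 := G.card_nbrs_add a C
    rw [h1] at h2
    have := hdeg a
    have : (G.neighborFinset a ∩ C).card ≤ C.card := Finset.card_le_card Finset.inter_subset_right
    simp at h2
    omega
  have hd := hS.disj
  obtain ⟨v₁, S', n', h1, h2, h3, rfl, rfl⟩ := hS.path.first hab
  have hS'C : Disjoint S' C := hd.mono_left (Finset.subset_insert _ _)
  obtain ⟨c₀, hc₀, c₁, hc₁, hne, -, -⟩ := exists_two_attachments (hatt2 hS)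
  -- If the longest path is a single edge, only its two ends lie off C, and minimum degree four
  -- makes the graph complete on five vertices.
  by_cases hv1 : v₁ = b
  · subst hv1
    obtain ⟨rfl, rfl⟩ := h3.eq_singleton
    have hcl : Cᶜ = {a, v₁} := hF.compl_eq_of_closed (a := a) (by simp) (by simpa using hd) (by
      intro u hu v hv huv
      simp only [Finset.mem_insert, Finset.mem_singleton] at hu
      rcases hu with rfl | rfl
      · simpa using hS.nbr_mem hv huv
      · simpa using hS.reverse.nbr_mem hv huv)
    have hV : Fintype.card V = 5 := by
      rw [← Finset.card_add_card_compl C, hcl, hcard, Finset.card_pair hab]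
    obtain ⟨u, v, huv, hnadj⟩ := hK5 hV
    have h6 : G.neighborFinset u ⊆ (Finset.univ.erase u).erase v := by
      intro z hz
      simp at hz ⊢
      exact ⟨fun h => hnadj (h ▸ hz), hz.ne'⟩
    have h7 := Finset.card_le_card h6
    rw [Finset.card_erase_of_mem (by simpa using huv.symm), Finset.card_erase_of_mem (by simp),
      Finset.card_univ, hV, card_neighborFinset_eq_degree] at h7
    have := hdeg u
    omega
  -- Dropping `a` from the path lowers its weight by one while both ends still attach, so the two
  -- paths miss different residues.
  by_cases hatt : ∃ c ∈ C, G.Adj v₁ c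
  · obtain ⟨c, hc, hadj⟩ := hatt
    obtain ⟨c', hc', hne'⟩ := Finset.exists_mem_ne (by omega : 1 < C.card) c
    have hbC := hall hS.reverse
    refine hn fun r => ?_
    by_cases hr : r = n' + 1
    · refine hF.exists_cycle_of_ne hunit hcard hS.path.reverse hd hab.symm hc hc' hne' (hbC c hc)
        (hbC c' hc') (hall hS c hc) rfl rfl ?_
      rw [hr]
      intro h
      have : (1 : ZMod 4) = 0 := by linear_combination -h
      exact absurd this (by decide)
    · exact hF.exists_cycle_of_ne hunit hcard h3.reverse hS'C (Ne.symm hv1) hc hc' hne' (hbC c hc)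
        (hbC c' hc') hadj rfl rfl hr
  push Not at hatt
  obtain ⟨v₂, S'', n'', k1, k2, k3, rfl, rfl⟩ := h3.first hv1
  have h2' : a ∉ S'' := fun h => h2 (by simp [h])
  obtain ⟨q, hq⟩ : ((G.neighborFinset v₁).erase a |>.erase v₂).Nonempty := by
    rw [← Finset.card_pos]
    have e1 := Finset.pred_card_le_card_erase (s := G.neighborFinset v₁) (a := a)
    have e2 := Finset.pred_card_le_card_erase (s := (G.neighborFinset v₁).erase a) (a := v₂)
    have := hdeg v₁
    rw [card_neighborFinset_eq_degree] at e1
    omega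
  simp at hq
  obtain ⟨hq2, hqa, hq1⟩ := hq
  have hqC : q ∉ C := fun h => hatt q h hq1
  -- If `q` is on the path, the edge from `v₁` to `q` bypasses a segment of weight `β`. It is
  -- nonzero, since otherwise a cycle of weight 2 would arise, so the shortcut has a different
  -- weight. If `q` is off the path, it can replace `a` as an end, two steps away from `a`.
  by_cases hqS : q ∈ S''
  · obtain ⟨Q₁, Q₂, β, γ, l1, l2, rfl, l4, rfl⟩ := k3.split hqS
    have hv1Q : v₁ ∉ Q₁ := fun h => k2 (by simp [h])
    have hv2Q : v₁ ∉ Q₂ := fun h => k2 (by simp [h])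
    have haQ₂ : a ∉ Q₂ := fun h => h2' (by simp [h])
    have hav1 : a ≠ v₁ := h1.ne
    by_cases hβ : β = 0
    · subst hβ
      have e1 := CycleOn.join l1 (.nil v₁) k1.symm hq1.symm (by simpa using hv1Q) (by
        have := l1.two_le_card (Ne.symm hq2); simp; omega)
      refine hF.weight_ne_two hK hn e1 ?_ (by norm_num)
      rw [Finset.disjoint_union_right]
      exact ⟨(hS'C.mono_left (by intro x; simp; tauto)).symm, by
        simpa using Finset.disjoint_left.1 hS'C (by simp : v₁ ∈ _)⟩
    · have e1 := PathOn.cons h1 (by simp; exact ⟨hav1, haQ₂⟩) (PathOn.cons hq1 hv2Q l2)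
      refine hn (hF.full_of_ne hunit hcard hS.path e1 hd ?_ hab hc₀ hc₁ hne.symm (hall hS c₀ hc₀)
        (hall hS c₁ hc₁) (hall hS.reverse c₀ hc₀) rfl rfl ?_)
      · exact hd.mono_left (by intro x; simp; tauto)
      · intro h
        apply hβ
        linear_combination h
  · have hq' : q ∉ insert v₁ S'' := by simp; exact ⟨hq1.ne', hqS⟩
    have e1 := PathOn.cons hq1.symm hq' h3
    have e2 := hS.of_path e1 (by
      rw [Finset.card_insert_of_notMem hq', Finset.card_insert_of_notMem h2]) (by
      rw [Finset.disjoint_insert_left]; exact ⟨hqC, hS'C⟩)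
    refine hpath2 hS e2 (P := {a, v₁, q}) ?_ ?_
    · exact (PathOn.cons h1 (by simp; exact ⟨h1.ne, Ne.symm hqa⟩) (PathOn.edge hq1)).congr rfl
        (by norm_num)
    · have := Finset.disjoint_left.1 hS'C (by simp : v₁ ∈ _)
      simp [hS.left_notMem, hqC, this]

end SimpleGraph

/-! ### A special edge of arbitrary weight whose ends lie on all odd cycles. -/

namespace SimpleGraph

variable {V : Type*} [DecidableEq V]

/-- Weight `g` on the edge `s(x, y)` and weight one on all other edges. -/
def edgeWeight (x y : V) (g : ZMod 4) : Sym2 V → ZMod 4 := fun e => if e = s(x, y) then g else 1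

section

variable {x y u v : V} {g g' : ZMod 4}

theorem edgeWeight_self : edgeWeight x y g s(x, y) = g := by simp [edgeWeight]

theorem edgeWeight_comm : edgeWeight x y g = edgeWeight y x g := by
  unfold edgeWeight; rw [Sym2.eq_swap]

theorem edgeWeight_of_ne (h : s(u, v) ≠ s(x, y)) : edgeWeight x y g s(u, v) = 1 := by
  simp [edgeWeight, h]

theorem edgeWeight_of_left_ne (hx : u ≠ x) (hy : u ≠ y) : edgeWeight x y g s(u, v) = 1 := by
  apply edgeWeight_of_ne
  intro h
  have : u ∈ s(x, y) := h ▸ Sym2.mem_mk_left u v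
  rcases Sym2.mem_iff.1 this with h | h
  exacts [hx h, hy h]

theorem edgeWeight_of_ne_left (hu : u ≠ x) (hv : v ≠ x) : edgeWeight x y g s(u, v) = 1 := by
  apply edgeWeight_of_ne
  intro h
  have : x ∈ s(u, v) := h ▸ Sym2.mem_mk_left x y
  rcases Sym2.mem_iff.1 this with h | h
  exacts [hu h.symm, hv h.symm]

theorem edgeWeight_of_ne_right (hu : u ≠ y) (hv : v ≠ y) : edgeWeight x y g s(u, v) = 1 := by
  rw [edgeWeight_comm]; exact edgeWeight_of_ne_left hu hv

theorem edgeWeight_of_notMem {S : Finset V} (h : x ∉ S ∨ y ∉ S) (hu : u ∈ S) (hv : v ∈ S) :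
    edgeWeight x y g s(u, v) = 1 := by
  rcases h with h | h
  · exact edgeWeight_of_ne_left (fun e => h (e ▸ hu)) (fun e => h (e ▸ hv))
  · exact edgeWeight_of_ne_right (fun e => h (e ▸ hu)) (fun e => h (e ▸ hv))

variable {G : SimpleGraph V} {S C : Finset V} {a b : V} {n L : ZMod 4}

theorem PathOn.edgeWeight (h : PathOn G (edgeWeight x y g) S a b n) (hS : x ∉ S ∨ y ∉ S)
    (g' : ZMod 4) : PathOn G (SimpleGraph.edgeWeight x y g') S a b n :=
  h.reweightOn (fun _ hu _ hv _ => by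
    rw [edgeWeight_of_notMem hS hu hv, edgeWeight_of_notMem hS hu hv])

theorem CycleOn.edgeWeight (h : CycleOn G (edgeWeight x y g) S n) (hS : x ∉ S ∨ y ∉ S)
    (g' : ZMod 4) : CycleOn G (SimpleGraph.edgeWeight x y g') S n :=
  h.reweightOn (fun _ hu _ hv _ => by
    rw [edgeWeight_of_notMem hS hu hv, edgeWeight_of_notMem hS hu hv])

/-- A frame missing an end of the special edge does not use it, so it remains a frame for every
value of the weight. -/
theorem IsFrame.edgeWeight [Fintype V] (h : IsFrame G (edgeWeight x y g) C L)
    (hC : x ∉ C ∨ y ∉ C) (g' : ZMod 4) : IsFrame G (SimpleGraph.edgeWeight x y g') C L :=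
  ⟨h.cyc.edgeWeight hC g', h.odd, h.linked, fun C' L' h1 h2 h3 => h.min C' L'
    (h1.edgeWeight (hC.imp (fun h h' => h (h3 h')) (fun h h' => h (h3 h'))) g) h2 h3, h.nbr⟩

end

variable [Fintype V] {G : SimpleGraph V} [DecidableRel G.Adj] {x y : V} {g g₀ g₁ : ZMod 4}

/-- All odd cycles use both ends of the special edge. -/
theorem KConn.full_of_forall_mem (hK : KConn G 3) (hxy : G.Adj x y) (h4 : ∃ v, 4 ≤ G.degree v)
    (hdeg : ∀ v, v ≠ x → v ≠ y → 4 ≤ G.degree v)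
    (hmem : ∀ C L, CycleOn G (edgeWeight x y g) C L → 2 * L = 2 → x ∈ C ∧ y ∈ C)
    {C₀ : Finset V} {L₀ : ZMod 4} (hC₀ : CycleOn G (edgeWeight x y g) C₀ L₀) (hL₀ : 2 * L₀ = 2) :
    Full G (edgeWeight x y g) := by
  by_contra hn
  obtain ⟨C, L, h, hF, hh⟩ := hK.exists_frame_of_odd_cycle h4 hC₀ hL₀
  obtain ⟨hxC, hyC⟩ := hmem C L hF.cyc hF.odd
  have hne : ∀ u, u ∉ C → u ≠ x ∧ u ≠ y := fun u hu =>
    ⟨fun h => hu (h ▸ hxC), fun h => hu (h ▸ hyC)⟩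
  have hunit : ∀ u v, u ∉ C → edgeWeight x y g s(u, v) = 1 := fun u v hu =>
    edgeWeight_of_left_ne (hne u hu).1 (hne u hu).2
  -- two attachments other than the ends of the special edge, the first different from `x`
  have key : ∀ {x y : V} {P A B D : Finset V} {k α β δ : ZMod 4} {v b c : V}, G.Adj x y →
      (∀ C L, CycleOn G (edgeWeight x y g) C L → 2 * L = 2 → x ∈ C) → v ∉ C →
      IsFrame G (edgeWeight x y g) C L → (∀ u v, u ∉ C → edgeWeight x y g s(u, v) = 1) →
      PathOn G (edgeWeight x y g) A x b α → PathOn G (edgeWeight x y g) B b c β →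
      PathOn G (edgeWeight x y g) D c y δ → A ∪ (B ∪ D) = C → (∀ v ∈ A, v ∈ B ∪ D → v = b) →
      (∀ v ∈ B, v ∈ D → v = c) → L = α + (β + δ) + g → b ≠ c → b ≠ x → G.Adj v b → G.Adj v c →
      Full G (edgeWeight x y g) := by
    intro x y P A B D k α β δ v b c hxy hmem hv hF hunit hA hB hD hU d1 d2 hL hbc hbx a₁ a₂
    have hAC : A ⊆ C := by rw [← hU]; intro v; simp; tauto
    have hBC : B ⊆ C := by rw [← hU]; intro v; simp; tauto
    have hDC : D ⊆ C := by rw [← hU]; intro v; simp; tauto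
    have hxBD : x ∉ B ∪ D := fun h => hbx (d1 x hA.left_mem h).symm
    have hvB : v ∉ B := fun h => hv (hBC h)
    have cB := hB.two_le_card hbc
    have uB := hB.unit (fun u hu v hv _ => edgeWeight_of_notMem
      (.inl (fun h => hxBD (by simp [h]))) hu hv)
    have e1 := CycleOn.join hB (.nil v) a₁.symm a₂.symm (by simpa using hvB) (by simp; omega)
    -- The cycle through `v` and B avoids x, hence is even.
    have hβ : 2 * β = 0 := by
      rcases ZMod4.even_or_odd β with h | h
      · exact h
      · have := hmem _ _ e1 (by
          rw [Sym2.eq_swap, hunit v b hv, Sym2.eq_swap (a := c), hunit v c hv]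
          linear_combination h + ZMod4.four_eq_zero)
        simp only [Finset.mem_union, Finset.mem_singleton] at this hxBD
        rcases this with h | rfl
        · exact absurd (.inl h) hxBD
        · exact absurd (hAC hA.left_mem) hv
    have hO : PathOn G (edgeWeight x y g) (A ∪ D) b c (α + g + δ) :=
      (hA.reverse.join hxy hD.reverse (by
        rw [Finset.disjoint_left]
        intro z hz hz'
        have := d1 z hz (by simp [hz'])
        subst this
        exact hbc (d2 _ hB.left_mem hz'))).congr rfl (by rw [edgeWeight_self])
    have hwv : edgeWeight x y g s(v, b) = edgeWeight x y g s(v, c) := by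
      rw [hunit v b hv, hunit v c hv]
    have hodd := hF.odd
    -- For weight 0 the third vertex is the successor of `b` on B, as for unit frames. For weight 2
    -- it is x: the parts of the odd arc on its two sides have opposite parities, and adding 2 to
    -- each gives all residues.
    by_cases hβ0 : β = 0
    · obtain ⟨c₃, B', β', g1, g2, g3, rfl, rfl⟩ := hB.first hbc
      have hw3 : edgeWeight x y g s(b, c₃) = 1 := edgeWeight_of_notMem (S := insert b B')
        (.inl fun h => hxBD (Finset.mem_union_left _ h)) (by simp) (by simp [g3.left_mem])
      rw [hw3] at hL hβ hβ0
      have hc3 : c₃ ≠ c := by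
        rintro rfl
        rw [g3.eq_singleton.2] at hβ0
        exact absurd hβ0 (by decide)
      obtain ⟨z, hz, hadj⟩ := hF.nbr c₃ (hBC (by simp [g3.left_mem]))
      refine hF.full_of_three_arcs hv hz a₁ a₂ hwv hadj.symm (PathOn.edge g1) g3 hO ?_
        (fun v hv => hBC (by simp [hv])) (Finset.union_subset hAC hDC) ?_ ?_ g1.ne hc3 ?_
      · intro z hz
        simp at hz
        rcases hz with rfl | rfl
        exacts [hBC (by simp), hBC (by simp [g3.left_mem])]
      · intro z hz hz'
        have hzB : z ∈ insert b B' := by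
          simp at hz ⊢
          rcases hz with rfl | rfl
          · simp
          · simp [g3.left_mem]
        rcases Finset.mem_union.1 hz' with h | h
        · exact d1 z h (Finset.mem_union_left _ hzB)
        · have := d2 z hzB h
          subst this
          simp [hc3.symm] at hz
          exact hz
      · intro z hz hz'
        rcases Finset.mem_union.1 hz' with h | h
        · have := d1 z h (by simp [hz])
          subst this
          exact absurd hz g2
        · exact d2 z (by simp [hz]) h
      · rw [hw3]
        have ho : 2 * (α + g + δ) = 2 := by
          linear_combination hodd - 2 * hL - 2 * hβ0
        clear hL hO
        generalize α + g + δ = t at *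
        clear g3 uB hB e1
        revert β' t
        decide
    · have hβ2 : β = 2 := by
        clear hL uB hB e1
        revert β
        decide
      subst hβ2
      obtain ⟨z, hz, hadj⟩ := hF.nbr x (hAC hA.left_mem)
      have hyx : PathOn G (edgeWeight x y g) (insert x D) x c (g + δ) :=
        (PathOn.cons hxy (fun h => hxBD (by simp [h])) hD.reverse).congr rfl
          (by rw [edgeWeight_self])
      refine hF.full_of_three_arcs hv hz a₁ a₂ hwv hadj.symm hA.reverse hyx hB hAC ?_ hBC
        (fun z h1 h2 => d1 z h1 (by simp [h2])) ?_ hbx ?_ ?_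
      · intro z hz
        rcases Finset.mem_insert.1 hz with rfl | h
        exacts [hAC hA.left_mem, hDC h]
      · intro z hz hz'
        rcases Finset.mem_insert.1 hz with rfl | h
        · exact absurd (by simp [hz']) hxBD
        · exact d2 z hz' h
      · rintro rfl
        exact hxBD (by simp [hB.right_mem])
      · have ho : 2 * (α + (g + δ)) = 2 := by
          linear_combination hodd - 2 * hL - ZMod4.four_eq_zero
        clear hL hO hyx
        generalize g + δ = t at *
        clear hA hF
        revert α t
        decide
  obtain ⟨P, k, hP, rfl, hL⟩ := hF.cyc.consecutive hF.odd hF.min hxC hyC hxy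
  rw [edgeWeight_self] at hL
  -- A vertex off the frame with two attachments has them only at x and y. If the first attachment
  -- in path order is x, the roles of x and y are exchanged.
  have hpair : ∀ {v}, v ∉ P → ∀ c₁ ∈ P, ∀ c₂ ∈ P, c₁ ≠ c₂ → G.Adj v c₁ → G.Adj v c₂ →
      (c₁ = x ∨ c₁ = y) := by
    intro v hv c₁ h₁ c₂ h₂ hne a₁ a₂
    by_contra hcon
    push Not at hcon
    obtain ⟨b, c, A, B, D, α, β, δ, ⟨k1, k1'⟩, ⟨k2, k2'⟩, k3, k4, k5, k6, k7, k8, k9, k10⟩ :=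
      hP.order₂ (P := fun u => G.Adj v u ∧ (u = c₁ ∨ u = c₂)) h₁ h₂ hne ⟨a₁, .inl rfl⟩
        ⟨a₂, .inr rfl⟩
    by_cases hbx : b = x
    · have hcy : c ≠ y := by
        rintro rfl
        rcases k1' with h | h
        · exact hcon.1 (h ▸ hbx)
        · rcases k2' with h' | h'
          · exact hcon.2 h'.symm
          · exact k3 (h.trans h'.symm)
      rw [edgeWeight_comm] at k4 k5 k6
      refine hn ?_
      rw [edgeWeight_comm]
      refine key (P := P) (k := k) hxy.symm (fun C L h1 h2 => ?_) hv ?_ ?_ k6.reverse k5.reverse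
        k4.reverse ?_ ?_ ?_ ?_ k3.symm hcy k2 k1
      · rw [edgeWeight_comm] at h1
        exact (hmem C L h1 h2).2
      · rw [edgeWeight_comm]; exact hF
      · rw [edgeWeight_comm]; exact hunit
      · rw [← k7]; ext z; simp; tauto
      · intro z hz hz'
        rcases Finset.mem_union.1 hz' with h | h
        · exact k9 z h hz
        · have := k8 z h (by simp [hz])
          subst this
          exact k9 _ k5.left_mem hz
      · intro z hz hz'
        exact k8 z hz' (by simp [hz])
      · rw [hL, k10]; ring
    · exact hn (key (P := P) (k := k) hxy (fun C L h1 h2 => (hmem C L h1 h2).1) hv hF hunit k4 k5 k6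
        k7 k8 k9 (by rw [hL, k10]) k3 hbx k1 k2)
  -- The end of a longest path attaches exactly to x and y and thus has two neighbours off the
  -- frame. Rotation gives a second such end at distance two.
  have hend : ∀ {S a b n}, IsLongest G (edgeWeight x y g) P S a b n →
      G.Adj a x ∧ G.Adj a y ∧ 2 ≤ (G.neighborFinset a \ P).card := by
    intro S a b n hS
    have ha := hS.left_notMem
    have h1 := hF.card_nbrs_le_two hK hn hS (fun u hu v _ _ => hunit u v hu)
      (fun u hu => .inl (hdeg u (hne u hu).1 (hne u hu).2))
    have h2 := G.card_nbrs_add a P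
    have h3 := hdeg a (hne a ha).1 (hne a ha).2
    have h4 : G.neighborFinset a ∩ P ⊆ {x, y} := by
      intro c hc
      obtain ⟨c', hc', hne⟩ := Finset.exists_mem_ne (by omega : 1 < (G.neighborFinset a ∩ P).card) c
      simp only [Finset.mem_inter, mem_neighborFinset] at hc hc'
      simpa using hpair ha c hc.2 c' hc'.2 hne.symm hc.1 hc'.1
    have h5 : G.neighborFinset a ∩ P = {x, y} := Finset.eq_of_subset_of_card_le h4 (by
      rw [Finset.card_pair hxy.ne]; omega)
    have hx : x ∈ G.neighborFinset a ∩ P := by rw [h5]; simp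
    have hy : y ∈ G.neighborFinset a ∩ P := by rw [h5]; simp
    simp only [Finset.mem_inter, mem_neighborFinset] at hx hy
    rw [h5, Finset.card_pair hxy.ne] at h2
    exact ⟨hx.1, hy.1, by omega⟩
  obtain ⟨S, a, b, n, hS⟩ := IsLongest.exists_of_notMem (G := G) (edgeWeight x y g) hh
  obtain ⟨hax, hay, h2⟩ := hend hS
  obtain ⟨z, b', A, D, α, δ, h1, h2, h3, h4, h5, h6, h7, h8⟩ := hS.exists_rotation h2
  have hz := hS.rotate h1 h3 h4 h6 h7
  obtain ⟨hzx, hzy, -⟩ := hend hz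
  have hb' : b' ∉ P := Finset.disjoint_left.1 hS.disj (by rw [← h7]; simp [h3.left_mem])
  refine hn (hF.full_of_common (P := {a, b', z}) (v := a) (z := z) ?_ ?_ hxC hyC hxy.ne' hax hay hzx
    (by rw [hunit a x hS.left_notMem, hunit z x hz.left_notMem]))
  · exact (PathOn.cons h4 (by simp [h4.ne, h5]) (PathOn.edge h2.symm)).congr rfl (by
      rw [hunit a b' hS.left_notMem, hunit b' z hb']; norm_num)
  · simp [hS.left_notMem, hz.left_notMem, hb']

end SimpleGraph

/-! ### A special edge with one odd and one even weight available. -/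

namespace SimpleGraph

variable {V : Type*} [DecidableEq V]

/-- Every residue is the weight of a cycle for one of two weights of the edge `s(x, y)`. -/
def FullPair (G : SimpleGraph V) (x y : V) (g₀ g₁ : ZMod 4) : Prop :=
  ∀ r, (∃ S, CycleOn G (edgeWeight x y g₀) S r) ∨ ∃ S, CycleOn G (edgeWeight x y g₁) S r

section

variable {G : SimpleGraph V} {x y : V} {g₀ g₁ q : ZMod 4}

theorem Full.fullPair (h : Full G (edgeWeight x y g₀)) : FullPair G x y g₀ g₁ := fun r => .inl (h r)

theorem FullPair.symm (h : FullPair G x y g₀ g₁) : FullPair G x y g₁ g₀ := fun r => (h r).symm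

theorem FullPair.comm (h : FullPair G x y g₀ g₁) : FullPair G y x g₀ g₁ := by
  unfold FullPair
  rw [edgeWeight_comm, edgeWeight_comm (g := g₁)]
  exact h

/-- The residues that may be missed, `q + g₀` and `q + g₁`, are different. -/
theorem fullPair_of_forall_ne (hg : g₀ ≠ g₁)
    (h₀ : ∀ r, r ≠ q + g₀ → ∃ S, CycleOn G (edgeWeight x y g₀) S r)
    (h₁ : ∀ r, r ≠ q + g₁ → ∃ S, CycleOn G (edgeWeight x y g₁) S r) : FullPair G x y g₀ g₁ := by
  intro r
  by_cases hr : r = q + g₀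
  · exact .inr (h₁ r (by rw [hr]; simpa using hg))
  · exact .inl (h₀ r hr)

end

variable [Fintype V] {G : SimpleGraph V} [DecidableRel G.Adj] {x y : V} {g g₀ g₁ : ZMod 4}

/-- The frame contains y but not x, so the special edge is an attaching edge. When the end of a
longest path is adjacent to y, a path from it to x closes up over this edge and misses one residue
for each weight. -/
theorem KConn.fullPair_of_mem (hK : KConn G 3) (hxy : G.Adj x y)
    (hdeg : ∀ v, v ≠ x → v ≠ y → 4 ≤ G.degree v) (hg : g₀ ≠ g₁)
    (hmem : ∀ C L, CycleOn G (edgeWeight x y g₀) C L → 2 * L = 2 → x ∉ C → y ∈ C)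
    {C₀ : Finset V} {L₀ : ZMod 4} (hC₀ : CycleOn G (edgeWeight x y g₀) C₀ L₀) (hL₀ : 2 * L₀ = 2)
    (hx : x ∉ C₀) : FullPair G x y g₀ g₁ := by
  by_contra hnP
  have hn : ¬ Full G (edgeWeight x y g₀) := fun h => hnP h.fullPair
  obtain ⟨C, L, hF, hd⟩ := hK.exists_frame (H₀ := {x}) hC₀ hL₀ (by simp) (by
    intro u hu v hv
    simp at hu hv
    subst hu hv
    exact Linked.refl (by simp)) (by simpa using hx)
  have hxC : x ∉ C := by simpa using hd
  have hyC : y ∈ C := hmem C L hF.cyc hF.odd hxC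
  have hunitC : ∀ g, ∀ u ∈ C, ∀ v ∈ C, G.Adj u v → edgeWeight x y g s(u, v) = 1 :=
    fun g u hu v hv _ => edgeWeight_of_notMem (.inl hxC) hu hv
  have hney : ∀ u, u ∉ C → u ≠ y := fun u hu h => hu (h ▸ hyC)
  have hunitH : ∀ u ∉ C, ∀ v ∉ C, G.Adj u v → edgeWeight x y g₀ s(u, v) = 1 :=
    fun u hu v hv _ => edgeWeight_of_ne_right (hney u hu) (hney v hv)
  have hwC : ∀ g u v, u ∉ C → u ≠ x → edgeWeight x y g s(u, v) = 1 :=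
    fun g u v hu hux => edgeWeight_of_left_ne hux (hney u hu)
  -- The degree of x is not bounded below, but x attaches to the frame at y.
  have htwo : ∀ {S a b n}, IsLongest G (edgeWeight x y g₀) C S a b n →
      (G.neighborFinset a \ C).card ≤ 2 := fun hS =>
    hF.card_nbrs_le_two hK hn hS hunitH (fun u hu => by
      by_cases h : u = x
      · subst h; exact .inr ⟨y, hyC, hxy⟩
      · exact .inl (hdeg u h (hney u hu)))
  have hatt2 : ∀ {S a b n}, IsLongest G (edgeWeight x y g₀) C S a b n → a ≠ x →
      2 ≤ (G.neighborFinset a ∩ C).card := by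
    intro S a b n hS hax
    have h1 := htwo hS
    have h2 := G.card_nbrs_add a C
    have := hdeg a hax (hney a hS.left_notMem)
    omega
  -- If both ends were x, then x would be the only vertex off C, and a vertex of C other than y
  -- would have degree at most three.
  obtain ⟨S, a, b, n, hS, hax⟩ : ∃ S a b n, IsLongest G (edgeWeight x y g₀) C S a b n ∧ a ≠ x := by
    obtain ⟨S, a, b, n, hS⟩ := IsLongest.exists_of_notMem (G := G) (edgeWeight x y g₀) hxC
    by_cases ha : a = x
    · by_cases hb : b = x
      · subst ha
        subst hb
        have hcl := hF.compl_eq_of_closed (W := {b}) (a := b) (by simp) (by simpa using hxC) (by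
          intro u hu v hv huv
          simp only [Finset.mem_singleton] at hu
          subst hu
          have := hS.nbr_mem hv huv
          rwa [hS.path.eq_singleton.1] at this)
        obtain ⟨c, hc, hcy⟩ := Finset.exists_mem_ne
          (by have := hF.cyc.three_le_card; omega : 1 < C.card) y
        have h1 := hdeg c (fun h => hxC (h ▸ hc)) hcy
        have h2 := G.card_nbrs_add c C
        have h3 := hF.card_nbrs_inter_le_two hc
        have h4 : (G.neighborFinset c \ C).card ≤ 1 := by
          rw [← Finset.card_singleton b, ← hcl]
          apply Finset.card_le_card
          intro z hz
          simp at hz ⊢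
          exact hz.2
        omega
      · exact ⟨S, b, a, n, hS.reverse, hb⟩
    · exact ⟨S, a, b, n, hS, ha⟩
  have hcard : C.card = 3 := by
    by_contra hcard
    obtain ⟨c₁, h1, c₂, h2, h3, h4, h5⟩ := exists_two_attachments (hatt2 hS hax)
    exact hn (hF.full_of_two_attachments (hunitC g₀) hcard hS.left_notMem h3 h1 h2 h4 h5
      (by rw [hwC _ _ _ hS.left_notMem hax, hwC _ _ _ hS.left_notMem hax]))
  by_cases hay : G.Adj a y
  · obtain ⟨c, hc, hne⟩ := Finset.exists_mem_ne
      (by have := hatt2 hS hax; omega : 1 < (G.neighborFinset a ∩ C).card) y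
    simp at hc
    obtain ⟨P, p, hP, hPC⟩ := (hF.linked a hS.left_notMem x hxC).path (edgeWeight x y g₀)
    have hPd : Disjoint P C := by
      rw [Finset.disjoint_left]; intro z hz; simpa using hPC hz
    have hyP : y ∉ P := fun h => Finset.disjoint_left.1 hPd h hyC
    refine hnP (fullPair_of_forall_ne hg (q := p) (fun r hr => ?_) (fun r hr => ?_))
    · exact hF.exists_cycle_of_ne (hunitC _) hcard hP hPd hax hyC hc.2 hne hay hc.1 hxy
        (hwC _ _ _ hS.left_notMem hax) (hwC _ _ _ hS.left_notMem hax)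
        (by rwa [edgeWeight_self])
    · exact (hF.edgeWeight (.inl hxC) g₁).exists_cycle_of_ne (hunitC _) hcard
        (hP.edgeWeight (.inr hyP) g₁) hPd hax hyC hc.2 hne hay hc.1 hxy
        (hwC _ _ _ hS.left_notMem hax) (hwC _ _ _ hS.left_notMem hax)
        (by rwa [edgeWeight_self])
  · have h2 : 2 ≤ (G.neighborFinset a \ C).card := by
      have h1 : G.neighborFinset a ∩ C ⊆ C.erase y := by
        intro c hc
        simp at hc ⊢
        exact ⟨fun h => hay (h ▸ hc.1), hc.2⟩
      have h2 := Finset.card_le_card h1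
      rw [Finset.card_erase_of_mem hyC] at h2
      have h3 := G.card_nbrs_add a C
      have := hdeg a hax (hney a hS.left_notMem)
      omega
    obtain ⟨z, b', A, D, α, δ, h1, h2, h3, h4, h5, h6, h7, h8⟩ := hS.exists_rotation h2
    have hz := hS.rotate h1 h3 h4 h6 h7
    have hb' : b' ∉ C := Finset.disjoint_left.1 hS.disj (by rw [← h7]; simp [h3.left_mem])
    have hwab := hunitH a hS.left_notMem b' hb' h4
    have hwzb := hunitH z hz.left_notMem b' hb' h2
    -- When the rotated end is x, its attachments are not controlled, so the other end `b` is used.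
    -- Bypassing the segment A via the edge ab' changes the weight by `α`, and `α = 0` would give a
    -- cycle of weight 2.
    by_cases hzx : z = x
    · have hbx : b ≠ x := by
        rintro rfl
        rw [hzx] at h1
        exact Finset.disjoint_left.1 h6 h1.right_mem h3.right_mem
      have hab : a ≠ b := fun h => Finset.disjoint_left.1 h6 h1.left_mem (h ▸ h3.right_mem)
      obtain ⟨c, hc, c', hc', hne, a₁, a₂, a₃⟩ := exists_common_attachment hcard (hatt2 hS hax)
        (hatt2 hS.reverse hbx)
      have hAC : Disjoint A C := hS.disj.mono_left (by rw [← h7]; exact Finset.subset_union_left)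
      have hDC : Disjoint D C := hS.disj.mono_left (by rw [← h7]; exact Finset.subset_union_right)
      have haD : a ∉ D := Finset.disjoint_left.1 h6 h1.left_mem
      have hb'A : b' ∉ A := Finset.disjoint_right.1 h6 h3.left_mem
      by_cases hα : α = 0
      · subst hα
        have e1 := CycleOn.join h1 (.nil b') h4 h2 (by simpa using hb'A) (by
          have := h1.two_le_card h5; simp; omega)
        rw [hwab, hwzb] at e1
        refine hF.weight_ne_two hK hn e1 ?_ (by norm_num)
        rw [Finset.disjoint_union_right]
        exact ⟨hAC.symm, by simpa using hb'⟩
      · have e1 := PathOn.cons h4 haD h3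
        refine hn (hF.full_of_ne (hunitC _) hcard hS.path e1 hS.disj ?_ hab hc hc' hne a₁ a₂ a₃
          (hwC _ _ _ hS.left_notMem hax) (hwC _ _ _ hS.left_notMem hax) ?_)
        · rw [Finset.disjoint_insert_left]
          exact ⟨hS.left_notMem, hDC⟩
        · rw [h8, hwab, hwzb]
          intro h
          exact hα (by linear_combination h)
    · obtain ⟨c, hc, c', hc', hne, a₁, a₂, a₃⟩ := exists_common_attachment hcard (hatt2 hS hax)
        (hatt2 hz hzx)
      refine hn (hF.full_of_common (P := {a, b', z}) (v := a) (z := z) ?_ ?_ hc hc' hne a₁ a₂ a₃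
        (by rw [hwC _ _ _ hS.left_notMem hax, hwC _ _ _ hz.left_notMem hzx]))
      · exact (PathOn.cons h4 (by simp [h4.ne, h5]) (PathOn.edge h2.symm)).congr rfl (by
          rw [hwab, Sym2.eq_swap, hwzb]; norm_num)
      · simp [hS.left_notMem, hz.left_notMem, hb']

omit [DecidableRel G.Adj] in
/-- An ear configuration at a longest path whose rotated end is an end of the special edge forces
cycles of all weights. -/
theorem KConn.false_of_ear {C A B D : Finset V} {L α β δ : ZMod 4} {a b c e : V} (hK : KConn G 3)
    (hF : IsFrame G (edgeWeight x y g₀) C L) (hxC : x ∉ C) (hxy : G.Adj x y)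
    (hn₀ : ¬ Full G (edgeWeight x y g₀)) (hn₁ : ¬ Full G (edgeWeight x y g₁)) (hg₀ : 2 * g₀ = 2)
    (hg₁ : 2 * g₁ = 0) (hA : PathOn G (edgeWeight x y g₀) A a x α) (hxb : G.Adj x b)
    (hB : PathOn G (edgeWeight x y g₀) B b c β) (hD : PathOn G (edgeWeight x y g₀) D c e δ)
    (hab : G.Adj a b) (hac : G.Adj a c) (hax : a ≠ x) (hay : a ≠ y) (hbc : b ≠ c)
    (hd : Disjoint A (B ∪ D)) (hBD : ∀ v ∈ B, v ∈ D → v = c) (hy : y ∈ A ∪ (B ∪ D))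
    (hC : Disjoint (A ∪ (B ∪ D)) C) : False := by
  have hF₁ := hF.edgeWeight (.inl hxC) g₁
  have hbBD : b ∈ B ∪ D := by simp [hB.left_mem]
  have hbA : b ∉ A := Finset.disjoint_right.1 hd hbBD
  have hxBD : x ∉ B ∪ D := Finset.disjoint_left.1 hd hA.right_mem
  have hxB : x ∉ B := fun h => hxBD (by simp [h])
  have hAB : Disjoint A B := hd.mono_right Finset.subset_union_left
  have hAC : Disjoint C A := (hC.mono_left Finset.subset_union_left).symm
  have hBC : Disjoint C B := (hC.mono_left (by intro v; simp; tauto)).symm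
  have hbC : b ∉ C := Finset.disjoint_right.1 hBC hB.left_mem
  have hA2 := hA.two_le_card hax
  have hwa : ∀ g u, edgeWeight x y g s(a, u) = 1 := fun g u => edgeWeight_of_left_ne hax hay
  have hAb3 : 3 ≤ (A ∪ {b}).card := by
    rw [Finset.card_union_of_disjoint (by simpa using hbA)]; simp; omega
  have hAbC : Disjoint C (A ∪ {b}) := by
    rw [Finset.disjoint_union_right]; exact ⟨hAC, by simpa using hbC⟩
  have hAbB : ∀ v ∈ A ∪ {b}, v ∈ B → v = b := by
    intro v hv hv'
    rcases Finset.mem_union.1 hv with h | h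
    · exact absurd hv' (Finset.disjoint_left.1 hAB h)
    · simpa using h
  -- In each position of y on the path an even weight contains the special edge once, which cannot
  -- hold for both `g₀` and `g₁`, or a theta graph with the odd edge xy contradicts the ear.
  by_cases hyb : y = b
  · subst hyb
    have e0 := (hF.ear_even hK hn₀ (hA.join hxb (.nil y) (by simpa using hbA)) hAb3 hB hAbB hab hac
      hbc hAbC hBC (hwa _ _)).1
    have e1 := (hF₁.ear_even hK hn₁ ((hA.edgeWeight (.inr hbA) g₁).join hxb (.nil y)
      (by simpa using hbA)) hAb3 (hB.edgeWeight (.inl hxB) g₁) hAbB hab hac hbc hAbC hBC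
      (hwa _ _)).1
    rw [edgeWeight_self] at e0 e1
    have : (2 : ZMod 4) = 0 := by linear_combination e0 - e1 - hg₀ + hg₁
    exact absurd this (by decide)
  have hwxb : ∀ g, edgeWeight x y g s(x, b) = 1 := fun g =>
    edgeWeight_of_ne_right hxy.ne (Ne.symm hyb)
  rcases Finset.mem_union.1 hy with hyA | hyBD
  · obtain ⟨A₁, A₂, a₁, a₂, k1, k2, rfl, k4, rfl⟩ := hA.split hyA
    have hxA₁ : x ∉ A₁ := fun h => hxy.ne (k4 x h k2.right_mem)
    have hbA₁ : b ∉ A₁ := fun h => hbA (by simp [h])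
    have e0 := (hF.ear_even hK hn₀ (hA.join hxb (.nil b) (by simpa using hbA)) hAb3 hB hAbB hab hac
      hbc hAbC hBC (hwa _ _)).1
    rw [hwxb] at e0
    by_cases hA2c : A₂.card ≤ 2
    · obtain ⟨rfl, -, rfl⟩ := k2.eq_pair hA2c hxy.ne'
      have hA' := (k1.edgeWeight (.inl hxA₁) g₁).join hxy.symm (.nil x) (by simpa using hxA₁)
      have hU : A₁ ∪ {x} = A₁ ∪ {y, x} := by
        have := k1.right_mem
        ext v; simp; grind
      have e1 := (hF₁.ear_even hK hn₁ ((hA'.congr hU rfl).join hxb (.nil b)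
        (by simpa using hbA)) hAb3 (hB.edgeWeight (.inl hxB) g₁) hAbB hab hac hbc hAbC hBC
        (hwa _ _)).1
      rw [hwxb, Sym2.eq_swap, edgeWeight_self] at e1
      rw [Sym2.eq_swap, edgeWeight_self] at e0
      have : (2 : ZMod 4) = 0 := by linear_combination e0 - e1 - hg₀ + hg₁
      exact absurd this (by decide)
    · have c1 := CycleOn.of_path k2 hxy (by omega)
      rw [edgeWeight_self] at c1
      have hpath := PathOn.cons hxb (by simp; exact ⟨hxb.ne, hxA₁⟩)
        (PathOn.cons hab.symm hbA₁ k1)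
      have hcard : 3 ≤ (insert x (insert b A₁)).card := by
        rw [Finset.card_insert_of_notMem (by simp; exact ⟨hxb.ne, hxA₁⟩),
          Finset.card_insert_of_notMem hbA₁]
        have := Finset.card_pos.2 ⟨_, k1.left_mem⟩
        omega
      have c2 := CycleOn.of_path hpath hxy.symm hcard
      rw [hwxb, Sym2.eq_swap (a := b), hwa, Sym2.eq_swap (a := y), edgeWeight_self] at c2
      have c3 := CycleOn.of_path (hA.join hxb (.nil b) (by simpa using hbA)) hab.symm hAb3
      rw [hwxb, Sym2.eq_swap (a := b), hwa] at c3
      obtain ⟨e2, e3⟩ := hF.theta_even hK hn₀ (n₁ := g₀) (n₂ := a₂) (n₃ := 2 + a₁)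
        (c1.congr rfl (by ring)) (c2.congr rfl (by ring)) (c3.congr rfl (by ring))
        (hAC.mono_right Finset.subset_union_right) (by
          rw [Finset.disjoint_insert_right, Finset.disjoint_insert_right]
          exact ⟨hxC, hbC, hAC.mono_right Finset.subset_union_left⟩) hAbC hg₀
      have : (2 : ZMod 4) = 0 := by linear_combination e0 - e2 - e3 + ZMod4.four_eq_zero
      exact absurd this (by decide)
  · have hyA : y ∉ A := Finset.disjoint_right.1 hd hyBD
    obtain ⟨Q, Q', q, q', k1, -, k3, -, -⟩ := (hB.append hD hBD).split hyBD
    have hQ : Q ⊆ B ∪ D := by rw [← k3]; exact Finset.subset_union_left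
    have hxQ : x ∉ Q := fun h => hxBD (hQ h)
    have hAb := hA.reverse.join hab (.nil b) (by simpa using hbA)
    have hyAb : y ∉ A ∪ {b} := by simp [hyA, hyb]
    have hQC : Disjoint C Q := hC.symm.mono_right (hQ.trans Finset.subset_union_right)
    have hAbQ : ∀ v ∈ A ∪ {b}, v ∈ Q → v = b := by
      intro v hv hv'
      rcases Finset.mem_union.1 hv with h | h
      · exact absurd (hQ hv') (Finset.disjoint_left.1 hd h)
      · simpa using h
    have e0 := (hF.ear_even hK hn₀ hAb hAb3 k1 hAbQ hxb hxy (Ne.symm hyb) hAbC hQC (hwxb _)).2.1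
    have e1 := (hF₁.ear_even hK hn₁ (hAb.edgeWeight (.inr hyAb) g₁) hAb3
      (k1.edgeWeight (.inl hxQ) g₁) hAbQ hxb hxy (Ne.symm hyb) hAbC hQC (hwxb _)).2.1
    rw [edgeWeight_self] at e0 e1
    have : (2 : ZMod 4) = 0 := by linear_combination e0 - e1 - hg₀ + hg₁
    exact absurd this (by decide)

/-- A path of `G` avoiding `C` from `v` through `x` and `y` to a vertex with an attachment in common
with `v`, cut between `x` and `y`. -/
theorem KConn.exists_paths_through {C : Finset V} {v : V} {M : Type*} [AddCommMonoid M]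
    (w : Sym2 V → M) (hK : KConn G 3) (hconn : ∀ u ∉ C, ∀ v ∉ C, Linked G Cᶜ u v) (hx : x ∉ C)
    (hy : y ∉ C) (hxy : x ≠ y) (hv : v ∉ C) (h₁ : C.card ≤ (G.neighborFinset v ∩ C).card + 1)
    (h₂ : 2 ≤ (G.neighborFinset v ∩ C).card) :
    ∃ x' y' u c P Q n m, ((x' = x ∧ y' = y) ∨ (x' = y ∧ y' = x)) ∧ PathOn G w P v x' n ∧
      PathOn G w Q y' u m ∧ Disjoint P Q ∧ Disjoint P C ∧ Disjoint Q C ∧ c ∈ C ∧ G.Adj v c ∧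
      G.Adj u c := by
  classical
  let G' : SimpleGraph V :=
    { Adj := fun u v => G.Adj u v ∧ u ∉ C ∧ v ∉ C
      symm := ⟨fun u v h => ⟨h.1.symm, h.2.2, h.2.1⟩⟩
      loopless := ⟨fun u h => G.loopless.irrefl u h.1⟩ }
  have hG' : ∀ {u v}, G'.Adj u v ↔ G.Adj u v ∧ u ∉ C ∧ v ∉ C := Iff.rfl
  have hsub : ∀ {S a b n}, PathOn G' (fun _ => (1 : ℕ)) S a b n → a ∉ C → S ⊆ Cᶜ := by
    intro S a b n h ha
    exact h.subset_of_closed (U := Finset.univ) (fun u hu v _ huv => by simpa using huv.2.2)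
      (by simpa using ha) (Finset.subset_univ _)
  set U := Finset.univ.filter (fun u => u ∉ C ∧ ∃ c ∈ C, G.Adj v c ∧ G.Adj u c) with hU
  have hUmem : ∀ u, u ∈ U ↔ u ∉ C ∧ ∃ c ∈ C, G.Adj v c ∧ G.Adj u c := by simp [hU]
  obtain ⟨T, f, P, t1, t2, t3, t4⟩ := menger w 2 G' {x, y} U (by
    intro X hX
    by_contra hlt
    obtain ⟨a, ha, haX⟩ := Finset.exists_mem_notMem_of_card_lt_card (s := X) (t := {x, y})
      (by rw [Finset.card_pair hxy]; omega)
    have haC : a ∉ C := by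
      simp at ha
      rcases ha with rfl | rfl <;> assumption
    obtain ⟨c, hc, hcX⟩ := Finset.exists_mem_notMem_of_card_lt_card (s := X)
      (t := G.neighborFinset v ∩ C) (by omega)
    simp only [Finset.mem_inter, mem_neighborFinset] at hc
    have hlC : ∀ {u}, Linked G' Xᶜ a u → u ∉ C := by
      rintro u ⟨S, n, h1, h2⟩
      simpa using hsub h1 haC h1.right_mem
    -- A component off C and X that contains no vertex of U sends edges only to X and to C outside
    -- the neighbourhood of `v`: at most two vertices in all.
    have := hK (Finset.univ.filter (fun u => Linked G' Xᶜ a u)) (X ∪ (C \ G.neighborFinset v))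
      ⟨a, by simpa using Linked.refl (by simpa using haX)⟩ (by
        intro u hu z huz
        simp only [Finset.mem_filter, Finset.mem_univ, true_and] at hu ⊢
        by_cases hzX : z ∈ X
        · exact .inr (by simp [hzX])
        by_cases hzC : z ∈ C
        · by_cases hvz : G.Adj v z
          · exact absurd hu (hX a ha u ((hUmem u).2 ⟨hlC hu, z, hzC, hvz, huz⟩))
          · exact .inr (by simp [hzC, hvz])
        · exact .inl (hu.adj (hG'.2 ⟨huz, hlC hu, hzC⟩) (by simpa using hzX))) ⟨c, by
        simp only [Finset.mem_filter, Finset.mem_univ, true_and]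
        exact fun h => hlC h hc.2, by simp [hcX, hc.1]⟩
    have h3 := Finset.card_union_le X (C \ G.neighborFinset v)
    have h4 := Finset.card_inter_add_card_sdiff C (G.neighborFinset v)
    rw [Finset.inter_comm] at h4
    omega)
  have hT : T = {x, y} := Finset.eq_of_subset_of_card_le t2 (by rw [t1]; exact Finset.card_le_two)
  subst hT
  have key : ∀ {x y h S n}, x ∉ C → y ∉ C → f y ∈ U → (∃ n, PathOn G' w (P x) x (f x) n) →
      (∃ n, PathOn G' w (P y) y (f y) n) → Disjoint (P x) (P y) → PathOn G w S v h n → S ⊆ Cᶜ →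
      (∀ z ∈ S, z ∈ P x ∪ P y → z = h) → h ∈ P x →
      ∃ u c P Q n m, PathOn G w P v x n ∧ PathOn G w Q y u m ∧ Disjoint P Q ∧ Disjoint P C ∧
        Disjoint Q C ∧ c ∈ C ∧ G.Adj v c ∧ G.Adj u c := by
    rintro x y h S n hx hy hfy ⟨p, hp⟩ ⟨q, hq⟩ hPd hS hSC hhit hh
    obtain ⟨-, c, hc, hvc, huc⟩ := (hUmem _).1 hfy
    have hpC := hsub (hp.reweight _).choose_spec hx
    have hqC := hsub (hq.reweight _).choose_spec hy
    replace hp := hp.graphMap (G' := G) (fun _ _ _ _ h => h.1)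
    replace hq := hq.graphMap (G' := G) (fun _ _ _ _ h => h.1)
    obtain ⟨P₁, P₂, p₁, p₂, k1, k2, k3, k4, k5⟩ := hp.split hh
    have hP₁ : P₁ ⊆ P x := by rw [← k3]; exact Finset.subset_union_left
    have hcompl : ∀ {T}, T ⊆ Cᶜ → Disjoint T C := fun {T} hT => by
      rw [Finset.disjoint_left]; intro z hz; simpa using hT hz
    refine ⟨f y, c, S ∪ P₁, P y, _, q, hS.append k1.reverse
      (fun z h1 h2 => hhit z h1 (by simp [hP₁ h2])), hq, ?_,
      hcompl (Finset.union_subset hSC (hP₁.trans hpC)), hcompl hqC, hc, hvc, huc⟩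
    rw [Finset.disjoint_union_left]
    refine ⟨?_, hPd.mono_left hP₁⟩
    rw [Finset.disjoint_left]
    intro z hz hz'
    have := hhit z hz (by simp [hz'])
    subst this
    exact Finset.disjoint_left.1 hPd hh hz'
  have tx := t3 x (by simp)
  have ty := t3 y (by simp)
  have txy := t4 x (by simp) y (by simp) hxy
  obtain ⟨S, n, hS, hSC⟩ := (hconn v hv x hx).path w
  -- The path from `v` follows whichever of the two disjoint paths it meets first back to x or y;
  -- the other path leads from the remaining end to U.
  obtain ⟨S', n', h, e1, e2, e3, e4⟩ := hS.firstHit (B := P x ∪ P y) ⟨x, hS.right_mem, by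
    obtain ⟨n, hn⟩ := tx.2
    simp [hn.left_mem]⟩
  rcases Finset.mem_union.1 e3 with hh | hh
  · obtain ⟨u, c, P, Q, n, m, r⟩ := key hx hy ty.1 tx.2 ty.2 txy e1 (e2.trans hSC) e4 hh
    exact ⟨x, y, u, c, P, Q, n, m, .inl ⟨rfl, rfl⟩, r⟩
  · obtain ⟨u, c, P, Q, n, m, r⟩ := key hy hx tx.1 ty.2 tx.2 txy.symm e1 (e2.trans hSC)
      (fun z h1 h2 => e4 z h1 (by rwa [Finset.union_comm])) hh
    exact ⟨y, x, u, c, P, Q, n, m, .inr ⟨rfl, rfl⟩, r⟩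

/-- A frame is chosen off both ends of the special edge. Then a path off C through this edge,
attached suitably at both ends, misses one residue for each weight, and the two differ. -/
theorem KConn.fullPair_of_notMem (hK : KConn G 3) (hxy : G.Adj x y)
    (hdeg : ∀ v, v ≠ x → v ≠ y → 4 ≤ G.degree v) (hg₀ : 2 * g₀ = 2) (hg₁ : 2 * g₁ = 0)
    {C₀ : Finset V} {L₀ : ZMod 4} (hC₀ : CycleOn G (edgeWeight x y g₀) C₀ L₀) (hL₀ : 2 * L₀ = 2)
    (hx : x ∉ C₀) (hy : y ∉ C₀) : FullPair G x y g₀ g₁ := by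
  by_contra hnP
  have hn₀ : ¬ Full G (edgeWeight x y g₀) := fun h => hnP h.fullPair
  have hn₁ : ¬ Full G (edgeWeight x y g₁) := fun h => hnP h.fullPair.symm
  have hg : g₀ ≠ g₁ := by rintro rfl; rw [hg₀] at hg₁; exact absurd hg₁ (by decide)
  have hxyl : Linked G {x, y} x y := .of_path (PathOn.edge (w := fun _ => (1 : ℕ)) hxy) (by simp)
  obtain ⟨C, L, hF, hd⟩ := hK.exists_frame (H₀ := {x, y}) hC₀ hL₀ (by simp) (by
    have hx : Linked G {x, y} x x := .refl (by simp)
    have hy : Linked G {x, y} y y := .refl (by simp)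
    intro u hu v hv
    simp only [Finset.mem_insert, Finset.mem_singleton] at hu hv
    rcases hu with rfl | rfl <;> rcases hv with rfl | rfl
    exacts [hx, hxyl, hxyl.symm, hy]) (by simp [hx, hy])
  have hxC : x ∉ C := Finset.disjoint_right.1 hd (by simp)
  have hyC : y ∉ C := Finset.disjoint_right.1 hd (by simp)
  have hF₁ := hF.edgeWeight (.inl hxC) g₁
  have hunitC : ∀ g, ∀ u ∈ C, ∀ v ∈ C, G.Adj u v → edgeWeight x y g s(u, v) = 1 :=
    fun g u hu v hv _ => edgeWeight_of_notMem (.inl hxC) hu hv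
  have hwC : ∀ g u c, c ∈ C → edgeWeight x y g s(u, c) = 1 := fun g u c hc => by
    rw [Sym2.eq_swap]
    exact edgeWeight_of_left_ne (fun h => hxC (h ▸ hc)) (fun h => hyC (h ▸ hc))
  have hw : ∀ g u v, u ≠ x → u ≠ y → edgeWeight x y g s(u, v) = 1 :=
    fun g u v h1 h2 => edgeWeight_of_left_ne h1 h2
  have hdegC : ∀ c ∈ C, 4 ≤ G.degree c := fun c hc =>
    hdeg c (fun h => hxC (h ▸ hc)) (fun h => hyC (h ▸ hc))
  -- The attachment of the rotated end is only known away from x and y; `KConn.false_of_ear` covers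
  -- these two ends.
  have htwo : ∀ {S a b n}, IsLongest G (edgeWeight x y g₀) C S a b n → a ≠ x → a ≠ y →
      2 ≤ (G.neighborFinset a ∩ C).card := by
    intro S a e n hS hax hay
    have h1 := G.card_nbrs_add a C
    have h2 := hdeg a hax hay
    suffices (G.neighborFinset a \ C).card ≤ 2 by omega
    by_contra hcon
    obtain ⟨z, b, c, A, B, D, α, β, δ, h1, h2, h3, h4, h5, h6, h7, h8, h9, h10, h11⟩ :=
      hS.exists_ear (by omega)
    have hz := hS.rotate h1 (h3.append h4 h10) h5 h9 h11
    have hdC : Disjoint (A ∪ (B ∪ D)) C := by rw [h11]; exact hS.disj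
    by_cases hzx : z = x
    · subst hzx
      exact hK.false_of_ear hF hxC hxy hn₀ hn₁ hg₀ hg₁ h1 h2 h3 h4 h5 h6 hax hay h8 h9 h10
        (by rw [h11]; exact hz.nbr_mem hyC hxy) hdC
    by_cases hzy : z = y
    · subst hzy
      rw [edgeWeight_comm] at hF hn₀ hn₁ h1 h3 h4
      exact hK.false_of_ear hF hyC hxy.symm hn₀ hn₁ hg₀ hg₁ h1 h2 h3 h4 h5 h6 hay hax h8 h9 h10
        (by rw [h11]; exact hz.nbr_mem hxC hxy.symm) hdC
    obtain ⟨c₁, hc₁, a₁⟩ := hF.exists_attachment hK hn₀ hS (fun u _ _ => hw _ _ _ hax hay)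
      (hdeg a hax hay)
    obtain ⟨c₂, hc₂, a₂⟩ := hF.exists_attachment hK hn₀ hz (fun u _ _ => hw _ _ _ hzx hzy)
      (hdeg z hzx hzy)
    exact hn₀ (hF.full_of_ear hK h1 h2 h3 (h9.mono_right Finset.subset_union_left) h5 h6 h7 h8
      (hdC.mono_left Finset.subset_union_left).symm
      (hdC.mono_left (by intro v; simp; tauto)).symm (hw _ _ _ hax hay) (hw _ _ _ hzx hzy) hc₁ hc₂
      a₁ a₂)
  have hthree : ∀ {v}, v ∉ C → 2 ≤ (G.neighborFinset v ∩ C).card → C.card = 3 := by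
    intro v hv h2
    by_contra hcard
    obtain ⟨c₁, h1, c₂, h2, h3, h4, h5⟩ := exists_two_attachments h2
    exact hn₀ (hF.full_of_two_attachments (hunitC g₀) hcard hv h3 h1 h2 h4 h5
      (by rw [hwC _ _ _ h1, hwC _ _ _ h2]))
  by_cases hex : ∃ S a b n, IsLongest G (edgeWeight x y g₀) C S a b n ∧ a ≠ x ∧ a ≠ y
  · obtain ⟨S, a, b, n, hS, hax, hay⟩ := hex
    have h2 := htwo hS hax hay
    have hcard := hthree hS.left_notMem h2
    obtain ⟨x', y', u, c, P, Q, n, m, hxy', hP, hQ, hPQ, hPC, hQC, hc, hac, huc⟩ :=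
      hK.exists_paths_through (edgeWeight x y g₀) hF.linked hxC hyC hxy.ne hS.left_notMem
        (by omega) h2
    obtain ⟨c', hc', hne⟩ := Finset.exists_mem_ne
      (by omega : 1 < (G.neighborFinset a ∩ C).card) c
    simp only [Finset.mem_inter, mem_neighborFinset] at hc'
    have hs : s(x', y') = s(x, y) := by
      rcases hxy' with ⟨rfl, rfl⟩ | ⟨rfl, rfl⟩
      exacts [rfl, Sym2.eq_swap]
    have hadj : G.Adj x' y' := by
      rcases hxy' with ⟨rfl, rfl⟩ | ⟨rfl, rfl⟩
      exacts [hxy, hxy.symm]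
    have hy'P := Finset.disjoint_right.1 hPQ hQ.left_mem
    have hx'Q := Finset.disjoint_left.1 hPQ hP.right_mem
    have hPn : x ∉ P ∨ y ∉ P := by
      rcases hxy' with ⟨rfl, rfl⟩ | ⟨rfl, rfl⟩
      exacts [.inr hy'P, .inl hy'P]
    have hQn : x ∉ Q ∨ y ∉ Q := by
      rcases hxy' with ⟨rfl, rfl⟩ | ⟨rfl, rfl⟩
      exacts [.inl hx'Q, .inr hx'Q]
    have hau : a ≠ u := fun h => Finset.disjoint_left.1 hPQ hP.left_mem (h ▸ hQ.right_mem)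
    have hPQC : Disjoint (P ∪ Q) C := by rw [Finset.disjoint_union_left]; exact ⟨hPC, hQC⟩
    have e0 := hP.join hadj hQ hPQ
    have e1 := (hP.edgeWeight hPn g₁).join hadj (hQ.edgeWeight hQn g₁) hPQ
    rw [hs, edgeWeight_self] at e0 e1
    refine hnP (fullPair_of_forall_ne hg (q := n + m + 1) (fun r hr => ?_) (fun r hr => ?_))
    · exact hF.exists_cycle_of_ne (hunitC _) hcard e0 hPQC hau hc hc'.2 hne hac hc'.1 huc
        (hwC _ _ _ hc) (hwC _ _ _ hc'.2) (by
          rw [hwC _ _ _ hc]; intro h; exact hr (by rw [h]; ring))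
    · exact hF₁.exists_cycle_of_ne (hunitC _) hcard e1 hPQC hau hc hc'.2 hne hac hc'.1 huc
        (hwC _ _ _ hc) (hwC _ _ _ hc'.2) (by
          rw [hwC _ _ _ hc]; intro h; exact hr (by rw [h]; ring))
  -- the longest paths avoiding the frame cycle consist of the special edge
  have hex' : ∀ {S a b n}, IsLongest G (edgeWeight x y g₀) C S a b n → a = x ∨ a = y := by
    intro S a b n h
    by_contra hcon
    push Not at hcon
    exact hex ⟨S, a, b, n, h, hcon⟩
  obtain ⟨S, a, b, n, hS⟩ := IsLongest.exists_of_notMem (G := G) (edgeWeight x y g₀) hxC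
  have ha := hex' hS
  have hb := hex' hS.reverse
  have hab : G.Adj a b := by
    have hne : a ≠ b := by
      rintro rfl
      have : ∃ u, u ∉ C ∧ G.Adj a u := by
        rcases ha with rfl | rfl
        exacts [⟨y, hyC, hxy⟩, ⟨x, hxC, hxy.symm⟩]
      obtain ⟨u, hu, hau⟩ := this
      have := hS.nbr_mem hu hau
      rw [hS.path.eq_singleton.1] at this
      simp at this
      exact hau.ne this.symm
    rcases ha with rfl | rfl <;> rcases hb with rfl | rfl
    exacts [absurd rfl hne, hxy, hxy.symm, absurd rfl hne]
  have hSxy : S = {x, y} := by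
    obtain ⟨a', S', n', h1, h2, h3, rfl, rfl⟩ := hS.path.first hab.ne
    -- The ends are x and y, so the path closes to a cycle and its second vertex also starts a
    -- longest path. Being x or y and not `a`, it is `b`.
    have haa : a' = b := by
      have hrot := hS.of_path (h3.join hab.symm (.nil a) (by simpa using h2)) (by
        rw [Finset.union_comm, ← Finset.insert_eq]) (by
        have := hS.disj
        rwa [Finset.union_comm, ← Finset.insert_eq])
      have h4 := hex' hrot
      have h5 := h1.ne
      have h6 := hab.ne
      rcases ha with rfl | rfl <;> rcases hb with rfl | rfl <;> rcases h4 with rfl | rfl <;>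
        first | rfl | exact absurd rfl h5 | exact absurd rfl h6
    subst haa
    rw [h3.eq_singleton.1]
    rcases ha with rfl | rfl <;> rcases hb with rfl | rfl
    · exact absurd rfl hab.ne
    · rfl
    · exact Finset.pair_comm _ _
    · exact absurd rfl hab.ne
  have hcl : Cᶜ = {x, y} := hF.compl_eq_of_closed (a := x) (by simp) (by simp [hxC, hyC]) (by
    have hclS : ∀ u, u = a ∨ u = b → ∀ v ∉ C, G.Adj u v → v ∈ S := by
      rintro u (rfl | rfl) v hv huv
      exacts [hS.nbr_mem hv huv, hS.reverse.nbr_mem hv huv]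
    intro u hu v hv huv
    rw [← hSxy]
    refine hclS u ?_ v hv huv
    simp only [Finset.mem_insert, Finset.mem_singleton] at hu
    have := hab.ne
    rcases ha with rfl | rfl <;> rcases hb with rfl | rfl <;> tauto)
  -- A vertex of C has at most two neighbours on the induced cycle, so it needs both vertices off C.
  have hcxy : ∀ c ∈ C, G.Adj c x ∧ G.Adj c y := by
    intro c hc
    have h1 := G.card_nbrs_add c C
    have h2 := hdegC c hc
    have h3 := hF.card_nbrs_inter_le_two hc
    have h4 : G.neighborFinset c \ C = {x, y} := by
      apply Finset.eq_of_subset_of_card_le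
      · rw [← hcl]
        intro z hz
        simp at hz ⊢
        exact hz.2
      · have := Finset.card_le_two (a := x) (b := y)
        omega
    have hx : x ∈ G.neighborFinset c \ C := by rw [h4]; simp
    have hy : y ∈ G.neighborFinset c \ C := by rw [h4]; simp
    simp at hx hy
    exact ⟨hx.1, hy.1⟩
  have hC3 := hF.cyc.three_le_card
  have hcard := hthree hxC (by
    have : G.neighborFinset x ∩ C = C := by
      ext c; simp; exact fun hc => (hcxy c hc).1.symm
    rw [this]; omega)
  obtain ⟨c, c', hc, hc', hne⟩ := Finset.one_lt_card_iff.1 (by omega : 1 < C.card)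
  have hdxy : Disjoint {x, y} C := by simp [hxC, hyC]
  refine hnP (fullPair_of_forall_ne hg (q := 1) (fun r hr => ?_) (fun r hr => ?_))
  · exact hF.exists_cycle_of_ne (hunitC _) hcard (PathOn.edge hxy) hdxy hxy.ne hc hc' hne.symm
      (hcxy c hc).1.symm (hcxy c' hc').1.symm (hcxy c hc).2.symm (hwC _ _ _ hc) (hwC _ _ _ hc') (by
        rw [hwC _ _ _ hc, edgeWeight_self, add_comm]; exact hr)
  · exact hF₁.exists_cycle_of_ne (hunitC _) hcard (PathOn.edge hxy) hdxy hxy.ne hc hc' hne.symm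
      (hcxy c hc).1.symm (hcxy c' hc').1.symm (hcxy c hc).2.symm (hwC _ _ _ hc) (hwC _ _ _ hc') (by
        rw [hwC _ _ _ hc, edgeWeight_self, add_comm]; exact hr)

/-- If the special edge may have an even or an odd weight, all residues occur as cycle weights. -/
theorem KConn.fullPair (hK : KConn G 3) (hxy : G.Adj x y) (h4 : ∃ v, 4 ≤ G.degree v)
    (hdeg : ∀ v, v ≠ x → v ≠ y → 4 ≤ G.degree v) (hg₀ : 2 * g₀ = 2) (hg₁ : 2 * g₁ = 0) :
    FullPair G x y g₀ g₁ := by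
  have hg : g₀ ≠ g₁ := by rintro rfl; rw [hg₀] at hg₁; exact absurd hg₁ (by decide)
  by_cases h1 : ∃ C L, CycleOn G (edgeWeight x y g₀) C L ∧ 2 * L = 2 ∧ x ∉ C ∧ y ∉ C
  · obtain ⟨C, L, hC, hL, hx, hy⟩ := h1
    exact hK.fullPair_of_notMem hxy hdeg hg₀ hg₁ hC hL hx hy
  by_cases h2 : ∃ C L, CycleOn G (edgeWeight x y g₀) C L ∧ 2 * L = 2 ∧ x ∉ C
  · obtain ⟨C, L, hC, hL, hx⟩ := h2
    refine hK.fullPair_of_mem hxy hdeg hg (fun C L h3 h4 h5 => ?_) hC hL hx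
    by_contra h6
    exact h1 ⟨C, L, h3, h4, h5, h6⟩
  by_cases h3 : ∃ C L, CycleOn G (edgeWeight x y g₀) C L ∧ 2 * L = 2 ∧ y ∉ C
  · obtain ⟨C, L, hC, hL, hy⟩ := h3
    rw [edgeWeight_comm] at hC
    refine (hK.fullPair_of_mem hxy.symm (fun v h1 h2 => hdeg v h2 h1) hg
      (fun C L h3 h4 h5 => ?_) hC hL hy).comm
    by_contra h6
    rw [edgeWeight_comm] at h3
    exact h1 ⟨C, L, h3, h4, h6, h5⟩
  -- An odd cycle missing x or y has the same weight for every `g`, and none exists for `g₀`.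
  have hmem : ∀ g C L, CycleOn G (edgeWeight x y g) C L → 2 * L = 2 → x ∈ C ∧ y ∈ C := by
    intro g C L hC hL
    constructor
    · by_contra h
      exact h2 ⟨C, L, hC.edgeWeight (.inl h) _, hL, h⟩
    · by_contra h
      exact h3 ⟨C, L, hC.edgeWeight (.inr h) _, hL, h⟩
  obtain ⟨u, hu, huy⟩ := Finset.exists_mem_ne (by
    have := hK.three_le_degree h4 x
    rw [card_neighborFinset_eq_degree]
    omega : 1 < (G.neighborFinset x).card) y
  simp only [mem_neighborFinset] at hu
  obtain ⟨S, m, hS, hSx⟩ := ((hK.mono (by norm_num : 2 ≤ 3)).linked (X := {x}) (by simp)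
    (by simpa using hu.ne') (by simpa using hxy.ne') (v := y)).path (edgeWeight x y g₀)
  have hxS : x ∉ S := fun h => by simpa using hSx h
  have hcyc : ∀ g, CycleOn G (edgeWeight x y g) (insert x S) (1 + m + g) := by
    intro g
    have := CycleOn.of_path (PathOn.cons hu hxS (hS.edgeWeight (.inl hxS) g)) hxy.symm (by
      rw [Finset.card_insert_of_notMem hxS]
      have := hS.two_le_card huy
      omega)
    exact this.congr rfl (by
      rw [edgeWeight_of_ne_right hxy.ne huy, Sym2.eq_swap, edgeWeight_self])
  -- A cycle through the special edge is odd for one of the two weights; that weight is used.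
  rcases ZMod4.even_or_odd (1 + m) with h | h
  · exact (hK.full_of_forall_mem hxy h4 hdeg (hmem g₀) (hcyc g₀)
      (by linear_combination h + hg₀)).fullPair
  · exact (hK.full_of_forall_mem hxy h4 hdeg (hmem g₁) (hcyc g₁)
      (by linear_combination h + hg₁)).fullPair.symm

end SimpleGraph

/-! ### 2-separations and the reduction to 3-connected side graphs. -/

namespace SimpleGraph

variable {V : Type*} [DecidableEq V]

theorem CycleOn.map {M N : Type*} [AddCommMonoid M] [AddCommMonoid N] {W : Type*} [DecidableEq W]
    {G : SimpleGraph V} {G' : SimpleGraph W} {w : Sym2 V → M} {w' : Sym2 W → N} {S : Finset V}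
    {n : M} (φ : M →+ N) (f : V ↪ W) (h : CycleOn G w S n)
    (hf : ∀ u ∈ S, ∀ v ∈ S, G.Adj u v → G'.Adj (f u) (f v) ∧ w' s(f u, f v) = φ (w s(u, v))) :
    CycleOn G' w' (S.map f) (φ n) := by
  obtain ⟨a, b, m, hba, hP, hc, rfl⟩ := h
  have h1 := hf b hP.right_mem a hP.left_mem hba
  exact ⟨f a, f b, _, h1.1, hP.map φ f hf, by simpa using hc, by rw [h1.2, map_add]⟩

theorem PathOn.toSubtype {M : Type*} [AddCommMonoid M] {G : SimpleGraph V} {w : Sym2 V → M}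
    {S U : Finset V} {a b : V} {n : M} {K : SimpleGraph {v // v ∈ U}}
    {wK : Sym2 {v // v ∈ U} → M} (h : PathOn G w S a b n) (hS : S ⊆ U)
    (hK : ∀ u v : {v // v ∈ U}, u.1 ∈ S → v.1 ∈ S → G.Adj u.1 v.1 →
      K.Adj u v ∧ wK s(u, v) = w s(u.1, v.1)) (ha : a ∈ U) (hb : b ∈ U) :
    PathOn K wK (S.subtype (· ∈ U)) ⟨a, ha⟩ ⟨b, hb⟩ n := by
  induction h with
  | nil a => exact (PathOn.nil _).congr (by ext v; simp [Subtype.ext_iff]) rfl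
  | @cons S a a' b n hab haS hp ih =>
    have hS' : S ⊆ U := fun v hv => hS (by simp [hv])
    have ha' := hS' hp.left_mem
    have h1 := hK ⟨a, ha⟩ ⟨a', ha'⟩ (by simp) (by simp [hp.left_mem]) hab
    have h2 := ih hS' (fun u v hu hv => hK u v (by simp [hu]) (by simp [hv])) ha' hb
    exact (PathOn.cons h1.1 (by simpa using haS) h2).congr
      (by ext v; simp [Subtype.ext_iff]) (by rw [h1.2])

/-- `{x, y}` separates `M` from the rest of the graph. -/
structure IsSide (G : SimpleGraph V) (M : Finset V) (x y : V) : Prop where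
  nonempty : M.Nonempty
  ne : x ≠ y
  left : x ∉ M
  right : y ∉ M
  nbr : ∀ u ∈ M, ∀ v, G.Adj u v → v ∈ M ∨ v = x ∨ v = y
  outside : ∃ v, v ∉ M ∧ v ≠ x ∧ v ≠ y

/-- The graph induced on a side and its two boundary vertices, with an edge joining the latter. -/
def sideGraph (G : SimpleGraph V) (M : Finset V) (x y : V) :
    SimpleGraph {v // v ∈ insert x (insert y M)} where
  Adj u v := u ≠ v ∧ (G.Adj u.1 v.1 ∨ s(u.1, v.1) = s(x, y))
  symm := ⟨fun u v h => ⟨h.1.symm, h.2.imp (fun h => h.symm) (fun h => by rw [Sym2.eq_swap, h])⟩⟩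
  loopless := ⟨fun u h => h.1 rfl⟩

/-- The first boundary vertex of a side, as a vertex of its graph. -/
abbrev sideLeft (M : Finset V) (x y : V) : {v // v ∈ insert x (insert y M)} := ⟨x, by simp⟩

/-- The second boundary vertex of a side, as a vertex of its graph. -/
abbrev sideRight (M : Finset V) (x y : V) : {v // v ∈ insert x (insert y M)} := ⟨y, by simp⟩

namespace IsSide

variable {G : SimpleGraph V} {M S T : Finset V} {x y u v a b : V} {g r n : ZMod 4}

omit [DecidableEq V] in
theorem symm (h : IsSide G M x y) : IsSide G M y x :=
  ⟨h.nonempty, h.ne.symm, h.right, h.left, fun u hu v huv => (h.nbr u hu v huv).imp id Or.symm,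
    h.outside.imp fun _ h => ⟨h.1, h.2.2, h.2.1⟩⟩

omit [DecidableEq V] in
theorem exists_nbr_left (h : IsSide G M x y) (hK : KConn G 2) : ∃ m ∈ M, G.Adj m x := by
  by_contra hcon
  push Not at hcon
  have := hK M {y} h.nonempty (by
    intro u hu v huv
    rcases h.nbr u hu v huv with h1 | rfl | rfl
    · exact .inl h1
    · exact absurd huv (hcon u hu)
    · exact .inr (by simp)) ⟨x, h.left, by simpa using h.ne⟩
  simp at this

omit [DecidableEq V] in
theorem exists_nbr_right (h : IsSide G M x y) (hK : KConn G 2) : ∃ m ∈ M, G.Adj m y :=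
  h.symm.exists_nbr_left hK

theorem adj_iff {u v : {v // v ∈ insert x (insert y M)}} (h : s(u, v) ≠ s(sideLeft M x y, sideRight M x y)) :
    (sideGraph G M x y).Adj u v ↔ G.Adj u.1 v.1 := by
  have h' : s(u.1, v.1) ≠ s(x, y) := by
    intro e
    apply h
    rcases Sym2.eq_iff.1 e with ⟨h1, h2⟩ | ⟨h1, h2⟩
    · exact Sym2.eq_iff.2 (.inl ⟨Subtype.ext h1, Subtype.ext h2⟩)
    · exact Sym2.eq_iff.2 (.inr ⟨Subtype.ext h1, Subtype.ext h2⟩)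
  simp only [sideGraph, h', or_false]
  exact ⟨fun h => h.2, fun h => ⟨fun e => h.ne (by rw [e]), h⟩⟩

theorem adj_left_right (h : IsSide G M x y) :
    (sideGraph G M x y).Adj (sideLeft M x y) (sideRight M x y) :=
  ⟨fun e => h.ne (Subtype.ext_iff.1 e), .inr rfl⟩

/-- Cycles of the side graph lift along a path outside the side. -/
theorem lift (h : IsSide G M x y) (hS : PathOn G (fun _ => (1 : ZMod 4)) S x y g)
    (hSM : Disjoint S M) {T : Finset {v // v ∈ insert x (insert y M)}}
    (hT : CycleOn (sideGraph G M x y) (edgeWeight (sideLeft M x y) (sideRight M x y) g) T r) :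
    ∃ T', CycleOn G (fun _ => (1 : ZMod 4)) T' r := by
  have hadj : ∀ u v, ((sideGraph G M x y).deleteEdges {s(sideLeft M x y, sideRight M x y)}).Adj u v →
      G.Adj u.1 v.1 ∧ (1 : ZMod 4) =
        edgeWeight (sideLeft M x y) (sideRight M x y) g s(u, v) := by
    intro u v huv
    rw [deleteEdges_adj, Set.mem_singleton_iff] at huv
    exact ⟨(adj_iff huv.2).1 huv.1, (edgeWeight_of_ne huv.2).symm⟩
  have h3 := hT.three_le_card
  rcases hT.deleteEdge (sideLeft M x y) (sideRight M x y) with hT | ⟨m, -, hP, rfl⟩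
  · exact ⟨_, hT.map (AddMonoidHom.id _) (Function.Embedding.subtype _)
      (fun u _ v _ huv => hadj u v huv)⟩
  · have hP' : PathOn G (fun _ => (1 : ZMod 4)) (T.map (Function.Embedding.subtype _)) x y m :=
      hP.map (AddMonoidHom.id _) (Function.Embedding.subtype _) (fun u _ v _ huv => hadj u v huv)
    rw [edgeWeight_self]
    refine ⟨_, CycleOn.of_paths hP' hS ?_ h.ne ?_⟩
    · intro v hv hvS
      obtain ⟨u, -, rfl⟩ := Finset.mem_map.1 hv
      have := u.2
      simp only [Finset.mem_insert] at this
      rcases this with h1 | h1 | h1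
      · exact .inl h1
      · exact .inr h1
      · exact absurd h1 (Finset.disjoint_left.1 hSM hvS)
    · calc 3 ≤ T.card := h3
        _ = (T.map (Function.Embedding.subtype _)).card := by simp
        _ ≤ _ := Finset.card_le_card Finset.subset_union_left

/-- A path from `M` that avoids `x` and ends in `y` stays in the side. -/
theorem subset_of_path {M' : Type*} [AddCommMonoid M'] {w : Sym2 V → M'} {n : M'}
    (h : IsSide G M x y) (hS : PathOn G w S a y n) (ha : a ∈ M) (hx : x ∉ S) :
    S ⊆ insert y M := by
  obtain ⟨b, T, m, h1, h2, h3, rfl, rfl⟩ := hS.last (fun e => h.right (e ▸ ha))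
  refine Finset.insert_subset_insert y (h3.subset_of_closed (U := T) ?_ ha subset_rfl)
  intro u hu v hv huv
  rcases h.nbr u hu v huv with h4 | rfl | rfl
  · exact h4
  · exact absurd (by simp [hv]) hx
  · exact absurd hv h2

theorem compl [Fintype V] (h : IsSide G M x y) : IsSide G (insert x (insert y M))ᶜ x y := by
  obtain ⟨o, h1, h2, h3⟩ := h.outside
  obtain ⟨m, hm⟩ := h.nonempty
  refine ⟨⟨o, by simp [h1, h2, h3]⟩, h.ne, by simp, by simp, ?_, ⟨m, by simp [hm], ?_, ?_⟩⟩
  · intro u hu v huv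
    simp only [Finset.mem_compl, Finset.mem_insert, not_or] at hu ⊢
    by_contra hcon
    push Not at hcon
    have hv : v ∈ M := by
      by_contra hv
      exact hcon.2.2 (by
        have := hcon.1 hcon.2.1
        tauto)
    rcases h.nbr v hv u huv.symm with h4 | h4 | h4
    · exact hu.2.2 h4
    · exact hu.1 h4
    · exact hu.2.1 h4
  · rintro rfl; exact h.left hm
  · rintro rfl; exact h.right hm

variable [Fintype V]

/-- Through an odd cycle outside the side its boundary vertices are joined by paths of both
parities. -/
theorem exists_paths (h : IsSide G M x y) (hK : KConn G 2) {C : Finset V} {L : ZMod 4}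
    (hC : CycleOn G (fun _ => (1 : ZMod 4)) C L) (hL : 2 * L = 2) (hCM : Disjoint C M) :
    ∃ S₀ S₁ g₀ g₁, PathOn G (fun _ => (1 : ZMod 4)) S₀ x y g₀ ∧
      PathOn G (fun _ => (1 : ZMod 4)) S₁ x y g₁ ∧ Disjoint S₀ M ∧ Disjoint S₁ M ∧ 2 * g₀ = 2 ∧
      2 * g₁ = 0 := by
  let G' : SimpleGraph V :=
    { Adj := fun u v => G.Adj u v ∧ u ∉ M ∧ v ∉ M
      symm := ⟨fun u v h => ⟨h.1.symm, h.2.2, h.2.1⟩⟩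
      loopless := ⟨fun u h => G.loopless.irrefl u h.1⟩ }
  have hsub : ∀ {S : Finset V} {a b n}, PathOn G' (fun _ => (1 : ZMod 4)) S a b n → a ∉ M →
      Disjoint S M := by
    intro S a b n h ha
    have := h.subset_of_closed (W := Mᶜ) (U := Finset.univ)
      (fun u hu v _ huv => by simpa using huv.2.2) (by simpa using ha) (Finset.subset_univ _)
    rw [Finset.disjoint_left]
    intro z hz; simpa using this hz
  have hxyC : ({x, y} : Finset V).card = 2 := Finset.card_pair h.ne
  obtain ⟨T, f, P, t1, t2, t3, t4⟩ := menger (fun _ => (1 : ZMod 4)) 2 G' {x, y} C (by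
    intro X hX
    by_contra hlt
    obtain ⟨a, ha, haX⟩ := Finset.exists_mem_notMem_of_card_lt_card (s := X) (t := {x, y})
      (by omega)
    obtain ⟨c, hc, hcX⟩ := Finset.exists_mem_notMem_of_card_lt_card (s := X) (t := C)
      (by have := hC.three_le_card; omega)
    have hcM := Finset.disjoint_left.1 hCM hc
    obtain ⟨S, n, hS, hSX⟩ := hK.linked (by omega : X.card < 2) hcX haX
    -- A path starting outside M can enter M only through x or y, so up to its first hit of {x, y}
    -- it stays outside.
    obtain ⟨S', n', a', e1, e2, e3, e4⟩ := hS.firstHit (B := {x, y}) ⟨a, hS.right_mem, ha⟩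
    have hS'X : S' ⊆ Xᶜ := e2.trans hSX
    have hS'M : ∀ z ∈ S', z ∉ M := by
      by_cases hca : c = a'
      · subst hca
        rw [e1.eq_singleton.1]
        intro z hz
        rw [Finset.mem_singleton.1 hz]
        exact hcM
      obtain ⟨p, R, m, k1, k2, k3, rfl, rfl⟩ := e1.last hca
      have hRxy : ∀ v ∈ R, v ∉ ({x, y} : Finset V) := fun v hv h =>
        k2 (e4 v (by simp [hv]) h ▸ hv)
      have hR : R ⊆ (insert x (insert y M))ᶜ := k3.subset_of_closed (U := R) (by
        intro u hu v hv huv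
        have hvn := hRxy v hv
        simp only [Finset.mem_compl, Finset.mem_insert, Finset.mem_singleton, not_or] at hu hvn ⊢
        refine ⟨hvn.1, hvn.2, fun hvM => ?_⟩
        rcases h.nbr v hvM u huv.symm with h4 | h4 | h4
        exacts [hu.2.2 h4, hu.1 h4, hu.2.1 h4]) (by
          have := hRxy c k3.left_mem
          simp only [Finset.mem_compl, Finset.mem_insert, Finset.mem_singleton, not_or] at this ⊢
          exact ⟨this.1, this.2, hcM⟩) subset_rfl
      intro z hz
      rcases Finset.mem_insert.1 hz with rfl | hz
      · simp at e3
        rcases e3 with rfl | rfl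
        exacts [h.left, h.right]
      · have := hR hz
        simp only [Finset.mem_compl, Finset.mem_insert, not_or] at this
        exact this.2.2
    refine hX a' e3 c hc (Linked.symm (.of_path (w := fun _ => (1 : ℕ)) (e1.graphMap ?_) hS'X))
    exact fun u hu v hv huv => ⟨huv, hS'M u hu, hS'M v hv⟩)
  have hT : T = {x, y} := Finset.eq_of_subset_of_card_le t2 (by rw [t1, hxyC])
  subst hT
  obtain ⟨hfx, p, hp⟩ := t3 x (by simp)
  obtain ⟨hfy, q, hq⟩ := t3 y (by simp)
  have hd := t4 x (by simp) y (by simp) h.ne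
  have hpM := hsub hp h.left
  have hqM := hsub hq h.right
  replace hp := hp.graphMap (G' := G) (fun _ _ _ _ h => h.1)
  replace hq := hq.graphMap (G' := G) (fun _ _ _ _ h => h.1)
  obtain ⟨A, a, c, a1, a2, a3, a4⟩ := hp.firstHit ⟨_, hp.right_mem, hfx⟩
  obtain ⟨B, b, d, b1, b2, b3, b4⟩ := hq.firstHit ⟨_, hq.right_mem, hfy⟩
  have hAB : Disjoint A B := hd.mono a2 b2
  have hcd : c ≠ d := fun e => Finset.disjoint_left.1 hAB a1.right_mem (e ▸ b1.right_mem)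
  obtain ⟨X₁, X₂, n₁, n₂, k1, k2, k3, -, k5⟩ := hC.arcs a3 b3 hcd
  have hpath : ∀ {X m}, PathOn G (fun _ => (1 : ZMod 4)) X c d m → X ⊆ C →
      PathOn G (fun _ => (1 : ZMod 4)) (A ∪ (X ∪ B)) x y (a + (m + b)) ∧
        Disjoint (A ∪ (X ∪ B)) M := by
    intro X m hX hXC
    refine ⟨a1.append (hX.append b1.reverse ?_) ?_, ?_⟩
    · intro z hz hz'
      exact b4 z hz' (hXC hz)
    · intro z hz hz'
      rcases Finset.mem_union.1 hz' with h | h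
      · exact a4 z hz (hXC h)
      · exact absurd h (Finset.disjoint_left.1 hAB hz)
    · rw [Finset.disjoint_union_left, Finset.disjoint_union_left]
      exact ⟨hpM.mono_left a2, hCM.mono_left hXC, hqM.mono_left b2⟩
  obtain ⟨p1, p2⟩ := hpath k1 (by rw [← k3]; exact Finset.subset_union_left)
  obtain ⟨p3, p4⟩ := hpath k2 (by rw [← k3]; exact Finset.subset_union_right)
  rw [k5] at hL
  -- The two routes differ by the two arcs of an odd cycle, so one is odd and the other even.
  rcases ZMod4.even_or_odd (a + (n₁ + b)) with e | e
  · exact ⟨_, _, _, _, p3, p1, p4, p2, by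
      linear_combination hL - e + (a + b) * ZMod4.four_eq_zero, e⟩
  · exact ⟨_, _, _, _, p1, p3, p2, p4, e, by
      linear_combination hL - e + (a + b) * ZMod4.four_eq_zero⟩

variable [DecidableRel G.Adj]

/-- Since x and y are adjacent in the side graph, a separation by at most two vertices leaves a part
containing neither. That part would be a side of G properly inside M. -/
theorem kconn (h : IsSide G M x y) (hK : KConn G 2) (hdeg : ∀ v, 4 ≤ G.degree v)
    (hmin : ∀ M' x' y', IsSide G M' x' y' → M' ⊆ M → M' = M) : KConn (sideGraph G M x y) 3 := by
  intro A Z hA hbd ho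
  by_contra hlt
  -- Minimality gives D = M, and then Z together with `e` would be three distinct vertices among x
  -- and y.
  have key : ∀ D : Finset {v // v ∈ insert x (insert y M)}, D.Nonempty → sideLeft M x y ∉ D →
      sideRight M x y ∉ D → Disjoint D Z →
      (∀ u ∈ D, ∀ v, (sideGraph G M x y).Adj u v → v ∈ D ∨ v ∈ Z) → (∃ e, e ∉ D ∧ e ∉ Z) →
      False := by
    intro D hD hx hy hDZ hnb ⟨e, heD, heZ⟩
    have hDM : ∀ u ∈ D, u.1 ∈ M := by
      intro u hu
      have := u.2
      simp only [Finset.mem_insert] at this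
      rcases this with h1 | h1 | h1
      · exact absurd (by rwa [show u = sideLeft M x y from Subtype.ext h1] at hu) hx
      · exact absurd (by rwa [show u = sideRight M x y from Subtype.ext h1] at hu) hy
      · exact h1
    have hbd' : ∀ u ∈ D.map (Function.Embedding.subtype _), ∀ v, G.Adj u v →
        v ∈ D.map (Function.Embedding.subtype _) ∨ v ∈ Z.map (Function.Embedding.subtype _) := by
      intro u hu v huv
      obtain ⟨u, huD, rfl⟩ := Finset.mem_map.1 hu
      have hv : v ∈ insert x (insert y M) := by
        rcases h.nbr u.1 (hDM u huD) v huv with h1 | h1 | h1 <;> simp [h1]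
      have := hnb u huD ⟨v, hv⟩ ⟨fun e => huv.ne (congrArg Subtype.val e), .inl huv⟩
      rcases this with h1 | h1
      · exact .inl (Finset.mem_map.2 ⟨_, h1, rfl⟩)
      · exact .inr (Finset.mem_map.2 ⟨_, h1, rfl⟩)
    have h2 := hK _ _ (by simpa using hD) hbd' ⟨e.1, by simpa using heD, by simpa using heZ⟩
    rw [Finset.card_map] at h2
    obtain ⟨z₁, z₂, hz, rfl⟩ := Finset.card_eq_two.1 (by omega : Z.card = 2)
    have hside : IsSide G (D.map (Function.Embedding.subtype _)) z₁.1 z₂.1 := by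
      refine ⟨by simpa using hD, fun e => hz (Subtype.ext e), ?_, ?_, ?_, ⟨e.1, ?_, ?_, ?_⟩⟩
      · have := Finset.disjoint_right.1 hDZ (by simp : z₁ ∈ _)
        simpa using this
      · have := Finset.disjoint_right.1 hDZ (by simp : z₂ ∈ _)
        simpa using this
      · intro u hu v huv
        refine (hbd' u hu v huv).imp id ?_
        simp
      · simpa using heD
      · intro e'; exact heZ (by simp [Subtype.ext e'])
      · intro e'; exact heZ (by simp [Subtype.ext e'])
    have hDM' : D.map (Function.Embedding.subtype _) = M := hmin _ _ _ hside (by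
      intro u hu
      obtain ⟨u, huD, rfl⟩ := Finset.mem_map.1 hu
      exact hDM u huD)
    have hnot : ∀ u : {v // v ∈ insert x (insert y M)}, u ∉ D → u.1 = x ∨ u.1 = y := by
      intro u hu
      have h1 := u.2
      simp only [Finset.mem_insert] at h1
      rcases h1 with h1 | h1 | h1
      · exact .inl h1
      · exact .inr h1
      · have h2 := hDM'.ge h1
        exact absurd (by simpa using h2) hu
    have hz1 := hnot z₁ (Finset.disjoint_right.1 hDZ (by simp))
    have hz2 := hnot z₂ (Finset.disjoint_right.1 hDZ (by simp))
    have he := hnot e heD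
    replace hz : z₁.1 ≠ z₂.1 := fun e => hz (Subtype.ext e)
    simp only [Finset.mem_insert, Finset.mem_singleton, Subtype.ext_iff] at heZ
    rcases hz1 with h1 | h1 <;> rcases hz2 with h2 | h2 <;> rcases he with h3 | h3 <;>
      rw [h1, h2, h3] at heZ <;> rw [h1, h2] at hz <;> tauto
  obtain ⟨o, hoA, hoZ⟩ := ho
  -- If A were inside Z, a vertex of A together with two of its neighbours would give three vertices
  -- in Z.
  have hA' : (A \ Z).Nonempty := by
    by_contra hempty
    rw [Finset.not_nonempty_iff_eq_empty, Finset.sdiff_eq_empty_iff_subset] at hempty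
    obtain ⟨u, hu⟩ := hA
    have htwo : ∃ p q, p ≠ q ∧ (sideGraph G M x y).Adj u p ∧ (sideGraph G M x y).Adj u q := by
      have hin : ∀ m ∈ M, ∃ m' : {v // v ∈ insert x (insert y M)}, m'.1 = m :=
        fun m hm => ⟨⟨m, by simp [hm]⟩, rfl⟩
      have hu' := u.2
      simp only [Finset.mem_insert] at hu'
      rcases hu' with h1 | h1 | h1
      · obtain ⟨m, hm, hmx⟩ := h.exists_nbr_left hK
        obtain rfl : u = sideLeft M x y := Subtype.ext h1
        refine ⟨sideRight M x y, ⟨m, by simp [hm]⟩, ?_, h.adj_left_right, ?_, .inl hmx.symm⟩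
        · intro e
          exact h.right ((show y = m from congrArg Subtype.val e).symm ▸ hm)
        · intro e
          exact h.left ((show x = m from congrArg Subtype.val e).symm ▸ hm)
      · obtain ⟨m, hm, hmy⟩ := h.exists_nbr_right hK
        obtain rfl : u = sideRight M x y := Subtype.ext h1
        refine ⟨sideLeft M x y, ⟨m, by simp [hm]⟩, ?_, h.adj_left_right.symm, ?_, .inl hmy.symm⟩
        · intro e
          exact h.left ((show x = m from congrArg Subtype.val e).symm ▸ hm)
        · intro e
          exact h.right ((show y = m from congrArg Subtype.val e).symm ▸ hm)
      · obtain ⟨p, q, hp, hq, hpq⟩ := Finset.one_lt_card_iff.1 (by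
          rw [card_neighborFinset_eq_degree]; have := hdeg u.1; omega :
            1 < (G.neighborFinset u.1).card)
        simp only [mem_neighborFinset] at hp hq
        have hW : ∀ p, G.Adj u.1 p → p ∈ insert x (insert y M) := by
          intro p hp
          rcases h.nbr u.1 h1 p hp with h2 | h2 | h2 <;> simp [h2]
        refine ⟨⟨p, hW p hp⟩, ⟨q, hW q hq⟩, fun e => hpq (congrArg Subtype.val e), ⟨?_, .inl hp⟩,
          ⟨?_, .inl hq⟩⟩
        · intro e; exact hp.ne (congrArg Subtype.val e)
        · intro e; exact hq.ne (congrArg Subtype.val e)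
    obtain ⟨p, q, hpq, hp, hq⟩ := htwo
    have hZ : ∀ v, (sideGraph G M x y).Adj u v → v ∈ Z := fun v hv =>
      (hbd u hu v hv).elim (fun h => hempty h) id
    have hsub : ({u, p, q} : Finset _) ⊆ Z := by
      intro z hz
      simp only [Finset.mem_insert, Finset.mem_singleton] at hz
      rcases hz with rfl | rfl | rfl
      exacts [hempty hu, hZ _ hp, hZ _ hq]
    have := Finset.card_le_card hsub
    rw [Finset.card_eq_three.2 ⟨u, p, q, hp.ne, hq.ne, hpq, rfl⟩] at this
    omega
  have hbdA : ∀ u ∈ A \ Z, ∀ v, (sideGraph G M x y).Adj u v → v ∈ A \ Z ∨ v ∈ Z := by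
    intro u hu v huv
    by_cases hv : v ∈ Z
    · exact .inr hv
    · exact .inl (by simpa [hv] using (hbd u (Finset.mem_sdiff.1 hu).1 v huv).resolve_right hv)
  by_cases hxy : sideLeft M x y ∈ A \ Z ∨ sideRight M x y ∈ A \ Z
  · obtain ⟨a, ha⟩ := hA'
    have hxy' : ∀ p ∈ ({sideLeft M x y, sideRight M x y} : Finset _), p ∈ A ∪ Z := by
      have hadj := h.adj_left_right
      intro p hp
      simp only [Finset.mem_insert, Finset.mem_singleton] at hp
      have hAZ : ∀ p, p ∈ A \ Z ∨ p ∈ Z → p ∈ A ∪ Z := by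
        intro p hp; simp at hp ⊢; tauto
      apply hAZ
      rcases hxy with h1 | h1 <;> rcases hp with rfl | rfl
      exacts [.inl h1, hbdA _ h1 _ hadj, hbdA _ h1 _ hadj.symm, .inl h1]
    refine key (A ∪ Z)ᶜ ⟨o, by simp [hoA, hoZ]⟩ ?_ ?_ ?_ ?_ ⟨a, ?_, ?_⟩
    · exact Finset.notMem_compl.2 (hxy' (sideLeft M x y) (by simp))
    · exact Finset.notMem_compl.2 (hxy' (sideRight M x y) (by simp))
    · rw [Finset.disjoint_left]; intro z hz hz'; simp [hz'] at hz
    · intro u hu v huv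
      by_contra hcon
      simp only [Finset.mem_compl, Finset.mem_union, not_or, not_and, not_not] at hu hcon
      have hv : v ∈ A \ Z := by simp; tauto
      rcases hbdA v hv u huv.symm with h1 | h1
      · exact hu.1 (Finset.mem_sdiff.1 h1).1
      · exact hu.2 h1
    · simp [(Finset.mem_sdiff.1 ha).1]
    · exact (Finset.mem_sdiff.1 ha).2
  · push Not at hxy
    exact key (A \ Z) hA' hxy.1 hxy.2 Finset.sdiff_disjoint hbdA
      ⟨o, by simp [hoA], hoZ⟩

theorem degree_sideGraph (h : IsSide G M x y) (hdeg : ∀ v, 4 ≤ G.degree v)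
    [DecidableRel (sideGraph G M x y).Adj] (v : {v // v ∈ insert x (insert y M)}) (hv : v.1 ∈ M) :
    4 ≤ (sideGraph G M x y).degree v := by
  refine (hdeg v.1).trans ?_
  rw [← card_neighborFinset_eq_degree, ← card_neighborFinset_eq_degree,
    ← Finset.card_map (Function.Embedding.subtype _)]
  apply Finset.card_le_card
  intro u hu
  simp only [mem_neighborFinset] at hu
  have huW : u ∈ insert x (insert y M) := by
    rcases h.nbr v.1 hv u hu with h2 | h2 | h2 <;> simp [h2]
  refine Finset.mem_map.2 ⟨⟨u, huW⟩, ?_, rfl⟩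
  simp only [mem_neighborFinset]
  exact ⟨fun e => hu.ne (congrArg Subtype.val e), .inl hu⟩

omit [Fintype V] in
theorem mem_of_ne {v : {v // v ∈ insert x (insert y M)}} (hx : v ≠ sideLeft M x y)
    (hy : v ≠ sideRight M x y) : v.1 ∈ M := by
  have := v.2
  simp only [Finset.mem_insert] at this
  rcases this with h1 | h1 | h1
  · exact absurd (Subtype.ext h1) hx
  · exact absurd (Subtype.ext h1) hy
  · exact h1

/-- The odd cycle outside M supplies x-y paths of both parities, whose weights serve as the two
weights of the special edge; cycles of either kind lift to G. -/
theorem full_of_odd_cycle (h : IsSide G M x y) (hK : KConn G 2) (hdeg : ∀ v, 4 ≤ G.degree v)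
    (hmin : ∀ M' x' y', IsSide G M' x' y' → M' ⊆ M → M' = M) {C : Finset V} {L : ZMod 4}
    (hC : CycleOn G (fun _ => (1 : ZMod 4)) C L) (hL : 2 * L = 2) (hCM : Disjoint C M) :
    Full G (fun _ => 1) := by
  classical
  obtain ⟨S₀, S₁, g₀, g₁, h1, h2, h3, h4, h5, h6⟩ := h.exists_paths hK hC hL hCM
  obtain ⟨m, hm⟩ := h.nonempty
  have := (h.kconn hK hdeg hmin).fullPair h.adj_left_right
    ⟨⟨m, by simp [hm]⟩, h.degree_sideGraph hdeg _ hm⟩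
    (fun v hx hy => h.degree_sideGraph hdeg v (mem_of_ne hx hy)) h5 h6
  intro r
  rcases this r with ⟨T, hT⟩ | ⟨T, hT⟩
  · exact h.lift h1 h3 hT
  · exact h.lift h2 h4 hT

/-- The case of a side on which, together with its boundary, there is no odd cycle. -/
theorem full_of_forall_not (h : IsSide G M x y) (hK : KConn G 2) (hdeg : ∀ v, 4 ≤ G.degree v)
    (hmin : ∀ M' x' y', IsSide G M' x' y' → M' ⊆ M → M' = M)
    (hin : ∀ C L, CycleOn G (fun _ => (1 : ZMod 4)) C L → 2 * L = 2 → ¬ C ⊆ insert x (insert y M))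
    (hout : ∀ C L, CycleOn G (fun _ => (1 : ZMod 4)) C L → 2 * L = 2 → ¬ Disjoint C M)
    {C : Finset V} {L : ZMod 4} (hC : CycleOn G (fun _ => (1 : ZMod 4)) C L) (hL : 2 * L = 2) :
    Full G (fun _ => 1) := by
  classical
  obtain ⟨m, hmC, hmM⟩ := Finset.not_disjoint_iff.1 (hout C L hC hL)
  obtain ⟨o, hoC, hoM⟩ := Finset.not_subset.1 (hin C L hC hL)
  simp only [Finset.mem_insert, not_or] at hoM
  have hmo : m ≠ o := fun e => hoM.2.2 (e ▸ hmM)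
  have hcross : ∀ {S n}, PathOn G (fun _ => (1 : ZMod 4)) S m o n → x ∈ S ∨ y ∈ S := by
    intro S n hS
    by_contra hcon
    push Not at hcon
    have := hS.subset_of_closed (U := S) (W := M) (by
      intro u hu v hv huv
      rcases h.nbr u hu v huv with h1 | rfl | rfl
      exacts [h1, absurd hv hcon.1, absurd hv hcon.2]) hmM subset_rfl hS.right_mem
    exact hoM.2.2 this
  obtain ⟨X₁, X₂, n₁, n₂, k1, k2, k3, k4, -⟩ := hC.arcs hmC hoC hmo
  have hxm : x ≠ m := fun e => h.left (e ▸ hmM)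
  have hym : y ≠ m := fun e => h.right (e ▸ hmM)
  -- Both arcs between `m` and `o` must cross {x, y}, and the arcs share only their ends.
  have hboth : x ∈ C ∧ y ∈ C := by
    rw [← k3]
    simp only [Finset.mem_union]
    have e1 := hcross k1
    have e2 := hcross k2
    have e3 := k4 x
    have e4 := k4 y
    have e5 := hoM.1
    have e6 := hoM.2.1
    by_cases hx1 : x ∈ X₁ <;> by_cases hx2 : x ∈ X₂
    · rcases e3 hx1 hx2 with e | e
      exacts [absurd e hxm, absurd e.symm e5]
    · exact ⟨.inl hx1, .inr (e2.resolve_left hx2)⟩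
    · exact ⟨.inr hx2, .inl (e1.resolve_left hx1)⟩
    · rcases e4 (e1.resolve_left hx1) (e2.resolve_left hx2) with e | e
      exacts [absurd e hym, absurd e.symm e6]
  obtain ⟨hxC, hyC⟩ := hboth
  -- A path that has already used x and y as its ends cannot leave the side again.
  have hinner : ∀ {S n}, PathOn G (fun _ => (1 : ZMod 4)) S x y n → (∃ z ∈ S, z ∈ M) →
      S ⊆ insert x (insert y M) := by
    rintro S n hS ⟨z, hzS, hzM⟩
    obtain ⟨A, B, a, b, l1, l2, rfl, l4, -⟩ := hS.split hzS
    have hxB : x ∉ B := fun e => h.left ((l4 x l1.left_mem e) ▸ hzM)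
    have hyA : y ∉ A := fun e => h.right ((l4 y e l2.right_mem) ▸ hzM)
    have e1 := h.subset_of_path l2 hzM hxB
    have e2 := h.symm.subset_of_path l1.reverse hzM hyA
    intro v hv
    rcases Finset.mem_union.1 hv with hv | hv
    · have := e2 hv
      simp only [Finset.mem_insert] at this ⊢
      tauto
    · have := e1 hv
      simp only [Finset.mem_insert] at this ⊢
      tauto
  have main : ∀ {Y₁ Y₂ p q}, PathOn G (fun _ => (1 : ZMod 4)) Y₁ x y p →
      PathOn G (fun _ => (1 : ZMod 4)) Y₂ x y q → Y₁ ∪ Y₂ = C → L = p + q → m ∈ Y₁ →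
      Full G (fun _ => 1) := by
    intro Y₁ Y₂ p q h1 h2 h3 h4 hm
    have hY1 := hinner h1 ⟨m, hm, hmM⟩
    have hoY2 : o ∈ Y₂ := by
      rw [← h3] at hoC
      refine (Finset.mem_union.1 hoC).resolve_left fun h => ?_
      have := hY1 h
      simp only [Finset.mem_insert] at this
      tauto
    have hY2 : Disjoint Y₂ M := by
      rw [Finset.disjoint_left]
      intro z hz hzM
      have := hinner h2 ⟨z, hz, hzM⟩ hoY2
      simp only [Finset.mem_insert] at this
      tauto
    -- the inner arc closes up to an odd cycle of the side graph
    obtain ⟨u, T, p', e1, e2, e3, rfl, rfl⟩ := h1.first h.ne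
    have hTU : T ⊆ insert x (insert y M) := fun v hv => hY1 (by simp [hv])
    have huy : u ≠ y := by
      rintro rfl
      rw [e3.eq_singleton.1] at hm
      simp only [Finset.mem_insert, Finset.mem_singleton] at hm
      rcases hm with rfl | rfl
      exacts [hxm rfl, hym rfl]
    have huU := hTU e3.left_mem
    have hT := e3.toSubtype (K := sideGraph G M x y)
      (wK := edgeWeight (sideLeft M x y) (sideRight M x y) q) hTU (by
        intro a b ha hb hab
        refine ⟨⟨fun e => hab.ne (congrArg Subtype.val e), .inl hab⟩, edgeWeight_of_ne_left ?_ ?_⟩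
        · rintro rfl; exact e2 ha
        · rintro rfl; exact e2 hb) huU (by simp)
    have hxu : (sideGraph G M x y).Adj (sideLeft M x y) ⟨u, huU⟩ :=
      ⟨fun e => e1.ne (congrArg Subtype.val e), .inl e1⟩
    have hxT : sideLeft M x y ∉ T.subtype (· ∈ insert x (insert y M)) := by simpa using e2
    have hcyc := CycleOn.of_path (PathOn.cons hxu hxT hT) h.adj_left_right.symm (by
      rw [Finset.card_insert_of_notMem hxT]
      have := hT.two_le_card (fun e => huy (congrArg Subtype.val e))
      omega)
    rw [edgeWeight_of_ne_right (fun e => h.ne (congrArg Subtype.val e))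
      (fun e => huy (congrArg Subtype.val e)), Sym2.eq_swap, edgeWeight_self] at hcyc
    obtain ⟨m', hm'⟩ := h.nonempty
    -- The special edge gets the weight of the outer arc. An odd cycle of the side graph missing x
    -- or y would be an odd cycle of G inside the side and its boundary, which `hin` excludes.
    have hfull := (h.kconn hK hdeg hmin).full_of_forall_mem h.adj_left_right
      ⟨⟨m', by simp [hm']⟩, h.degree_sideGraph hdeg _ hm'⟩
      (fun v hx hy => h.degree_sideGraph hdeg v (mem_of_ne hx hy)) (g := q) (by
        intro C' L' hC' hL'
        by_contra hcon
        have hcon' : sideLeft M x y ∉ C' ∨ sideRight M x y ∉ C' := by tauto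
        have hne : ∀ a ∈ C', ∀ b ∈ C', s(a, b) ≠ s(sideLeft M x y, sideRight M x y) := by
          intro a ha b hb e
          rcases Sym2.eq_iff.1 e with ⟨rfl, rfl⟩ | ⟨rfl, rfl⟩ <;> tauto
        refine hin _ L' (hC'.map (AddMonoidHom.id _) (Function.Embedding.subtype _)
          (fun a ha b hb hab => ⟨(adj_iff (hne a ha b hb)).1 hab,
            (edgeWeight_of_ne (hne a ha b hb)).symm⟩)) hL' ?_
        intro v hv
        obtain ⟨v, -, rfl⟩ := Finset.mem_map.1 hv
        exact v.2) hcyc (by rw [← h4]; exact hL)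
    intro r
    obtain ⟨T', hT'⟩ := hfull r
    exact h.lift h2 hY2 hT'
  obtain ⟨Y₁, Y₂, p, q, l1, l2, l3, -, l5⟩ := hC.arcs hxC hyC h.ne
  rw [← l3] at hmC
  rcases Finset.mem_union.1 hmC with hm | hm
  · exact main l1 l2 l3 l5 hm
  · exact main l2 l1 (by rw [Finset.union_comm, l3]) (by rw [l5, add_comm]) hm

omit [DecidableRel G.Adj] in
theorem exists_min (h : IsSide G M x y) (U : Finset V) (hU : M ⊆ U) :
    ∃ M' x' y', IsSide G M' x' y' ∧ M' ⊆ U ∧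
      ∀ M'' x'' y'', IsSide G M'' x'' y'' → M'' ⊆ M' → M'' = M' := by
  classical
  obtain ⟨M', hM', hmin⟩ := Finset.exists_min_image
    (Finset.univ.filter fun M' : Finset V => M' ⊆ U ∧ ∃ x y, IsSide G M' x y) Finset.card
    ⟨M, by simpa using ⟨hU, x, y, h⟩⟩
  simp only [Finset.mem_filter, Finset.mem_univ, true_and] at hM' hmin
  obtain ⟨h1, x', y', h2⟩ := hM'
  exact ⟨M', x', y', h2, h1, fun M'' x'' y'' h3 h4 =>
    Finset.eq_of_subset_of_card_le h4 (hmin M'' ⟨h4.trans h1, x'', y'', h3⟩)⟩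

end IsSide

/-- A 2-connected graph of minimum degree four with an odd cycle has cycles of all lengths modulo
four unless it is the complete graph on five vertices. -/
theorem full_or_complete [Fintype V] {G : SimpleGraph V} [DecidableRel G.Adj] (hK : KConn G 2)
    (hdeg : ∀ v, 4 ≤ G.degree v) {C : Finset V} {L : ZMod 4}
    (hC : CycleOn G (fun _ => (1 : ZMod 4)) C L) (hL : 2 * L = 2) :
    Full G (fun _ => 1) ∨ (Fintype.card V = 5 ∧ ∀ u v, u ≠ v → G.Adj u v) := by
  by_cases hK3 : KConn G 3
  · exact hK3.full_or_complete hdeg hC hL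
  left
  have hside : ∃ M x y, IsSide G M x y := by
    unfold KConn at hK3
    push Not at hK3
    obtain ⟨M, X, hM, hbd, ⟨o, hoM, hoX⟩, hX⟩ := hK3
    have h2 := hK M X hM hbd ⟨o, hoM, hoX⟩
    obtain ⟨x, y, hxy, rfl⟩ := Finset.card_eq_two.1 (by omega : X.card = 2)
    simp only [Finset.mem_insert, Finset.mem_singleton, not_or] at hoX
    -- The set M of a separation may overlap its boundary. Minimum degree four keeps it nonempty
    -- after removing the two boundary vertices.
    refine ⟨M \ {x, y}, x, y, ?_, hxy, by simp, by simp, ?_, ⟨o, by simp [hoM], hoX.1, hoX.2⟩⟩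
    · by_contra hempty
      rw [Finset.not_nonempty_iff_eq_empty, Finset.sdiff_eq_empty_iff_subset] at hempty
      obtain ⟨u, hu⟩ := hM
      have h3 : G.neighborFinset u ⊆ {x, y} := by
        intro v hv
        rw [mem_neighborFinset] at hv
        rcases hbd u hu v hv with h | h
        exacts [hempty h, h]
      have h4 := Finset.card_le_card h3
      have h5 := hdeg u
      rw [card_neighborFinset_eq_degree] at h4
      omega
    · intro u hu v huv
      have := hbd u (Finset.mem_sdiff.1 hu).1 v huv
      simp only [Finset.mem_insert, Finset.mem_singleton, Finset.mem_sdiff] at this ⊢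
      tauto
  obtain ⟨M₀, x₀, y₀, h₀⟩ := hside
  obtain ⟨M, x, y, h, -, hmin⟩ := h₀.exists_min _ subset_rfl
  by_cases hex : ∃ C L, CycleOn G (fun _ => (1 : ZMod 4)) C L ∧ 2 * L = 2 ∧ Disjoint C M
  · obtain ⟨C, L, h1, h2, h3⟩ := hex
    exact h.full_of_odd_cycle hK hdeg hmin h1 h2 h3
  -- The second minimal side and its boundary are disjoint from M, so an odd cycle inside them would
  -- be one avoiding M.
  obtain ⟨M', x', y', h', hM', hmin'⟩ := h.compl.exists_min _ subset_rfl
  by_cases hex' : ∃ C L, CycleOn G (fun _ => (1 : ZMod 4)) C L ∧ 2 * L = 2 ∧ Disjoint C M'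
  · obtain ⟨C, L, h1, h2, h3⟩ := hex'
    exact h'.full_of_odd_cycle hK hdeg hmin' h1 h2 h3
  refine h'.full_of_forall_not hK hdeg hmin' (fun C L h1 h2 h3 => hex ⟨C, L, h1, h2, ?_⟩)
    (fun C L h1 h2 h3 => hex' ⟨C, L, h1, h2, h3⟩) hC hL
  have hnot : ∀ m ∈ M', ∀ z, G.Adj m z → z ∉ M := by
    intro m hm z hmz hz
    have h4 := hM' hm
    simp only [Finset.mem_compl, Finset.mem_insert, not_or] at h4
    rcases h.nbr z hz m hmz.symm with h5 | h5 | h5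
    · exact h4.2.2 h5
    · exact h4.1 h5
    · exact h4.2.1 h5
  rw [Finset.disjoint_left]
  intro v hv
  have := h3 hv
  simp only [Finset.mem_insert] at this
  rcases this with rfl | rfl | hv
  · obtain ⟨m, hm, hadj⟩ := h'.exists_nbr_left hK
    exact hnot m hm _ hadj
  · obtain ⟨m, hm, hadj⟩ := h'.exists_nbr_right hK
    exact hnot m hm _ hadj
  · have := hM' hv
    simp only [Finset.mem_compl, Finset.mem_insert, not_or] at this
    exact this.2.2

end SimpleGraph

/-! ### Translation to walks, bipartiteness and connectedness. -/

namespace SimpleGraph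

variable {V : Type*} [DecidableEq V]

theorem Walk.IsPath.pathOn {M : Type*} [AddCommMonoid M] {G : SimpleGraph V} (w : Sym2 V → M)
    {a b : V} {p : G.Walk a b} (hp : p.IsPath) : ∃ n, PathOn G w p.support.toFinset a b n := by
  induction p with
  | nil => exact ⟨0, (PathOn.nil _).congr (by simp) rfl⟩
  | cons h p ih =>
    rw [Walk.cons_isPath_iff] at hp
    obtain ⟨n, hn⟩ := ih hp.1
    exact ⟨_, (PathOn.cons h (by simpa using hp.2) hn).congr (by simp) rfl⟩

theorem PathOn.exists_walk {M : Type*} [AddCommMonoid M] {G : SimpleGraph V} {w : Sym2 V → M}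
    {S : Finset V} {a b : V} {n : M} (h : PathOn G w S a b n) :
    ∃ p : G.Walk a b, p.IsPath ∧ p.support.toFinset = S := by
  induction h with
  | nil a => exact ⟨.nil, by simp, by simp⟩
  | cons hab ha hp ih =>
    obtain ⟨p, h1, h2⟩ := ih
    refine ⟨.cons hab p, ?_, by simp [h2]⟩
    rw [Walk.cons_isPath_iff, ← List.mem_toFinset, h2]
    exact ⟨h1, ha⟩

theorem Walk.IsPath.card_support {G : SimpleGraph V} {a b : V} {p : G.Walk a b} (hp : p.IsPath) :
    p.support.toFinset.card = p.length + 1 := by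
  rw [List.toFinset_card_of_nodup hp.support_nodup, Walk.length_support]

theorem hasCycleMod_iff {G : SimpleGraph V} {r : ℕ} :
    G.HasCycleMod r 4 ↔ ∃ S, CycleOn G (fun _ => (1 : ZMod 4)) S r := by
  constructor
  · rintro ⟨v, c, hc, hr⟩
    cases c with
    | nil => exact absurd rfl hc.ne_nil
    | cons h p =>
      have h3 := hc.three_le_length
      rw [Walk.cons_isCycle_iff] at hc
      obtain ⟨n, hn⟩ := hc.1.pathOn (fun _ => (1 : ZMod 4))
      have hcard := hc.1.card_support
      rw [Walk.length_cons] at h3 hr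
      have hcyc := CycleOn.of_path hn h (by omega)
      refine ⟨_, hcyc.congr rfl ?_⟩
      rw [hcyc.unit (fun _ _ _ _ _ => rfl), hcard]
      exact (ZMod.natCast_eq_natCast_iff _ _ _).2 hr
  · rintro ⟨S, h⟩
    have hr := h.unit (fun _ _ _ _ _ => rfl)
    obtain ⟨a, b, m, hba, hP, hS, -⟩ := h
    obtain ⟨p, hp, rfl⟩ := hP.exists_walk
    have hcard := hp.card_support
    refine ⟨b, .cons hba p, (Walk.cons_isCycle_iff _ _).2 ⟨hp, ?_⟩, ?_⟩
    · cases p with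
      | nil => simp at hS
      | cons h p =>
        rw [Walk.cons_isPath_iff] at hp
        rw [Walk.edges_cons, List.mem_cons, not_or]
        refine ⟨fun e => ?_, fun e => hp.2 (Walk.snd_mem_support_of_mem_edges _ e)⟩
        rcases Sym2.eq_iff.1 e with ⟨rfl, -⟩ | ⟨rfl, -⟩
        · exact hba.ne rfl
        · rw [(Walk.isPath_iff_nil.1 hp.1).eq_nil] at hS
          simp [h.ne] at hS
    · rw [Walk.length_cons, ← hcard]
      exact (ZMod.natCast_eq_natCast_iff _ _ _).1 hr.symm

/-- A walk has the parity of some path between its ends, unless the graph has an odd cycle. -/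
theorem Walk.exists_pathOn {G : SimpleGraph V}
    (hG : ∀ S n, CycleOn G (fun _ => (1 : ZMod 4)) S n → 2 * n = 0) {a b : V} (p : G.Walk a b) :
    ∃ S n, PathOn G (fun _ => (1 : ZMod 4)) S a b n ∧ 2 * n = 2 * (p.length : ZMod 4) := by
  induction p with
  | nil => exact ⟨_, _, .nil _, by simp⟩
  | @cons a a' b h p ih =>
    obtain ⟨S, n, hS, hn⟩ := ih
    rw [Walk.length_cons, Nat.cast_add, Nat.cast_one]
    -- The segment of the path up to `a` closes up with the new edge to a cycle or a doubled edge;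
    -- both are even, so it may be dropped.
    by_cases ha : a ∈ S
    · obtain ⟨S₁, S₂, n₁, n₂, h1, h2, -, -, rfl⟩ := hS.split ha
      refine ⟨S₂, n₂, h2, ?_⟩
      suffices 2 * (n₁ + 1) = 0 by
        linear_combination hn - this
      by_cases hc : 3 ≤ S₁.card
      · exact hG _ _ (CycleOn.of_path h1 h hc)
      · obtain ⟨-, -, rfl⟩ := h1.eq_pair (by omega) h.ne.symm
        rfl
    · exact ⟨_, _, .cons h ha hS, by linear_combination hn⟩

theorem exists_odd_cycle {G : SimpleGraph V} (hG : ¬ G.IsBipartite) :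
    ∃ C L, CycleOn G (fun _ => (1 : ZMod 4)) C L ∧ 2 * L = 2 := by
  by_contra hcon
  push Not at hcon
  refine hG (two_colorable_iff_forall_loop_even.2 fun u p => ?_)
  obtain ⟨S, n, hS, hn⟩ := p.exists_pathOn fun S n h =>
    (ZMod4.even_or_odd n).resolve_right (hcon S n h)
  rw [hS.eq_singleton.2, mul_zero] at hn
  have h4 : ((2 * p.length : ℕ) : ZMod 4) = 0 := by push_cast; exact hn.symm
  rw [ZMod.natCast_eq_zero_iff] at h4
  rw [even_iff_two_dvd]
  omega

theorem Walk.mem_of_closed {V : Type*} {G : SimpleGraph V} {M : Set V}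
    (hM : ∀ u ∈ M, ∀ v, G.Adj u v → v ∈ M) {a b : V} (p : G.Walk a b) (ha : a ∈ M) : b ∈ M := by
  induction p with
  | nil => exact ha
  | cons h p ih => exact ih (hM _ ha _ h)

/-- If X lies in M, then M is closed and connectedness applies. Otherwise X is a single vertex
outside M, and its deletion leaves a connected graph. -/
theorem TwoConnected.kConn {G : SimpleGraph V} (hG : G.TwoConnected) : KConn G 2 := by
  intro M X ⟨m, hm⟩ hbd ⟨v, hv, hvX⟩
  by_contra hlt
  by_cases hXM : X ⊆ M
  · obtain ⟨p⟩ := hG.2.1.preconnected m v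
    exact hv (p.mem_of_closed (M := M) (fun u hu z hz => (hbd u hu z hz).elim id (@hXM z)) hm)
  · obtain ⟨c, hcX, hcM⟩ := Finset.not_subset.1 hXM
    have hX : ∀ z ∈ X, z = c := fun z hz => Finset.card_le_one.1 (by omega) z hz c hcX
    obtain ⟨p⟩ := (hG.2.2 c).preconnected ⟨m, fun e => hcM (e ▸ hm)⟩ ⟨v, fun e => hvX (e ▸ hcX)⟩
    refine hv (p.mem_of_closed (M := Subtype.val ⁻¹' (M : Set V)) (fun u hu z hz => ?_) hm)
    exact (hbd u.1 hu z.1 hz).resolve_right fun h => z.2 (hX _ h)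

theorem hasCyclesOfAllLengthsMod_iff [Fintype V] {G : SimpleGraph V} [DecidableRel G.Adj]
    (hG : G.TwoConnected) (hb : ¬ G.IsBipartite) (hdeg : 4 ≤ G.minDegree) :
    G.HasCyclesOfAllLengthsMod 4 ↔ ¬ Nonempty (G ≃g completeGraph (Fin 5)) := by
  constructor
  · rintro h ⟨e⟩
    -- A cycle on five vertices has length 3, 4 or 5, never 2 modulo 4.
    obtain ⟨S, hS⟩ := hasCycleMod_iff.1 (h 2)
    have h1 := hS.unit (fun _ _ _ _ _ => rfl)
    have h2 := hS.three_le_card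
    have h3 := S.card_le_univ
    rw [Fintype.card_congr e.toEquiv, Fintype.card_fin] at h3
    rw [ZMod.natCast_eq_natCast_iff, Nat.ModEq] at h1
    omega
  · intro h r
    obtain ⟨C, L, hC, hL⟩ := exists_odd_cycle hb
    rcases full_or_complete hG.kConn (fun v => hdeg.trans (G.minDegree_le_degree v)) hC hL with
      hF | ⟨h5, hadj⟩
    · exact hasCycleMod_iff.2 (hF r)
    · exact absurd ⟨⟨Fintype.equivFinOfCardEq h5, fun {u v} => by
        simpa [completeGraph] using ⟨fun huv => hadj u v huv, fun huv => huv.ne⟩⟩⟩ h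

end SimpleGraph

/-! ### The graphs H_t of minimum degree three. -/

namespace SimpleGraph

theorem graphH_adj {t : ℕ} {x y : Bool × Fin (2 * t + 2)} :
    (graphH t).Adj x y ↔ graphHRel t x y ∨ graphHRel t y x := by
  rw [graphH, fromRel_adj]
  refine ⟨fun h => h.2, fun h => ⟨?_, h⟩⟩
  rintro rfl
  simp [graphHRel] at h

/-- Consecutive columns, joined in the same row or from an even column to the next. -/
def LadderStep {n : ℕ} (x y : Bool × Fin n) : Prop :=
  x.2.val + 1 = y.2.val ∧ (x.1 = y.1 ∨ Even x.2.val)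

/-- The graph of all ladder steps. -/
def ladder (n : ℕ) : SimpleGraph (Bool × Fin n) where
  Adj x y := LadderStep x y ∨ LadderStep y x
  symm := ⟨fun _ _ h => h.symm⟩
  loopless := ⟨fun x h => by simp [LadderStep] at h⟩

theorem eq_or_eq_of_snd_eq {α : Type*} {x y v : Bool × α} (hxy : x ≠ y) (h : x.2 = y.2)
    (hv : v.2 = x.2) : v = x ∨ v = y := by
  obtain ⟨v1, v2⟩ := v
  obtain ⟨x1, x2⟩ := x
  obtain ⟨y1, y2⟩ := y
  dsimp only at h hv
  subst h hv
  cases v1 <;> cases x1 <;> cases y1 <;> simp at hxy ⊢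

section Ladder

variable {n : ℕ} {S : Finset (Bool × Fin n)}
  {x y : Bool × Fin n} {m : ZMod 4}

theorem PathOn.ladder_parity (h : PathOn (ladder n) (fun _ => (1 : ZMod 4)) S x y m) :
    2 * m = 2 * ((x.2.val : ZMod 4) + y.2.val) := by
  induction h with
  | nil a => linear_combination -(a.2.val : ZMod 4) * ZMod4.four_eq_zero
  | @cons S a b c m hab ha hp ih =>
    rcases hab with ⟨h, -⟩ | ⟨h, -⟩ <;> have h' := congrArg (Nat.cast (R := ZMod 4)) h <;>
      push_cast at h'
    · linear_combination ih - 2 * h' + ZMod4.four_eq_zero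
    · linear_combination ih + 2 * h'

theorem CycleOn.ladder_parity (h : CycleOn (ladder n) (fun _ => (1 : ZMod 4)) S m) : 2 * m = 0 := by
  obtain ⟨a, b, m, hba, hP, -, rfl⟩ := h
  have h1 := hP.ladder_parity
  rcases hba with ⟨h, -⟩ | ⟨h, -⟩ <;> have h' := congrArg (Nat.cast (R := ZMod 4)) h <;>
      push_cast at h'
  · linear_combination h1 - 2 * h' + (b.2.val + 1 : ZMod 4) * ZMod4.four_eq_zero
  · linear_combination h1 - 2 * h' + (a.2.val + 1 : ZMod 4) * ZMod4.four_eq_zero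

/-- Both ends of the path step to the next column. Either they meet there, or both go straight on to
the two vertices of the next even column. Four edges vanish modulo 4, and induction applies to the
path between. -/
theorem PathOn.ladder_length (h : PathOn (ladder n) (fun _ => (1 : ZMod 4)) S x y m) (hxy : x ≠ y) (hcol : x.2 = y.2)
    (hx : Even x.2.val) (hS : ∀ v ∈ S, x.2 ≤ v.2) : m = 2 := by
  induction hk : S.card using Nat.strong_induction_on generalizing S x y m with
  | _ k ih =>
  have hall := fun v => eq_or_eq_of_snd_eq (v := v) hxy hcol
  obtain ⟨c, R, m₁, hxc, hxR, hR, rfl, rfl⟩ := h.first hxy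
  have hcy : c ≠ y := by
    rintro rfl
    rcases hxc with ⟨h, -⟩ | ⟨h, -⟩ <;> rw [hcol] at h <;> omega
  obtain ⟨d, Q, m₂, hdy, hyQ, hQ, rfl, rfl⟩ := hR.last hcy
  have hcol2 : ∀ v ∈ Q, x.2.val < v.2.val := by
    intro v hv
    refine lt_of_le_of_ne (hS v (by simp [hv])) fun e => ?_
    rcases hall v (Fin.ext e.symm) with rfl | rfl
    · exact hxR (by simp [hv])
    · exact hyQ hv
  have hc := hcol2 c hQ.left_mem
  have hd := hcol2 d hQ.right_mem
  have hc1 : c.2.val = x.2.val + 1 := by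
    rcases hxc with ⟨h, -⟩ | ⟨h, -⟩ <;> omega
  have hd1 : d.2.val = x.2.val + 1 := by
    rcases hdy with ⟨h, -⟩ | ⟨h, -⟩ <;> rw [← hcol] at h <;> omega
  by_cases hcd : c = d
  · subst hcd
    rw [hQ.eq_singleton.2]
    rfl
  have hodd : ∀ v : ℕ, v = x.2.val + 1 → ¬ Even v := by
    rintro _ rfl; rw [Nat.not_even_iff_odd]; exact hx.add_one
  -- The column of `x` is used up by `x` and `y`, and an odd column continues only within the rows.
  have hnext : ∀ c ∈ Q, c.2.val = x.2.val + 1 → ∀ e ∈ Q, (ladder n).Adj c e → e = (c.1, e.2) ∧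
      e.2.val = x.2.val + 2 := by
    intro c _ hc1 e he hce
    have he1 := hcol2 e he
    rcases hce with ⟨h1, h2 | h2⟩ | ⟨h1, h2 | h2⟩
    · exact ⟨by rw [h2], by omega⟩
    · exact absurd h2 (hodd _ hc1)
    · omega
    · omega
  obtain ⟨e, T, m₃, hce, hcT, hT, rfl, rfl⟩ := hQ.first hcd
  obtain ⟨he1, he2⟩ := hnext c (by simp) hc1 e (by simp [hT.left_mem]) hce
  have hed : e ≠ d := by rintro rfl; omega
  obtain ⟨f, U, m₄, hfd, hdU, hU, rfl, rfl⟩ := hT.last hed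
  obtain ⟨hf1, hf2⟩ := hnext d (by simp) hd1 f (by simp [hU.right_mem]) hfd.symm
  have hef : e ≠ f := by
    rintro rfl
    apply hcd
    rw [hf1] at he1
    exact Prod.ext (congrArg Prod.fst he1).symm (Fin.ext (by omega))
  have := ih U.card (by
    rw [← hk]
    apply Finset.card_lt_card
    refine Finset.ssubset_iff.2 ⟨x, fun hx => hxR (by simp [hx]), ?_⟩
    intro z hz
    simp only [Finset.mem_insert] at hz ⊢
    tauto) hU hef (Fin.ext (by omega)) (by rw [he2]; exact hx.add even_two) (by
      intro v hv
      rw [Fin.le_def]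
      have h1 := hcol2 v (by simp [hv])
      by_contra hlt
      have hv1 : v.2 = c.2 := Fin.ext (by omega)
      rcases eq_or_eq_of_snd_eq hcd (Fin.ext (by omega)) hv1 with rfl | rfl
      · exact hcT (by simp [hv])
      · exact hdU hv) rfl
  rw [this]
  rfl

end Ladder

/-- As the last column has odd index, reflection maps a step starting in an even column to another
such step reversed. This transfers the length statement to the last column. -/
theorem ladder_adj_rev {t : ℕ} {x y : Bool × Fin (2 * t + 2)} (h : (ladder _).Adj x y) :
    (ladder (2 * t + 2)).Adj (x.1, x.2.rev) (y.1, y.2.rev) := by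
  have key : ∀ x y : Bool × Fin (2 * t + 2), LadderStep x y →
      LadderStep (y.1, y.2.rev) (x.1, x.2.rev) := by
    rintro ⟨x1, x2⟩ ⟨y1, y2⟩ ⟨h1, h2⟩
    refine ⟨?_, h2.imp Eq.symm fun h => ?_⟩ <;> dsimp only at *
    · simp only [Fin.val_rev]
      omega
    · simp only [Fin.val_rev, Nat.even_iff] at h ⊢
      omega
  exact h.symm.imp (key _ _) (key _ _)

theorem PathOn.ladder_rev {t : ℕ} {S : Finset (Bool × Fin (2 * t + 2))} {x y} {m : ZMod 4}
    (h : PathOn (ladder _) (fun _ => (1 : ZMod 4)) S x y m) :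
    ∃ S, PathOn (ladder (2 * t + 2)) (fun _ => (1 : ZMod 4)) S (x.1, x.2.rev) (y.1, y.2.rev) m :=
  ⟨_, h.map (AddMonoidHom.id _) ((Equiv.prodCongr (Equiv.refl Bool) Fin.revPerm).toEmbedding)
    fun _ _ _ _ h => ⟨ladder_adj_rev h, rfl⟩⟩

/-- Removing its two vertical edges leaves a subgraph of the ladder. -/
theorem graphH_deleteEdges_le (t : ℕ) :
    ((graphH t).deleteEdges {s((false, 0), (true, 0))}).deleteEdges
      {s((false, Fin.last _), (true, Fin.last _))} ≤ ladder _ := by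
  intro x y h
  simp only [deleteEdges_adj, Set.mem_singleton_iff, graphH_adj] at h
  obtain ⟨⟨h, h1⟩, h2⟩ := h
  have hvert : ∀ x y : Bool × Fin (2 * t + 2), s(x, y) ≠ s((false, 0), (true, 0)) →
      s(x, y) ≠ s((false, Fin.last _), (true, Fin.last _)) → graphHRel t x y → LadderStep x y := by
    rintro ⟨x1, x2⟩ ⟨y1, y2⟩ h1 h2 (⟨h3, h4⟩ | ⟨h3, h4, h5⟩ | ⟨h3, h4, h5⟩)
    · exact ⟨h4, .inl h3⟩
    · exact ⟨h5, .inr h4⟩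
    · dsimp only at *
      subst h4
      rcases h5 with h5 | h5
      · obtain rfl : x2 = 0 := Fin.ext h5
        cases x1 <;> cases y1 <;> simp_all
      · obtain rfl : x2 = Fin.last _ := Fin.ext h5
        cases x1 <;> cases y1 <;> simp_all
  exact h.imp (hvert x y h1 h2) (hvert y x (by rwa [Sym2.eq_swap]) (by rwa [Sym2.eq_swap]))

/-- With no vertical edge a cycle lies in the bipartite ladder. With exactly one, the rest is a path
of length 2 modulo 4, so the total is 3. With both, two paths between the end columns remain, of
equal parity, so the total is even. -/
theorem not_hasCycleMod_graphH (t : ℕ) : ¬ (graphH t).HasCycleMod 1 4 := by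
  rw [hasCycleMod_iff]
  rintro ⟨S, hS⟩
  have hle := graphH_deleteEdges_le t
  have hpath : ∀ {S x y m}, PathOn (((graphH t).deleteEdges {s((false, 0), (true, 0))}).deleteEdges
      {s((false, Fin.last _), (true, Fin.last _))}) (fun _ => (1 : ZMod 4)) S x y m →
      PathOn (ladder _) (fun _ => (1 : ZMod 4)) S x y m :=
    fun h => h.graphMap fun _ _ _ _ h => hle h
  have hne : (1 : ZMod 4) ≠ 2 + 1 := by decide
  have hodd : (2 : ZMod 4) ≠ 0 := by decide
  rw [Nat.cast_one] at hS
  rcases hS.deleteEdge (false, 0) (true, 0) with hS | ⟨m, -, hS, hm⟩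
  · rcases hS.deleteEdge (false, Fin.last _) (true, Fin.last _) with hS | ⟨m, -, hS, hm⟩
    · obtain ⟨a, b, m, hba, hP, hc, h1⟩ := hS
      have := CycleOn.ladder_parity ⟨a, b, m, hle hba, hpath hP, hc, h1⟩
      exact hodd (by rwa [mul_one] at this)
    · obtain ⟨S, hS⟩ := (hpath hS).ladder_rev
      refine hne (hm.trans ?_)
      rw [hS.ladder_length (by simp) rfl (by simp) (by simp)]
  · rcases hS.deleteEdge (false, Fin.last _) (true, Fin.last _) with
      hS | ⟨x, y, S₁, S₂, n₁, n₂, h1, -, h2, h3, -, -, rfl⟩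
    · refine hne (hm.trans ?_)
      rw [(hpath hS).ladder_length (by simp) rfl (by simp) (by simp)]
    · have h4 := (hpath h2).ladder_parity
      have h5 := (hpath h3).ladder_parity
      have h6 : x.2 = Fin.last _ ∧ y.2 = Fin.last _ := by
        rcases Sym2.eq_iff.1 h1 with ⟨rfl, rfl⟩ | ⟨rfl, rfl⟩ <;> exact ⟨rfl, rfl⟩
      rw [h6.1] at h4
      rw [h6.2] at h5
      apply hodd
      simp only [Fin.val_zero, Nat.cast_zero] at h4 h5
      linear_combination 2 * hm + h4 + h5 + (((Fin.last (2 * t + 1)).val : ZMod 4) + 1) *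
        ZMod4.four_eq_zero

theorem not_isBipartite_graphH (t : ℕ) : ¬ (graphH t).IsBipartite := by
  rintro ⟨c⟩
  -- The first column and one vertex of the second form a triangle.
  have h1 := c.valid (graphH_adj.2 (.inl (.inr (.inr ⟨by simp, rfl, .inl rfl⟩))) :
    (graphH t).Adj (false, 0) (true, 0))
  have h2 := c.valid (graphH_adj.2 (.inl (.inl ⟨rfl, by simp⟩)) :
    (graphH t).Adj (false, 0) (false, 1))
  have h3 := c.valid (graphH_adj.2 (.inl (.inr (.inl ⟨by simp, by simp, by simp⟩))) :
    (graphH t).Adj (true, 0) (false, 1))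
  omega

theorem graphH_row_reachable {t : ℕ} {s : Set (Bool × Fin (2 * t + 2))} {b : Bool}
    (hs : ∀ i, (b, i) ∈ s) (i : ℕ) (hi : i < 2 * t + 2) :
    ((graphH t).induce s).Reachable ⟨(b, 0), hs 0⟩ ⟨(b, ⟨i, hi⟩), hs _⟩ := by
  induction i with
  | zero => exact .rfl
  | succ i ih =>
    refine (ih (by omega)).trans (Adj.reachable ?_)
    exact graphH_adj.2 (.inl (.inl ⟨rfl, rfl⟩))

theorem graphH_exists_adj {t : ℕ} (b : Bool) (i : Fin (2 * t + 2)) :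
    ∃ j, (graphH t).Adj (!b, i) (b, j) := by
  rcases Nat.even_or_odd i.val with h | h
  · refine ⟨⟨i.val + 1, by have := i.2; rw [Nat.even_iff] at h; omega⟩, graphH_adj.2 (.inl ?_)⟩
    exact .inr (.inl ⟨by simp, h, rfl⟩)
  · have h' := Nat.odd_iff.1 h
    refine ⟨⟨i.val - 1, by have := i.2; omega⟩, graphH_adj.2 (.inr (.inr (.inl ⟨by simp, ?_, ?_⟩)))⟩
    · exact Nat.even_iff.2 (by dsimp only; omega)
    · dsimp only; omega

/-- One complete row is connected, and every vertex of the other row has a neighbour in it. This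
covers the whole graph and the deletion of any single vertex. -/
theorem graphH_induce_connected {t : ℕ} {s : Set (Bool × Fin (2 * t + 2))} {b : Bool}
    (hs : ∀ i, (b, i) ∈ s) : ((graphH t).induce s).Connected := by
  have key : ∀ x : s, ((graphH t).induce s).Reachable ⟨(b, 0), hs 0⟩ x := by
    rintro ⟨⟨c, i⟩, hx⟩
    by_cases hc : c = b
    · subst hc
      exact graphH_row_reachable hs i.1 i.2
    · obtain rfl : c = !b := by cases c <;> cases b <;> simp_all
      obtain ⟨j, hj⟩ := graphH_exists_adj b i
      exact (graphH_row_reachable hs j.1 j.2).trans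
        (Adj.reachable (G := (graphH t).induce s) (v := ⟨(!b, i), hx⟩) hj.symm)
  have : Nonempty s := ⟨⟨(b, 0), hs 0⟩⟩
  exact ⟨fun x y => (key x).symm.trans (key y)⟩

theorem twoConnected_graphH (t : ℕ) : (graphH t).TwoConnected := by
  refine ⟨?_, ?_, ?_⟩
  · rw [ENat.card_eq_coe_fintype_card, Fintype.card_prod, Fintype.card_bool, Fintype.card_fin]
    exact_mod_cast (by omega : 3 ≤ 2 * (2 * t + 2))
  · exact (induceUnivIso _).connected_iff.1 (graphH_induce_connected (b := true) fun i => trivial)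
  · rintro ⟨b, i⟩
    exact graphH_induce_connected (b := !b) fun j => by simp

theorem degree_graphH {t : ℕ} (x : Bool × Fin (2 * t + 2)) : (graphH t).degree x = 3 := by
  obtain ⟨b, i, hi⟩ := x
  have key : ∀ (c d e : Bool × Fin (2 * t + 2)), c ≠ d → c ≠ e → d ≠ e →
      (∀ y, (graphH t).Adj (b, ⟨i, hi⟩) y ↔ y = c ∨ y = d ∨ y = e) →
      (graphH t).degree (b, ⟨i, hi⟩) = 3 := by
    intro c d e h1 h2 h3 h
    rw [← card_neighborFinset_eq_degree, Finset.card_eq_three]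
    exact ⟨c, d, e, h1, h2, h3, by ext y; simp [h]⟩
  rcases Nat.even_or_odd i with h | h
  · have h' := Nat.even_iff.1 h
    rcases Nat.eq_zero_or_pos i with rfl | hpos
    · refine key (b, ⟨1, by omega⟩) (!b, ⟨1, by omega⟩) (!b, ⟨0, by omega⟩) (by simp) (by simp)
        (by simp) ?_
      rintro ⟨c, j, hj⟩
      simp only [graphH_adj, graphHRel, Prod.mk.injEq, Fin.mk.injEq, Nat.even_iff]
      cases b <;> cases c <;> simp <;> omega
    · refine key (b, ⟨i + 1, by omega⟩) (!b, ⟨i + 1, by omega⟩) (b, ⟨i - 1, by omega⟩) (by simp)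
        (by simp; omega) (by simp) ?_
      rintro ⟨c, j, hj⟩
      simp only [graphH_adj, graphHRel, Prod.mk.injEq, Fin.mk.injEq, Nat.even_iff]
      cases b <;> cases c <;> simp <;> omega
  · have h' := Nat.odd_iff.1 h
    by_cases hlast : i = 2 * t + 1
    · refine key (b, ⟨i - 1, by omega⟩) (!b, ⟨i - 1, by omega⟩) (!b, ⟨i, by omega⟩) (by simp)
        (by simp) (by simp; omega) ?_
      rintro ⟨c, j, hj⟩
      simp only [graphH_adj, graphHRel, Prod.mk.injEq, Fin.mk.injEq, Nat.even_iff]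
      cases b <;> cases c <;> simp <;> omega
    · refine key (b, ⟨i - 1, by omega⟩) (!b, ⟨i - 1, by omega⟩) (b, ⟨i + 1, by omega⟩) (by simp)
        (by simp) (by simp) ?_
      rintro ⟨c, j, hj⟩
      simp only [graphH_adj, graphHRel, Prod.mk.injEq, Fin.mk.injEq, Nat.even_iff]
      cases b <;> cases c <;> simp <;> omega

theorem minDegree_graphH (t : ℕ) : (graphH t).minDegree = 3 :=
  le_antisymm ((minDegree_le_degree _ (false, 0)).trans (degree_graphH _).le)
    (le_minDegree_of_forall_le_degree _ _ fun x => (degree_graphH x).ge)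

end SimpleGraph

theorem theorem6 :
    (∀ (V : Type*) [Fintype V] (G : SimpleGraph V) [DecidableRel G.Adj],
      G.TwoConnected → ¬ G.IsBipartite → 4 ≤ G.minDegree →
        (G.HasCyclesOfAllLengthsMod 4 ↔ ¬ Nonempty (G ≃g SimpleGraph.completeGraph (Fin 5)))) ∧
    (∀ t : ℕ, 1 ≤ t →
      (graphH t).TwoConnected ∧ ¬ (graphH t).IsBipartite ∧ (graphH t).minDegree = 3 ∧
        ¬ (graphH t).HasCycleMod 1 4) := by
  classical
  exact ⟨fun V _ G _ hG hb hdeg => SimpleGraph.hasCyclesOfAllLengthsMod_iff hG hb hdeg,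
    fun t _ => ⟨SimpleGraph.twoConnected_graphH t, SimpleGraph.not_isBipartite_graphH t,
      SimpleGraph.minDegree_graphH t, SimpleGraph.not_hasCycleMod_graphH t⟩⟩
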